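/- \textbf{Setting.} Let $S=S(x)$ be a curve on the unit sphere $|S|=1$ in $\mathbb{R}^3$. A \emph{differential function} is a smooth function of $x$ and finitely many of $S,S_x,S_{xx},\dots$, considered modulo the differential consequences of $S\cdot S=1$ (i.e. evaluated along smooth curves on the sphere). $D_x$ is the total derivative, and $D_x^{-1}g$ is the differential function $p$ with $D_xp=g$ whose integration constant is fixed by $p=0$ at constant $S$. A functional $\mathfrak F=\int F\,dx$ is a differential function $F$ modulo total $x$-derivatives; its variational derivative $\delta F/\delta S$ is the representative orthogonal to $S$ (it is determined by $\delta F\equiv\delta S\cdot\delta F/\delta S$ modulo total $x$-derivatives and $S\cdot\delta S=0$). Put $$f^{(n)}=\bigl(S\wedge D_x-S_xD_x^{-1}(S\wedge S_x)\cdot\bigr)^nS_x,\qquad H^{(n)}=\tfrac1{1+n}D_x^{-1}\bigl(S_x\cdot D_xf^{(n)}\bigr),\qquad n=0,1,2,\dots .$$ An operator $\mathcal D$ is \emph{Hamiltonian} if $\{\mathfrak F,\mathfrak G\}=\int \mathcal D(\delta F/\delta S)\cdot\delta G/\delta S\,dx$ is a skew-symmetric bracket that satisfies the Jacobi identity on the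 functionals $\mathfrak F$ for which $\mathcal D(\delta F/\delta S)$ is a differential function; these are required to include all functionals with $x$-independent density and to be closed under the bracket, and the vector fields $\mathcal D(\delta F/\delta S)$ are required to be tangent to the sphere. (In these brackets, and in the symplectic forms below, $D_x^{-1}$ may be any primitive that is a differential function.) Two Hamiltonian operators are \emph{compatible} if all their real linear combinations are Hamiltonian. \textbf{Theorem.} All $f^{(n)}$ and $H^{(n)}$ are well-defined differential functions (all the $D_x^{-1}$ above and below exist), and: (1) The vector models $S_t=f^{(n)}$ have the two Hamiltonian structures $$S_t=-S\wedge\frac{\delta H^{(n-1)}}{\delta S}=f^{(n)}\quad(n\ge1),\qquad S_t=D_x\Bigl(\frac{\delta H^{(n-2)}}{\delta S}+S\,D_x^{-1}\bigl(S_x\cdot\frac{\delta H^{(n-2)}}{\delta S}\bigr)\Bigr)=f^{(n)}\quad(n\ge2),$$ and $S\wedge$ and $D_x+S\,S_x\cdot+S_xD_x^{-1}S_x\cdot$ are a compatible pair of Hamiltonian operators. (2) Let $\gamma(x)$ be a curve on the unit sphere ${\rm S}^2\subset\mathbb{R}^3$ with its metric $g$, covariant derivative $\nabla_x$ (the tangential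 part of $D_x$) and complex structure $J=\gamma\wedge$, and put $F^{(n)}=(J\nabla_x-\gamma_xD_x^{-1}g(J\gamma_x,\cdot))^n\gamma_x$, $H^{(n)}=\frac1{1+n}D_x^{-1}g(\gamma_x,\nabla_xF^{(n)})$; again all the $D_x^{-1}$ exist. Then the map equations $\gamma_t=F^{(n)}$ have the two Hamiltonian structures $$\gamma_t=-J\frac{\delta H^{(n-1)}}{\delta\gamma}=F^{(n)}\quad(n\ge1),\qquad \gamma_t=\nabla_x\frac{\delta H^{(n-2)}}{\delta\gamma}+\gamma_xD_x^{-1}g\bigl(\gamma_x,\frac{\delta H^{(n-2)}}{\delta\gamma}\bigr)=F^{(n)}\quad(n\ge2),$$ where $\delta H/\delta\gamma$ is the $g$-gradient, and $J$ and $\nabla_x+\gamma_xD_x^{-1}g(\gamma_x,\cdot)$ are a compatible pair of Hamiltonian operators. (3) For a complex function $u(x)$ and with $\mathcal C$ complex conjugation, let $\mathcal I=-i$, $\mathcal R^*=iD_x-uD_x^{-1}{\rm Re}(iu\,\mathcal C)$ and $\mathcal J=D_x+uD_x^{-1}{\rm Re}(u\,\mathcal C)$. Then $\mathcal J=-\mathcal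 R^*\mathcal I^{-1}$, and $-\mathcal I^{-1}$, $\mathcal J$ are a compatible pair of symplectic operators: every real linear combination $\mathcal K$ of them defines a skew-symmetric closed 2-form $\omega(\xi,\eta)=\int{\rm Re}(\bar\xi\,\mathcal K\eta)\,dx$ on those evolutionary vector fields $\xi\,\partial/\partial u$, with $\xi$ a differential function of $u$, for which $\mathcal K\xi$ is a differential function, and these are closed under commutators. Moreover $\varpi^{(n)}=\mathcal R^{*n}(u)$ is a well-defined differential function of $u$ for all $n\ge0$ (with $D_x^{-1}$ normalised to vanish at $u=0$). (4) Let $S=\gamma$ be a smooth curve on the unit sphere with a smooth positively oriented orthonormal parallel frame $E^\perp=N_1+iN_2$ and complex function $u$, so that $S_x={\rm Re}(\bar uE^\perp)$ and $E^\perp_x=-uS$. Then $\xi\mapsto{\rm Re}(\bar E^\perp\xi)$ is a bijection from the smooth complex functions onto the smooth vector fields along $S$ orthogonal to $S$; it takes ${\rm Re}(\bar\xi\eta)$ to the Euclidean inner product; it takes $-\mathcal I^{-1}$ to $-S\wedge$ and to $-J$; and it takes $\mathcal J$ to $D_x+S\,S_x\cdot+S_xD_x^{-1}S_x\cdot$ and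 to $\nabla_x+\gamma_xD_x^{-1}g(\gamma_x,\cdot)$ (with the same value of the integral on both sides). It takes $\varpi^{(n)}$ to $f^{(n)}$ and to $F^{(n)}$, and $-\mathcal I\varpi^{(n+1)}$ (minus the $n$-th flow vector field $u_t=\mathcal I\varpi^{(n+1)}$) to $\delta H^{(n)}/\delta S$ and to $\delta H^{(n)}/\delta\gamma$, for all $n\ge0$. -/

import Mathlib

open scoped ContDiff

noncomputable section

namespace SpinHierarchy

/-! ### Differential functions on jet space -/

section Jets

variable {V W : Type*} [NormedAddCommGroup V] [InnerProductSpace ℝ V] [CompleteSpace V]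
  [NormedAddCommGroup W] [NormedSpace ℝ W]

/-- A function of `x` and of the jet variables `s 0 = c, s 1 = c_x, s 2 = c_xx, …` of a
curve `c` in `V`. -/
abbrev DFun (V W : Type*) := ℝ → (ℕ → V) → W

/-- `φ` is a smooth function of `x` and of finitely many of the jet variables. -/
def IsDFun (φ : DFun V W) : Prop :=
  ∃ (n : ℕ) (g : ℝ × (Fin n → V) → W), ContDiff ℝ ∞ g ∧
    ∀ x s, φ x s = g (x, fun i => s i)

/-- The jet `(c, c_x, c_xx, …)` of a curve `c` at `x`. -/
def jet (c : ℝ → V) (x : ℝ) : ℕ → V := fun k => iteratedDeriv k c x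

/-- The value `φ(x, c, c_x, c_xx, …)` of `φ` along a curve `c`. -/
def ev (φ : DFun V W) (c : ℝ → V) : ℝ → W := fun x => φ x (jet c x)

/-- The total derivative `D_x`. -/
def totalD (φ : DFun V W) : DFun V W := fun x s =>
  deriv (fun t : ℝ => φ (x + t) (fun k => s k + t • s (k + 1))) 0

/-- The derivative of `φ` along the evolutionary vector field `ξ`, that is, the derivative of
`φ(x, c, c_x, …)` under the infinitesimal variation `δc = ξ`. -/
def evol (ξ : DFun V V) (φ : DFun V W) : DFun V W := fun x s =>
  deriv (fun t : ℝ => φ x (fun k => s k + t • (totalD^[k] ξ) x s)) 0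

/-- The gradient of `φ` in the `k`-th jet variable. -/
def jetGrad (k : ℕ) (φ : DFun V ℝ) : DFun V V := fun x s =>
  gradient (fun v => φ x (Function.update s k v)) (s k)

/-- The Euler operator `∑ₖ (-D_x)^k ∂/∂c^{(k)}`. -/
def euler (φ : DFun V ℝ) : DFun V V := fun x s =>
  ∑ᶠ k : ℕ, (-1 : ℝ) ^ k • (totalD^[k] (jetGrad k φ)) x s

/-- Equality of `φ` and `ψ` along all curves of the class `𝒞`. -/
def EqAlong (𝒞 : Set (ℝ → V)) (φ ψ : DFun V W) : Prop :=
  ∀ c ∈ 𝒞, ev φ c = ev ψ c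

/-- `p` is a differential function with `D_x p = g` along all curves of the class `𝒞`. -/
def IsPrimitive (𝒞 : Set (ℝ → V)) (g p : DFun V ℝ) : Prop :=
  IsDFun p ∧ ∀ c ∈ 𝒞, ∀ x, HasDerivAt (ev p c) (ev g c x) x

/-- `g` is a total `x`-derivative, that is, `∫ g dx = 0` as a functional. -/
def IsTotal (𝒞 : Set (ℝ → V)) (g : DFun V ℝ) : Prop := ∃ p, IsPrimitive 𝒞 g p

/-- `p = D_x⁻¹ g` without integration constant: `p` vanishes along the vacuum curves `ℬ`. -/
def IsInvD (𝒞 ℬ : Set (ℝ → V)) (g p : DFun V ℝ) : Prop :=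
  IsPrimitive 𝒞 g p ∧ ∀ c ∈ ℬ, ∀ x, ev p c x = 0

open Classical in
/-- `D_x⁻¹ g`, if it exists as a differential function (and `0` otherwise). -/
def invD (𝒞 ℬ : Set (ℝ → V)) (g : DFun V ℝ) : DFun V ℝ :=
  if h : ∃ p, IsInvD 𝒞 ℬ g p then h.choose else fun _ _ => 0

/-- An operator, depending on a curve `c` and possibly containing one integral: `A c a p b` says
that `b = A_c(a)`, where `p` is the value of the integral `D_x⁻¹(…)` that occurs in `A_c(a)`. -/
abbrev CurveOp (V : Type*) := (ℝ → V) → (ℝ → V) → (ℝ → ℝ) → (ℝ → V) → Prop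

/-- The linear combination `α A + β B`. -/
def comb (α : ℝ) (A : CurveOp V) (β : ℝ) (B : CurveOp V) : CurveOp V := fun c a p b =>
  ∃ b₁ b₂, A c a p b₁ ∧ B c a p b₂ ∧ ∀ x, b x = α • b₁ x + β • b₂ x

/-- `w = A(v)` for differential functions `v`, `w` (the integral in `A(v)` being a differential
function as well). -/
def Acts (𝒞 : Set (ℝ → V)) (A : CurveOp V) (v w : DFun V V) : Prop :=
  IsDFun w ∧ ∃ p : DFun V ℝ, IsDFun p ∧ ∀ c ∈ 𝒞, A c (ev v c) (ev p c) (ev w c)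

end Jets

/-! ### The vector models -/

abbrev Vec3 := EuclideanSpace ℝ (Fin 3)

/-- The vector product in Euclidean space. -/
def cross (a b : Vec3) : Vec3 := WithLp.toLp 2 (crossProduct a.ofLp b.ofLp)

/-- The orthogonal projection of `w` to the tangent plane of the unit sphere at `c`. -/
def tproj (c w : Vec3) : Vec3 := w - inner ℝ c w • c

/-- The smooth curves on the unit sphere. -/
def sphereCurves : Set (ℝ → Vec3) := {S | ContDiff ℝ ∞ S ∧ ∀ x, ‖S x‖ = 1}

/-- The constant curves on the unit sphere. -/
def sphereVacuum : Set (ℝ → Vec3) := {S | ∃ e : Vec3, ‖e‖ = 1 ∧ S = fun _ => e}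

/-- `D_x⁻¹` on differential functions of `S`, `|S| = 1`. -/
def spinInvD (g : DFun Vec3 ℝ) : DFun Vec3 ℝ := invD sphereCurves sphereVacuum g

/-- `D_x⁻¹ g` exists as a differential function of `S`, `|S| = 1`. -/
def HasSpinInvD (g : DFun Vec3 ℝ) : Prop := ∃ p, IsInvD sphereCurves sphereVacuum g p

/-- The variational derivative `δF/δS` of the functional `∫ F dx`, determined modulo
`S · δS = 0`: the representative that is orthogonal to `S`. -/
def varS (F : DFun Vec3 ℝ) : DFun Vec3 Vec3 := fun x s => tproj (s 0) (euler F x s)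

/-- `f^{(n)} = (S ∧ D_x - S_x D_x⁻¹ (S ∧ S_x)·)^n S_x`. -/
def spinFlow : ℕ → DFun Vec3 Vec3
  | 0 => fun _ s => s 1
  | n + 1 => fun x s => cross (s 0) (totalD (spinFlow n) x s)
      - spinInvD (fun y r => inner ℝ (cross (r 0) (r 1)) (spinFlow n y r)) x s • s 1

/-- `H^{(n)} = (1+n)⁻¹ D_x⁻¹ (S_x · D_x f^{(n)})`. -/
def spinHam (n : ℕ) : DFun Vec3 ℝ := fun x s =>
  ((n : ℝ) + 1)⁻¹ * spinInvD (fun y r => inner ℝ (r 1) (totalD (spinFlow n) y r)) x s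

/-- The operator `S ∧`. -/
def spinOp₁ : CurveOp Vec3 := fun S a _ b => ∀ x, b x = cross (S x) (a x)

/-- The operator `D_x + S S_x· + S_x D_x⁻¹ S_x·`. -/
def spinOp₂ : CurveOp Vec3 := fun S a p b =>
  (∀ x, HasDerivAt p (inner ℝ (deriv S x) (a x)) x) ∧
  ∀ x, b x = deriv a x + inner ℝ (deriv S x) (a x) • S x + p x • deriv S x

/-! ### Hamiltonian operators on the unit sphere

A functional `∫ F dx` is represented by its density `F`, modulo total `x`-derivatives. It belongs
to the domain of the bracket of `A` if `A(δF/δS)` is defined; `X` is then its Hamiltonian vector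
field, and `{F, G} = ∫ X · δG/δS dx`. -/

/-- The density `X · δG/δS` of the bracket `{F, G}`, where `X = A(δF/δS)`. -/
def bracket (X : DFun Vec3 Vec3) (G : DFun Vec3 ℝ) : DFun Vec3 ℝ := fun x s =>
  inner ℝ (X x s) (varS G x s)

/-- `A` defines a Poisson bracket on functionals of `S`, `|S| = 1`. -/
structure IsHamiltonian (A : CurveOp Vec3) : Prop where
  /-- All functionals without explicit dependence on `x` belong to the domain. -/
  defined : ∀ F, IsDFun F → (∀ x y s, F x s = F y s) → ∃ X, Acts sphereCurves A (varS F) X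
  /-- Hamiltonian vector fields are tangent to the sphere. -/
  tangent : ∀ F X, IsDFun F → Acts sphereCurves A (varS F) X →
    EqAlong sphereCurves (fun x s => inner ℝ (s 0) (X x s)) (fun _ _ => (0 : ℝ))
  /-- The domain is closed under the bracket. -/
  closed : ∀ F G X Y, IsDFun F → IsDFun G →
    Acts sphereCurves A (varS F) X → Acts sphereCurves A (varS G) Y →
    ∃ Z, Acts sphereCurves A (varS (bracket X G)) Z
  skew : ∀ F G X Y, IsDFun F → IsDFun G →
    Acts sphereCurves A (varS F) X → Acts sphereCurves A (varS G) Y →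
    IsTotal sphereCurves (fun x s => bracket X G x s + bracket Y F x s)
  jacobi : ∀ F G H X Y Z, IsDFun F → IsDFun G → IsDFun H →
    Acts sphereCurves A (varS F) X → Acts sphereCurves A (varS G) Y →
    Acts sphereCurves A (varS H) Z →
    IsTotal sphereCurves (fun x s => bracket X (bracket Y H) x s
      + bracket Y (bracket Z F) x s + bracket Z (bracket X G) x s)

/-- `A` and `B` are a compatible pair of Hamiltonian operators. -/
def CompatibleHamiltonian (A B : CurveOp Vec3) : Prop :=
  IsHamiltonian A ∧ IsHamiltonian B ∧ ∀ α β : ℝ, IsHamiltonian (comb α A β B)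

/-! ### The dynamical maps into the 2-sphere

`γ` is a curve on the unit sphere, whose metric `g` is the restriction of the Euclidean inner
product. The `g`-gradient `δF/δγ` is `varS F`. -/

/-- The complex structure (Hodge dual) on the tangent plane of the unit sphere at `c`. -/
def sphereJ (c v : Vec3) : Vec3 := cross c v

/-- The covariant derivative `∇_x` of a vector field along `γ` on the sphere. -/
def covD (v : DFun Vec3 Vec3) : DFun Vec3 Vec3 := fun x s => tproj (s 0) (totalD v x s)

/-- `F^{(n)} = (J ∇_x - γ_x D_x⁻¹ g(Jγ_x, ·))^n γ_x`. -/
def mapFlow : ℕ → DFun Vec3 Vec3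
  | 0 => fun _ s => s 1
  | n + 1 => fun x s => sphereJ (s 0) (covD (mapFlow n) x s)
      - spinInvD (fun y r => inner ℝ (sphereJ (r 0) (r 1)) (mapFlow n y r)) x s • s 1

/-- `H^{(n)} = (1+n)⁻¹ D_x⁻¹ g(γ_x, ∇_x F^{(n)})`. -/
def mapHam (n : ℕ) : DFun Vec3 ℝ := fun x s =>
  ((n : ℝ) + 1)⁻¹ * spinInvD (fun y r => inner ℝ (r 1) (covD (mapFlow n) y r)) x s

/-- The operator `J`. -/
def mapOp₁ : CurveOp Vec3 := fun γ a _ b => ∀ x, b x = sphereJ (γ x) (a x)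

/-- The operator `∇_x + γ_x D_x⁻¹ g(γ_x, ·)`. -/
def mapOp₂ : CurveOp Vec3 := fun γ a p b =>
  (∀ x, HasDerivAt p (inner ℝ (deriv γ x) (a x)) x) ∧
  ∀ x, b x = tproj (γ x) (deriv a x) + p x • deriv γ x

/-! ### The flow variable `u` -/

/-- The smooth complex-valued functions `u` of `x`. -/
def uCurves : Set (ℝ → ℂ) := {u | ContDiff ℝ ∞ u}

/-- The vacuum `u = 0`. -/
def uVacuum : Set (ℝ → ℂ) := {fun _ => 0}

/-- `D_x⁻¹` on differential functions of `u`. -/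
def uInvD (g : DFun ℂ ℝ) : DFun ℂ ℝ := invD uCurves uVacuum g

/-- `D_x⁻¹ g` exists as a differential function of `u`. -/
def HasUInvD (g : DFun ℂ ℝ) : Prop := ∃ p, IsInvD uCurves uVacuum g p

/-- The Hamiltonian operator `ℐ = -i`. -/
def opI : ℂ := -Complex.I

/-- The operator `ℛ* = i D_x - u D_x⁻¹ Re(i u 𝒞)`, where `𝒞` is complex conjugation. -/
def uRecStar : CurveOp ℂ := fun u ξ p η =>
  (∀ x, HasDerivAt p (Complex.I * u x * star (ξ x)).re x) ∧
  ∀ x, η x = Complex.I * deriv ξ x - u x * (p x : ℂ)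

/-- The operator `-ℐ⁻¹`. -/
def uOp₁ : CurveOp ℂ := fun _ ξ _ η => ∀ x, η x = -opI⁻¹ * ξ x

/-- The operator `𝒥 = D_x + u D_x⁻¹ Re(u 𝒞)`. -/
def uOp₂ : CurveOp ℂ := fun u ξ p η =>
  (∀ x, HasDerivAt p (u x * star (ξ x)).re x) ∧
  ∀ x, η x = deriv ξ x + u x * (p x : ℂ)

/-- `ϖ^{(n)} = ℛ*^n (u)`. -/
def uGrad : ℕ → DFun ℂ ℂ
  | 0 => fun _ s => s 0
  | n + 1 => fun x s => Complex.I * totalD (uGrad n) x s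
      - s 0 * (uInvD (fun y r => (Complex.I * r 0 * star (uGrad n y r)).re) x s : ℂ)

/-- The commutator of evolutionary vector fields. -/
def lieBracket (ξ η : DFun ℂ ℂ) : DFun ℂ ℂ := fun x s => evol ξ η x s - evol η ξ x s

/-- `K` is a symplectic operator: `ω(ξ, η) = ∫ Re(ξ̄ K(η)) dx` is a closed 2-form on the
evolutionary vector fields in the domain of `K`. -/
structure IsSymplectic (K : CurveOp ℂ) : Prop where
  /-- The domain is closed under commutators. -/
  lie : ∀ ξ η ξ' η', IsDFun ξ → IsDFun η →
    Acts uCurves K ξ ξ' → Acts uCurves K η η' → ∃ ζ', Acts uCurves K (lieBracket ξ η) ζ'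
  skew : ∀ ξ η ξ' η', IsDFun ξ → IsDFun η → Acts uCurves K ξ ξ' → Acts uCurves K η η' →
    IsTotal uCurves (fun x s => (star (ξ x s) * η' x s).re + (star (η x s) * ξ' x s).re)
  /-- `dω(ξ, η, ζ) = ξ(ω(η, ζ)) - ω([ξ, η], ζ) + cyclic = 0`. -/
  closed : ∀ ξ η ζ ξ' η' ζ', IsDFun ξ → IsDFun η → IsDFun ζ →
    Acts uCurves K ξ ξ' → Acts uCurves K η η' → Acts uCurves K ζ ζ' →
    IsTotal uCurves (fun x s =>
      evol ξ (fun y r => (star (η y r) * ζ' y r).re) x s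
        - (star (lieBracket ξ η x s) * ζ' x s).re
      + (evol η (fun y r => (star (ζ y r) * ξ' y r).re) x s
        - (star (lieBracket η ζ x s) * ξ' x s).re)
      + (evol ζ (fun y r => (star (ξ y r) * η' y r).re) x s
        - (star (lieBracket ζ ξ x s) * η' x s).re))

/-- `K` and `L` are a compatible pair of symplectic operators. -/
def CompatibleSymplectic (K L : CurveOp ℂ) : Prop :=
  IsSymplectic K ∧ IsSymplectic L ∧ ∀ α β : ℝ, IsSymplectic (comb α K β L)

/-- `(S, N₁, N₂)` is a positively oriented orthonormal parallel frame along `S`, with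
`u = u₂ + i u₃` the components of `S_x`: with `E^⊥ = N₁ + i N₂`, the Frenet equations
`S_x = Re(ū E^⊥)` and `E^⊥_x = -u S` hold. -/
structure IsParallelFrame (S N₁ N₂ : ℝ → Vec3) (u : ℝ → ℂ) : Prop where
  smooth_S : ContDiff ℝ ∞ S
  smooth_N₁ : ContDiff ℝ ∞ N₁
  smooth_u : ContDiff ℝ ∞ u
  norm_S : ∀ x, ‖S x‖ = 1
  norm_N₁ : ∀ x, ‖N₁ x‖ = 1
  orthogonal : ∀ x, inner ℝ (S x) (N₁ x) = 0
  oriented : ∀ x, N₂ x = cross (S x) (N₁ x)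
  deriv_S : ∀ x, deriv S x = (u x).re • N₁ x + (u x).im • N₂ x
  deriv_N₁ : ∀ x, deriv N₁ x = -((u x).re • S x)
  deriv_N₂ : ∀ x, deriv N₂ x = -((u x).im • S x)

/-- The vector field `Re(Ē^⊥ ξ)` with components `ξ` in a frame `E^⊥ = N₁ + i N₂`. -/
def ofComp (N₁ N₂ : ℝ → Vec3) (ξ : ℝ → ℂ) : ℝ → Vec3 := fun x =>
  (ξ x).re • N₁ x + (ξ x).im • N₂ x

end SpinHierarchy

end

open SpinHierarchy

noncomputable section

namespace SpinHierarchy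

section Calculus

variable {V W W₁ W₂ W₃ : Type*} [NormedAddCommGroup V] [InnerProductSpace ℝ V]
  [NormedAddCommGroup W] [NormedSpace ℝ W] [NormedAddCommGroup W₁] [NormedSpace ℝ W₁]
  [NormedAddCommGroup W₂] [NormedSpace ℝ W₂] [NormedAddCommGroup W₃] [NormedSpace ℝ W₃]

/-! ### Closure properties of differential functions -/



/-! The whole hierarchy is encoded in one formal series `m = S + λ m₁ + λ² m₂ + …` with `λ m_x = m ∧
S` and `|m| = 1` (`spinM` lists its coefficients). The tangential part of `m_{n+1}` is `S ∧ D_x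
m_n`, and `|m| = 1` fixes its normal part algebraically, so every coefficient is a differential
function without any integration. With `h_n = -S · m_{n+1}` (`spinH`) one has `D_x h_n = (S ∧ S_x) ·
D_x m_n` (`totalD_spinH`). Thus `h_n` is the integral in the recursion, `f^{(n)} = D_x m_n` and
`H^{(n)} = h_{n+1} / (n+1)`. The normalised `D_x⁻¹` is unique because every curve can be altered
away from a given point so as to contain a vacuum piece (`IsInvD.eqAlong`).

Gradients come from a determinant. If `m'` is the `λ`-derivative of `m` and `δm` its variation under
`δS = X`, then `λ² D_x det(m, m', δm) = S · δm + λ X · m'` (`lax_variation_identity`). Comparing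
coefficients gives `δH^{(n)}/δS = S ∧ f^{(n+1)}`, first modulo total derivatives and then pointwise
by a du Bois-Reymond argument (`ev_varS_eq`). The first Hamiltonian structure is then `(S ∧)² = -1`
on tangent vectors; the second holds because `δH^{(n)}/δS + S D_x⁻¹(S_x · δH^{(n)}/δS) = m_{n+2}`.

For the operators, the whole pencil `α S ∧ + β (D_x + S S_x· + S_x D_x⁻¹ S_x·)` is treated at once.
Modulo total derivatives, the Jacobi expression is a cyclic sum of `X(Y) · c + Y · X(c)`, where `c`
is the third gradient. Self-adjointness of linearised gradients (`isTotal_helmholtz`) and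
skew-symmetry of the operator (`isTotal_linearization`) reduce this to the derivative of the
coefficients of the operator, whose cyclic sum is an explicit total derivative (`isTotal_linTerm`).
The nonlocal term is defined on `δF/δS` when `∂F/∂x` is a total derivative, and this condition is
preserved by the bracket. The symplectic pair in `u` is handled in the same way, except that there
the cyclic sum vanishes identically.

In a parallel frame `S ∧` becomes multiplication by `i`, and the normal part of `D_x` cancels
against `S S_x·`. Both hierarchies satisfy the same quadratic recursion for `h_n` (`spinH_eq_sum`,
`uH_eq`), so they are matched without comparing integration constants (`ofComp_uGrad`). The map
equations need no separate theory: `J` kills normal components, so `F^{(n)} = f^{(n)}`, and the two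
second operators agree on tangent vectors. -/

theorem IsDFun.comp {φ : DFun V W₁} {f : W₁ → W₂} (hf : ContDiff ℝ ∞ f) (hφ : IsDFun φ) :
    IsDFun (fun x s => f (φ x s)) := by
  obtain ⟨n, g, hg, h⟩ := hφ
  exact ⟨n, fun z => f (g z), hf.comp hg, fun x s => congrArg f (h x s)⟩

/-- Padding with unused jet variables brings several differential functions to a common finite jet
order, which is what closure under pairs and tuples requires. -/
theorem IsDFun.exists_of_le {φ : DFun V W} (hφ : IsDFun φ) :
    ∃ n, ∀ m, n ≤ m → ∃ g : ℝ × (Fin m → V) → W, ContDiff ℝ ∞ g ∧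
      ∀ x s, φ x s = g (x, fun i => s i) := by
  obtain ⟨n, g, hg, h⟩ := hφ
  refine ⟨n, fun m hm => ⟨fun z => g (z.1, fun i => z.2 (Fin.castLE hm i)), ?_, fun x s => ?_⟩⟩
  · refine hg.comp (contDiff_fst.prodMk (contDiff_pi.2 fun i => ?_))
    exact (contDiff_apply ℝ V (Fin.castLE hm i)).comp contDiff_snd
  · rw [h]; rfl

theorem IsDFun.prodMk {φ : DFun V W₁} {ψ : DFun V W₂} (hφ : IsDFun φ) (hψ : IsDFun ψ) :
    IsDFun (fun x s => (φ x s, ψ x s)) := by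
  obtain ⟨n, hn⟩ := hφ.exists_of_le
  obtain ⟨m, hm⟩ := hψ.exists_of_le
  obtain ⟨g, hg, h⟩ := hn (max n m) (le_max_left _ _)
  obtain ⟨g', hg', h'⟩ := hm (max n m) (le_max_right _ _)
  exact ⟨max n m, fun z => (g z, g' z), hg.prodMk hg', fun x s => Prod.ext (h x s) (h' x s)⟩

theorem IsDFun.pi {n : ℕ} {φ : Fin n → DFun V W} (hφ : ∀ i, IsDFun (φ i)) :
    IsDFun (fun x s i => φ i x s) := by
  choose N hN using fun i => (hφ i).exists_of_le
  choose g hg h using fun i => hN i (Finset.univ.sup N) (Finset.le_sup (Finset.mem_univ i))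
  exact ⟨Finset.univ.sup N, fun z i => g i z, contDiff_pi.2 hg, fun x s => funext fun i => h i x s⟩

theorem IsDFun.coord (k : ℕ) : IsDFun (fun _ s => s k : DFun V V) :=
  ⟨k + 1, fun z => z.2 (Fin.last k),
    (contDiff_apply ℝ V (Fin.last k)).comp contDiff_snd, fun _ _ => rfl⟩

theorem IsDFun.ofFun {f : ℝ → W} (hf : ContDiff ℝ ∞ f) : IsDFun (fun x _ => f x : DFun V W) :=
  ⟨0, fun z => f z.1, hf.comp contDiff_fst, fun _ _ => rfl⟩

theorem IsDFun.const (w : W) : IsDFun (fun _ _ => w : DFun V W) := IsDFun.ofFun contDiff_const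

theorem IsDFun.add {φ ψ : DFun V W} (hφ : IsDFun φ) (hψ : IsDFun ψ) :
    IsDFun (fun x s => φ x s + ψ x s) :=
  (hφ.prodMk hψ).comp (f := fun z => z.1 + z.2) contDiff_add

theorem IsDFun.neg {φ : DFun V W} (hφ : IsDFun φ) : IsDFun (fun x s => -φ x s) :=
  hφ.comp (f := fun z => -z) contDiff_neg

theorem IsDFun.sub {φ ψ : DFun V W} (hφ : IsDFun φ) (hψ : IsDFun ψ) :
    IsDFun (fun x s => φ x s - ψ x s) := by
  simpa only [sub_eq_add_neg] using hφ.add hψ.neg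

theorem IsDFun.bilin (B : W₁ →L[ℝ] W₂ →L[ℝ] W₃) {φ : DFun V W₁} {ψ : DFun V W₂}
    (hφ : IsDFun φ) (hψ : IsDFun ψ) : IsDFun (fun x s => B (φ x s) (ψ x s)) :=
  (hφ.prodMk hψ).comp (f := fun z => B z.1 z.2) B.isBoundedBilinearMap.contDiff

theorem IsDFun.smul {φ : DFun V ℝ} {ψ : DFun V W} (hφ : IsDFun φ) (hψ : IsDFun ψ) :
    IsDFun (fun x s => φ x s • ψ x s) :=
  (hφ.prodMk hψ).comp (f := fun z => z.1 • z.2) contDiff_smul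

theorem IsDFun.mul {φ ψ : DFun V ℝ} (hφ : IsDFun φ) (hψ : IsDFun ψ) :
    IsDFun (fun x s => φ x s * ψ x s) := hφ.smul hψ

theorem IsDFun.constSmul (r : ℝ) {φ : DFun V W} (hφ : IsDFun φ) :
    IsDFun (fun x s => r • φ x s) := (IsDFun.const r).smul hφ

theorem IsDFun.inner {φ ψ : DFun V V} (hφ : IsDFun φ) (hψ : IsDFun ψ) :
    IsDFun (fun x s => inner ℝ (φ x s) (ψ x s)) :=
  (hφ.prodMk hψ).comp (f := fun z => Inner.inner ℝ z.1 z.2) contDiff_inner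

theorem IsDFun.sum {ι : Type*} (t : Finset ι) {φ : ι → DFun V W} (hφ : ∀ i ∈ t, IsDFun (φ i)) :
    IsDFun (fun x s => ∑ i ∈ t, φ i x s) := by
  classical
  induction t using Finset.induction_on with
  | empty => simpa using IsDFun.const (V := V) (0 : W)
  | insert i t hi ih =>
    simp only [Finset.sum_insert hi]
    exact (hφ i (by simp)).add (ih fun j hj => hφ j (by simp [hj]))

/-! ### Derivatives along vector fields on jet space -/

/-- The derivative of `φ` along the vector field `a ∂/∂x + ∑ₖ Aₖ ∂/∂c^{(k)}` on jet space. -/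
def lieD (a : DFun V ℝ) (A : ℕ → DFun V V) (φ : DFun V W) : DFun V W := fun x s =>
  deriv (fun t : ℝ => φ (x + t * a x s) (fun k => s k + t • A k x s)) 0

/-- The partial derivative in `x`. -/
def partialX (φ : DFun V W) : DFun V W := fun x s => deriv (fun t : ℝ => φ (x + t) s) 0

theorem totalD_eq_lieD (φ : DFun V W) :
    totalD φ = lieD (fun _ _ => 1) (fun k _ s => s (k + 1)) φ := by
  funext x s; simp [totalD, lieD]

theorem evol_eq_lieD (ξ : DFun V V) (φ : DFun V W) :
    evol ξ φ = lieD (fun _ _ => 0) (fun k => totalD^[k] ξ) φ := by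
  funext x s; simp [evol, lieD]

theorem partialX_eq_lieD (φ : DFun V W) :
    partialX φ = lieD (fun _ _ => 1) (fun _ _ _ => 0) φ := by
  funext x s; simp [partialX, lieD]

section lieD

variable {a b : DFun V ℝ} {A B : ℕ → DFun V V}

theorem lieD_line_eq {n : ℕ} {g : ℝ × (Fin n → V) → W} (hg : ContDiff ℝ ∞ g)
    (x : ℝ) (s : ℕ → V) :
    HasDerivAt (fun t : ℝ => g (x + t * a x s, fun i : Fin n => s i + t • A i x s))
      (fderiv ℝ g (x, fun i => s i) (a x s, fun i => A i x s)) 0 := by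
  have h1 : HasDerivAt (fun t : ℝ => (x + t * a x s, fun i : Fin n => s i + t • A i x s))
      (a x s, fun i => A i x s) 0 := by
    refine HasDerivAt.prodMk ?_ (hasDerivAt_pi.2 fun i => ?_)
    · simpa using ((hasDerivAt_id (0 : ℝ)).mul_const (a x s)).const_add x
    · simpa using ((hasDerivAt_id (0 : ℝ)).smul_const (A i x s)).const_add (s i)
  have h2 := (hg.differentiable (by simp)).differentiableAt (x := (x, fun i : Fin n => s i))
  have h3 := h2.hasFDerivAt.comp_hasDerivAt_of_eq (0 : ℝ) h1 (by simp)
  exact h3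

theorem lieD_hasDerivAt {φ : DFun V W} (hφ : IsDFun φ) (x : ℝ) (s : ℕ → V) :
    HasDerivAt (fun t : ℝ => φ (x + t * a x s) (fun k => s k + t • A k x s))
      (lieD a A φ x s) 0 := by
  obtain ⟨n, g, hg, h⟩ := hφ
  have := lieD_line_eq (a := a) (A := A) hg x s
  simp only [lieD, h]
  exact this.differentiableAt.hasDerivAt

theorem lieD_eq_fderiv {φ : DFun V W} {n : ℕ} {g : ℝ × (Fin n → V) → W} (hg : ContDiff ℝ ∞ g)
    (h : ∀ x s, φ x s = g (x, fun i => s i)) (x : ℝ) (s : ℕ → V) :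
    lieD a A φ x s = fderiv ℝ g (x, fun i => s i) (a x s, fun i => A i x s) := by
  simp only [lieD, h]
  exact (lieD_line_eq hg x s).deriv

theorem IsDFun.lieD {φ : DFun V W} (hφ : IsDFun φ) (ha : IsDFun a) (hA : ∀ k, IsDFun (A k)) :
    IsDFun (lieD a A φ) := by
  obtain ⟨n, g, hg, h⟩ := hφ
  have h1 : IsDFun (fun x s => fderiv ℝ g (x, fun i => s i) : DFun V _) :=
    ⟨n, _, hg.fderiv_right (m := ∞) (by simp), fun _ _ => rfl⟩
  have h2 := (h1.prodMk (ha.prodMk (IsDFun.pi (fun i : Fin n => hA i)))).comp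
    (f := fun z => z.1 z.2) (contDiff_fst.clm_apply contDiff_snd)
  convert h2 using 3 with x s
  exact lieD_eq_fderiv hg h x s

theorem lieD_comp {φ : DFun V W₁} (hφ : IsDFun φ) (L : W₁ →L[ℝ] W₂) (x : ℝ) (s : ℕ → V) :
    lieD a A (fun x s => L (φ x s)) x s = L (lieD a A φ x s) :=
  (L.hasFDerivAt.comp_hasDerivAt (0 : ℝ) (lieD_hasDerivAt hφ x s)).deriv

theorem lieD_bilin (L : W₁ →L[ℝ] W₂ →L[ℝ] W₃) {φ : DFun V W₁} {ψ : DFun V W₂}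
    (hφ : IsDFun φ) (hψ : IsDFun ψ) (x : ℝ) (s : ℕ → V) :
    lieD a A (fun x s => L (φ x s) (ψ x s)) x s
      = L (lieD a A φ x s) (ψ x s) + L (φ x s) (lieD a A ψ x s) := by
  have h := (L.hasFDerivAt_of_bilinear (lieD_hasDerivAt (a := a) (A := A) hφ x s).hasFDerivAt
    (lieD_hasDerivAt (a := a) (A := A) hψ x s).hasFDerivAt).hasDerivAt
  refine h.deriv.trans ?_
  simp [add_comm]

theorem lieD_coord (k : ℕ) (x : ℝ) (s : ℕ → V) :
    lieD a A (fun _ s => s k) x s = A k x s := by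
  have : HasDerivAt (fun t : ℝ => s k + t • A k x s) (A k x s) 0 := by
    simpa using ((hasDerivAt_id (0 : ℝ)).smul_const (A k x s)).const_add (s k)
  exact this.deriv

theorem lieD_const (w : W) (x : ℝ) (s : ℕ → V) :
    lieD a A (fun _ _ => w) x s = 0 := by
  simp [lieD]

theorem lieD_add {φ ψ : DFun V W} (hφ : IsDFun φ) (hψ : IsDFun ψ) (x : ℝ) (s : ℕ → V) :
    lieD a A (fun x s => φ x s + ψ x s) x s = lieD a A φ x s + lieD a A ψ x s :=
  ((lieD_hasDerivAt hφ x s).add (lieD_hasDerivAt hψ x s)).deriv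

theorem lieD_sub {φ ψ : DFun V W} (hφ : IsDFun φ) (hψ : IsDFun ψ) (x : ℝ) (s : ℕ → V) :
    lieD a A (fun x s => φ x s - ψ x s) x s = lieD a A φ x s - lieD a A ψ x s :=
  ((lieD_hasDerivAt hφ x s).sub (lieD_hasDerivAt hψ x s)).deriv

theorem lieD_neg {φ : DFun V W} (hφ : IsDFun φ) (x : ℝ) (s : ℕ → V) :
    lieD a A (fun x s => -φ x s) x s = -lieD a A φ x s :=
  (lieD_hasDerivAt hφ x s).neg.deriv

theorem lieD_sum {ι : Type*} (t : Finset ι) {φ : ι → DFun V W} (hφ : ∀ i ∈ t, IsDFun (φ i))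
    (x : ℝ) (s : ℕ → V) :
    lieD a A (fun x s => ∑ i ∈ t, φ i x s) x s = ∑ i ∈ t, lieD a A (φ i) x s :=
  (HasDerivAt.fun_sum fun i hi => lieD_hasDerivAt (hφ i hi) x s).deriv

theorem lieD_smul {φ : DFun V ℝ} {ψ : DFun V W} (hφ : IsDFun φ) (hψ : IsDFun ψ)
    (x : ℝ) (s : ℕ → V) :
    lieD a A (fun x s => φ x s • ψ x s) x s
      = lieD a A φ x s • ψ x s + φ x s • lieD a A ψ x s :=
  lieD_bilin (ContinuousLinearMap.lsmul ℝ ℝ) hφ hψ x s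

theorem lieD_mul {φ ψ : DFun V ℝ} (hφ : IsDFun φ) (hψ : IsDFun ψ) (x : ℝ) (s : ℕ → V) :
    lieD a A (fun x s => φ x s * ψ x s) x s
      = lieD a A φ x s * ψ x s + φ x s * lieD a A ψ x s := lieD_smul hφ hψ x s

theorem lieD_constSmul (r : ℝ) {φ : DFun V W} (hφ : IsDFun φ) (x : ℝ) (s : ℕ → V) :
    lieD a A (fun x s => r • φ x s) x s = r • lieD a A φ x s := by
  rw [lieD_smul (IsDFun.const r) hφ, lieD_const]; simp

theorem lieD_inner {φ ψ : DFun V V} (hφ : IsDFun φ) (hψ : IsDFun ψ) (x : ℝ) (s : ℕ → V) :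
    lieD a A (fun x s => inner ℝ (φ x s) (ψ x s)) x s
      = inner ℝ (lieD a A φ x s) (ψ x s) + inner ℝ (φ x s) (lieD a A ψ x s) :=
  lieD_bilin (innerSL ℝ) hφ hψ x s

/-- The commutator of vector fields on jet space. -/
theorem lieD_lieD_sub {φ : DFun V W} (hφ : IsDFun φ) (ha : IsDFun a) (hA : ∀ k, IsDFun (A k))
    (hb : IsDFun b) (hB : ∀ k, IsDFun (B k)) (x : ℝ) (s : ℕ → V) :
    lieD a A (lieD b B φ) x s - lieD b B (lieD a A φ) x s
      = lieD (fun x s => lieD a A b x s - lieD b B a x s)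
          (fun k x s => lieD a A (B k) x s - lieD b B (A k) x s) φ x s := by
  obtain ⟨n, g, hg, h⟩ := hφ
  have hg' : ContDiff ℝ ∞ (fderiv ℝ g) := hg.fderiv_right (m := ∞) (by simp)
  -- Two fields in succession give the second derivative of `g` on the two coefficient vectors plus
  -- its first derivative on the differentiated coefficients. The former is symmetric, so only the
  -- latter survives in the commutator.
  have key : ∀ (a b : DFun V ℝ) (A B : ℕ → DFun V V), IsDFun b → (∀ k, IsDFun (B k)) →
      lieD a A (lieD b B φ) x s
        = fderiv ℝ (fderiv ℝ g) (x, fun i => s i) (a x s, fun i => A i x s)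
            (b x s, fun i => B i x s)
          + fderiv ℝ g (x, fun i => s i) (lieD a A b x s, fun i => lieD a A (B i) x s) := by
    intro a b A B hb hB
    have h1 := lieD_line_eq (a := a) (A := A) hg' x s
    have h2 := (lieD_hasDerivAt (a := a) (A := A) hb x s).prodMk
      (hasDerivAt_pi.2 fun i : Fin n => lieD_hasDerivAt (a := a) (A := A) (hB i) x s)
    have h3 := h1.clm_apply h2
    have h4 : lieD b B φ = fun x s => fderiv ℝ g (x, fun i => s i) (b x s, fun i => B i x s) := by
      funext x s; exact lieD_eq_fderiv hg h x s
    rw [h4]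
    refine h3.deriv.trans ?_
    simp
  rw [key a b A B hb hB, key b a B A ha hA, lieD_eq_fderiv hg h]
  have hsymm : IsSymmSndFDerivAt ℝ g (x, fun i => s i) :=
    (hg.contDiffAt).isSymmSndFDerivAt (by
      rw [minSmoothness_of_isRCLikeNormedField]; exact WithTop.coe_le_coe.2 (le_top : (2 : ℕ∞) ≤ ⊤))
  rw [hsymm.eq (a x s, fun i : Fin n => A i x s) (b x s, fun i => B i x s)]
  rw [add_sub_add_left_eq_sub, ← map_sub]
  rfl

end lieD

/-! ### Total derivatives and evolutionary vector fields -/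

theorem IsDFun.totalD {φ : DFun V W} (hφ : IsDFun φ) : IsDFun (totalD φ) := by
  rw [totalD_eq_lieD]
  exact hφ.lieD (IsDFun.const 1) fun k => IsDFun.coord (k + 1)

theorem IsDFun.iterate_totalD {φ : DFun V W} (hφ : IsDFun φ) (k : ℕ) :
    IsDFun (SpinHierarchy.totalD^[k] φ) := by
  induction k with
  | zero => exact hφ
  | succ k ih => rw [Function.iterate_succ_apply']; exact ih.totalD

theorem IsDFun.evol {ξ : DFun V V} {φ : DFun V W} (hφ : IsDFun φ) (hξ : IsDFun ξ) :
    IsDFun (evol ξ φ) := by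
  rw [evol_eq_lieD]
  exact hφ.lieD (IsDFun.const 0) fun k => hξ.iterate_totalD k

theorem IsDFun.partialX {φ : DFun V W} (hφ : IsDFun φ) : IsDFun (partialX φ) := by
  rw [partialX_eq_lieD]
  exact hφ.lieD (IsDFun.const 1) fun k => IsDFun.const 0

theorem totalD_coord (k : ℕ) :
    totalD (fun _ s => s k : DFun V V) = fun _ s => s (k + 1) := by
  funext x s; rw [totalD_eq_lieD, lieD_coord]

theorem totalD_iterate_coord (k j : ℕ) :
    totalD^[k] (fun _ s => s j : DFun V V) = fun _ s => s (j + k) := by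
  induction k with
  | zero => rfl
  | succ k ih => rw [Function.iterate_succ_apply', ih, totalD_coord]; rfl

theorem evol_coord (ξ : DFun V V) (k : ℕ) :
    evol ξ (fun _ s => s k : DFun V V) = totalD^[k] ξ := by
  funext x s; rw [evol_eq_lieD, lieD_coord]

theorem totalD_zero : totalD (fun _ _ => 0 : DFun V W) = fun _ _ => 0 := by
  funext x s; rw [totalD_eq_lieD, lieD_const]

theorem totalD_iterate_zero (k : ℕ) :
    totalD^[k] (fun _ _ => 0 : DFun V W) = fun _ _ => 0 := by
  induction k with
  | zero => rfl
  | succ k ih => rw [Function.iterate_succ_apply', ih, totalD_zero]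

theorem lieD_zero (φ : DFun V W) (x : ℝ) (s : ℕ → V) :
    lieD (fun _ _ => 0) (fun _ _ _ => 0) φ x s = 0 := by
  simp [lieD]

/-- Both are vector fields on jet space, and the `k`-th coefficient of their commutator is `D_x
(D_x^k ξ) - D_x^{k+1} ξ = 0`. -/
theorem totalD_evol {ξ : DFun V V} {φ : DFun V W} (hφ : IsDFun φ) (hξ : IsDFun ξ) :
    totalD (evol ξ φ) = evol ξ (totalD φ) := by
  funext x s
  have h := lieD_lieD_sub hφ (IsDFun.const 1) (fun k => IsDFun.coord (k + 1)) (IsDFun.const 0)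
    (fun k => hξ.iterate_totalD k) x s
  rw [← evol_eq_lieD, ← totalD_eq_lieD, ← evol_eq_lieD, ← totalD_eq_lieD] at h
  rw [← sub_eq_zero, h]
  simp only [lieD_const, lieD_coord]
  simp only [← totalD_eq_lieD, Function.iterate_succ_apply', sub_self]
  exact lieD_zero φ x s

theorem totalD_partialX {φ : DFun V W} (hφ : IsDFun φ) :
    totalD (partialX φ) = partialX (totalD φ) := by
  funext x s
  have h := lieD_lieD_sub hφ (IsDFun.const 1) (fun k => IsDFun.coord (k + 1)) (IsDFun.const 1)
    (fun k => IsDFun.const (0 : V)) x s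
  rw [← partialX_eq_lieD, ← totalD_eq_lieD, ← partialX_eq_lieD, ← totalD_eq_lieD] at h
  rw [← sub_eq_zero, h]
  simp only [lieD_const, lieD_coord, sub_self]
  exact lieD_zero φ x s

theorem totalD_iterate_evol {ξ : DFun V V} {φ : DFun V W} (hφ : IsDFun φ) (hξ : IsDFun ξ) (k : ℕ) :
    totalD^[k] (evol ξ φ) = evol ξ (totalD^[k] φ) := by
  induction k with
  | zero => rfl
  | succ k ih =>
    rw [Function.iterate_succ_apply', Function.iterate_succ_apply', ih,
      totalD_evol (hφ.iterate_totalD k) hξ]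

theorem totalD_iterate_partialX {φ : DFun V W} (hφ : IsDFun φ) (k : ℕ) :
    totalD^[k] (partialX φ) = partialX (totalD^[k] φ) := by
  induction k with
  | zero => rfl
  | succ k ih =>
    rw [Function.iterate_succ_apply', Function.iterate_succ_apply', ih,
      totalD_partialX (hφ.iterate_totalD k)]

theorem totalD_sub {φ ψ : DFun V W} (hφ : IsDFun φ) (hψ : IsDFun ψ) :
    totalD (fun x s => φ x s - ψ x s) = fun x s => totalD φ x s - totalD ψ x s := by
  funext x s; simp only [totalD_eq_lieD]; exact lieD_sub hφ hψ x s

theorem totalD_iterate_sub {φ ψ : DFun V W} (hφ : IsDFun φ) (hψ : IsDFun ψ) (k : ℕ) :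
    totalD^[k] (fun x s => φ x s - ψ x s) = fun x s => totalD^[k] φ x s - totalD^[k] ψ x s := by
  induction k with
  | zero => rfl
  | succ k ih =>
    simp only [Function.iterate_succ_apply', ih]
    exact totalD_sub (hφ.iterate_totalD k) (hψ.iterate_totalD k)

/-- The commutator of evolutionary vector fields is evolutionary. -/
theorem evol_evol_sub {X Y : DFun V V} {φ : DFun V W} (hφ : IsDFun φ) (hX : IsDFun X)
    (hY : IsDFun Y) (x : ℝ) (s : ℕ → V) :
    evol X (evol Y φ) x s - evol Y (evol X φ) x s
      = evol (fun x s => evol X Y x s - evol Y X x s) φ x s := by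
  have h := lieD_lieD_sub hφ (IsDFun.const 0) (fun k => hX.iterate_totalD k) (IsDFun.const 0)
    (fun k => hY.iterate_totalD k) x s
  simp only [lieD_const, sub_self, ← evol_eq_lieD] at h
  rw [h, evol_eq_lieD]
  congr 1
  funext k x s
  rw [totalD_iterate_sub (hY.evol hX) (hX.evol hY), totalD_iterate_evol hY hX,
    totalD_iterate_evol hX hY]

theorem partialX_evol {X : DFun V V} {φ : DFun V W} (hφ : IsDFun φ) (hX : IsDFun X)
    (x : ℝ) (s : ℕ → V) :
    partialX (evol X φ) x s = evol X (partialX φ) x s + evol (partialX X) φ x s := by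
  have h := lieD_lieD_sub hφ (IsDFun.const 1) (fun k => IsDFun.const (0 : V)) (IsDFun.const 0)
    (fun k => hX.iterate_totalD k) x s
  simp only [lieD_const, sub_self, sub_zero, ← evol_eq_lieD, ← partialX_eq_lieD] at h
  rw [← sub_eq_iff_eq_add', h, evol_eq_lieD]
  congr 1
  funext k x s
  rw [totalD_iterate_partialX hX]

/-- The evolutionary field of `c_x` shifts the jet variables. This splitting later ties the
existence of `D_x⁻¹(S_x · δF/δS)` to the explicit `x`-dependence of `F`. -/
theorem totalD_eq_partialX_add {φ : DFun V W} (hφ : IsDFun φ) (x : ℝ) (s : ℕ → V) :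
    totalD φ x s = partialX φ x s + evol (fun _ s => s 1) φ x s := by
  obtain ⟨n, g, hg, h⟩ := hφ
  rw [totalD_eq_lieD, partialX_eq_lieD, evol_eq_lieD, lieD_eq_fderiv hg h, lieD_eq_fderiv hg h,
    lieD_eq_fderiv hg h, ← map_add]
  congr 1
  simp only [totalD_iterate_coord, Prod.mk_add_mk, add_zero]
  congr 1
  funext i
  simp [add_comm]

/-! ### Differential functions along curves -/

theorem jet_zero (c : ℝ → V) (x : ℝ) : jet c x 0 = c x := by simp [jet]

theorem jet_one (c : ℝ → V) (x : ℝ) : jet c x 1 = deriv c x := by simp [jet]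

theorem hasDerivAt_iteratedDeriv {c : ℝ → W} (hc : ContDiff ℝ ∞ c) (k : ℕ) (x : ℝ) :
    HasDerivAt (iteratedDeriv k c) (iteratedDeriv (k + 1) c x) x := by
  rw [iteratedDeriv_succ]
  exact ((hc.differentiable_iteratedDeriv k (by exact_mod_cast WithTop.coe_lt_top _)) x).hasDerivAt

theorem contDiff_iteratedDeriv {c : ℝ → W} (hc : ContDiff ℝ ∞ c) (k : ℕ) :
    ContDiff ℝ ∞ (iteratedDeriv k c) := by
  induction k with
  | zero => simpa using hc
  | succ k ih =>
    rw [iteratedDeriv_succ]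
    exact (contDiff_infty_iff_deriv.1 ih).2

theorem hasDerivAt_ev {φ : DFun V W} (hφ : IsDFun φ) {c : ℝ → V} (hc : ContDiff ℝ ∞ c) (x : ℝ) :
    HasDerivAt (ev φ c) (ev (totalD φ) c x) x := by
  obtain ⟨n, g, hg, h⟩ := hφ
  have h1 : HasDerivAt (fun y : ℝ => (y, fun i : Fin n => jet c y i))
      (1, fun i : Fin n => jet c x (i + 1)) x :=
    (hasDerivAt_id x).prodMk (hasDerivAt_pi.2 fun i => hasDerivAt_iteratedDeriv hc i x)
  have h2 := (hg.differentiable (by simp)).differentiableAt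
    (x := (x, fun i : Fin n => jet c x i))
  have h3 := h2.hasFDerivAt.comp_hasDerivAt_of_eq x h1 rfl
  have h4 : ev φ c = fun y => g (y, fun i => jet c y i) := by funext y; exact h _ _
  rw [h4]
  have h5 : ev (totalD φ) c x
      = fderiv ℝ g (x, fun i : Fin n => jet c x i) (1, fun i : Fin n => jet c x (i + 1)) := by
    rw [totalD_eq_lieD]
    exact lieD_eq_fderiv hg h x (jet c x)
  rw [h5]
  exact h3

theorem contDiff_ev {φ : DFun V W} (hφ : IsDFun φ) {c : ℝ → V} (hc : ContDiff ℝ ∞ c) :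
    ContDiff ℝ ∞ (ev φ c) := by
  obtain ⟨n, g, hg, h⟩ := hφ
  have h4 : ev φ c = fun y => g (y, fun i => jet c y i) := by funext y; exact h _ _
  rw [h4]
  exact hg.comp (contDiff_id.prodMk (contDiff_pi.2 fun i => contDiff_iteratedDeriv hc i))

theorem iteratedDeriv_ev {φ : DFun V W} (hφ : IsDFun φ) {c : ℝ → V} (hc : ContDiff ℝ ∞ c)
    (k : ℕ) : iteratedDeriv k (ev φ c) = ev (totalD^[k] φ) c := by
  induction k with
  | zero => simp
  | succ k ih =>
    funext x
    rw [iteratedDeriv_succ, ih, Function.iterate_succ_apply',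
      (hasDerivAt_ev (hφ.iterate_totalD k) hc x).deriv]

/-- `D_x` differentiates along the curve itself, so agreement on this single curve is enough; for
`evol` the neighbouring curves matter. -/
theorem ev_totalD_congr {φ ψ : DFun V W} (hφ : IsDFun φ) (hψ : IsDFun ψ) {c : ℝ → V}
    (hc : ContDiff ℝ ∞ c) (h : ev φ c = ev ψ c) : ev (totalD φ) c = ev (totalD ψ) c := by
  funext x
  rw [← (hasDerivAt_ev hφ hc x).deriv, ← (hasDerivAt_ev hψ hc x).deriv, h]

theorem jet_congr {c c' : ℝ → V} {x : ℝ} (h : c =ᶠ[nhds x] c') : jet c x = jet c' x := by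
  funext k
  exact h.iteratedDeriv_eq k

end Calculus

section Variations

variable {V W : Type*} [NormedAddCommGroup V] [InnerProductSpace ℝ V]
  [NormedAddCommGroup W] [NormedSpace ℝ W]

/-! ### Variations of curves -/

theorem hasDerivAt_fst {Γ : ℝ × ℝ → V} (hΓ : ContDiff ℝ ∞ Γ) (t x : ℝ) :
    HasDerivAt (fun t => Γ (t, x)) (fderiv ℝ Γ (t, x) (1, 0)) t := by
  have h := (hΓ.differentiable (by simp) (t, x)).hasFDerivAt
  exact h.comp_hasDerivAt t ((hasDerivAt_id t).prodMk (hasDerivAt_const t x))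

theorem hasDerivAt_snd {Γ : ℝ × ℝ → V} (hΓ : ContDiff ℝ ∞ Γ) (t x : ℝ) :
    HasDerivAt (fun x => Γ (t, x)) (fderiv ℝ Γ (t, x) (0, 1)) x := by
  have h := (hΓ.differentiable (by simp) (t, x)).hasFDerivAt
  exact h.comp_hasDerivAt x ((hasDerivAt_const x t).prodMk (hasDerivAt_id x))

theorem contDiff_fderiv_apply {Γ : ℝ × ℝ → V} (hΓ : ContDiff ℝ ∞ Γ) (v : ℝ × ℝ) :
    ContDiff ℝ ∞ (fun z => fderiv ℝ Γ z v) :=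
  (hΓ.fderiv_right (m := ∞) (by simp)).clm_apply contDiff_const

theorem fderiv_fderiv_comm {Γ : ℝ × ℝ → V} (hΓ : ContDiff ℝ ∞ Γ) (z v w : ℝ × ℝ) :
    fderiv ℝ (fun y => fderiv ℝ Γ y v) z w = fderiv ℝ (fun y => fderiv ℝ Γ y w) z v := by
  have h1 : DifferentiableAt ℝ (fderiv ℝ Γ) z :=
    (hΓ.fderiv_right (m := ∞) (by simp)).differentiable (by simp) z
  have h2 : ∀ v w, fderiv ℝ (fun y => fderiv ℝ Γ y v) z w = fderiv ℝ (fderiv ℝ Γ) z w v := by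
    intro v w
    rw [fderiv_clm_apply h1 (differentiableAt_const v)]
    simp
  have hsymm : IsSymmSndFDerivAt ℝ Γ z := hΓ.contDiffAt.isSymmSndFDerivAt (by
    rw [minSmoothness_of_isRCLikeNormedField]; exact WithTop.coe_le_coe.2 (le_top : (2 : ℕ∞) ≤ ⊤))
  rw [h2, h2, hsymm.eq]

/-- Equality of mixed partial derivatives. Each step absorbs one `x`-derivative into `Γ`, so the
induction has to quantify over `Γ`. -/
theorem hasDerivAt_iteratedDeriv_variation (k : ℕ) : ∀ {Γ : ℝ × ℝ → V}, ContDiff ℝ ∞ Γ → ∀ x,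
    HasDerivAt (fun t => iteratedDeriv k (fun y => Γ (t, y)) x)
      (iteratedDeriv k (fun y => fderiv ℝ Γ (0, y) (1, 0)) x) 0 := by
  induction k with
  | zero => intro Γ hΓ x; simpa using hasDerivAt_fst hΓ 0 x
  | succ k ih =>
    intro Γ hΓ x
    simp only [iteratedDeriv_succ']
    have h1 : ∀ t, deriv (fun y => Γ (t, y)) = fun y => fderiv ℝ Γ (t, y) (0, 1) := fun t =>
      funext fun y => (hasDerivAt_snd hΓ t y).deriv
    have h2 : deriv (fun y => fderiv ℝ Γ (0, y) (1, 0))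
        = fun y => fderiv ℝ (fun z => fderiv ℝ Γ z (0, 1)) (0, y) (1, 0) := funext fun y => by
      rw [(hasDerivAt_snd (contDiff_fderiv_apply hΓ (1, 0)) 0 y).deriv, fderiv_fderiv_comm hΓ]
    simp only [h1, h2]
    exact ih (contDiff_fderiv_apply hΓ (0, 1)) x

/-- The link between the formal derivative `evol` and actual variations of curves: only the first
order of `Γ` in `t` matters. -/
theorem hasDerivAt_ev_variation {φ : DFun V W} (hφ : IsDFun φ) {ξ : DFun V V} (hξ : IsDFun ξ)
    {Γ : ℝ × ℝ → V} (hΓ : ContDiff ℝ ∞ Γ) {c : ℝ → V} (hc : ContDiff ℝ ∞ c)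
    (h0 : ∀ x, Γ (0, x) = c x)
    (h1 : ∀ x, HasDerivAt (fun t => Γ (t, x)) (ev ξ c x) 0) (x : ℝ) :
    HasDerivAt (fun t => ev φ (fun y => Γ (t, y)) x) (ev (evol ξ φ) c x) 0 := by
  obtain ⟨n, g, hg, h⟩ := hφ
  have hd : (fun y => fderiv ℝ Γ (0, y) (1, 0)) = ev ξ c := funext fun y =>
    (hasDerivAt_fst hΓ 0 y).unique (h1 y)
  have hc' : (fun y => Γ (0, y)) = c := funext h0
  have h2 : HasDerivAt (fun t : ℝ => (x, fun i : Fin n => jet (fun y => Γ (t, y)) x i))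
      (0, fun i : Fin n => (totalD^[i] ξ) x (jet c x)) 0 := by
    refine (hasDerivAt_const _ _).prodMk (hasDerivAt_pi.2 fun i => ?_)
    have := hasDerivAt_iteratedDeriv_variation (i : ℕ) hΓ x
    rw [hd, iteratedDeriv_ev hξ hc] at this
    exact this
  have h3 := (hg.differentiable (by simp)).differentiableAt
    (x := (x, fun i : Fin n => jet c x i))
  have h4 := h3.hasFDerivAt.comp_hasDerivAt_of_eq (0 : ℝ) h2 (by rw [hc'])
  have h5 : (fun t => ev φ (fun y => Γ (t, y)) x)
      = fun t => g (x, fun i => jet (fun y => Γ (t, y)) x i) := funext fun t => h _ _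
  have h6 : ev (evol ξ φ) c x = fderiv ℝ g (x, fun i : Fin n => jet c x i)
      (0, fun i : Fin n => (totalD^[i] ξ) x (jet c x)) := by
    rw [evol_eq_lieD]
    exact lieD_eq_fderiv hg h x (jet c x)
  rw [h5, h6]
  exact h4

/-- A field of tangent vectors along a curve on the unit sphere comes from a variation of the
curve on the sphere. -/
theorem exists_sphere_variation {S X : ℝ → Vec3} (hS : S ∈ sphereCurves) (hX : ContDiff ℝ ∞ X)
    (hSX : ∀ x, inner ℝ (S x) (X x) = 0) :
    ∃ Γ : ℝ × ℝ → Vec3, ContDiff ℝ ∞ Γ ∧ (∀ x, Γ (0, x) = S x) ∧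
      (∀ x, HasDerivAt (fun t => Γ (t, x)) (X x) 0) ∧
      ∀ t, (fun x => Γ (t, x)) ∈ sphereCurves := by
  -- The variation is `(S + tX)/|S + tX|`. By orthogonality the squared denominator is `1 + t²|X|²`,
  -- hence never zero and stationary at `t = 0`.
  have hn : ∀ t x, ‖S x + t • X x‖ ^ 2 = 1 + t ^ 2 * ‖X x‖ ^ 2 := by
    intro t x
    rw [norm_add_sq_real, inner_smul_right, hSX, hS.2, norm_smul, mul_pow, Real.norm_eq_abs, sq_abs]
    ring
  have hpos : ∀ t x, 0 < 1 + t ^ 2 * ‖X x‖ ^ 2 := fun t x => by positivity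
  have hne : ∀ t x, ‖S x + t • X x‖ ≠ 0 := fun t x h => by
    have := hn t x; rw [h] at this; have := hpos t x; nlinarith
  have hv : ContDiff ℝ ∞ (fun z : ℝ × ℝ => S z.2 + z.1 • X z.2) :=
    (hS.1.comp contDiff_snd).add (contDiff_fst.smul (hX.comp contDiff_snd))
  have hsm : ContDiff ℝ ∞ (fun z : ℝ × ℝ => ‖S z.2 + z.1 • X z.2‖⁻¹ • (S z.2 + z.1 • X z.2)) := by
    have h0 : ∀ z : ℝ × ℝ, S z.2 + z.1 • X z.2 ≠ 0 := fun z => norm_ne_zero_iff.1 (hne z.1 z.2)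
    have h1 : ContDiff ℝ ∞ (fun z : ℝ × ℝ => ‖S z.2 + z.1 • X z.2‖) := hv.norm ℝ h0
    exact (h1.inv fun z => hne z.1 z.2).smul hv
  refine ⟨_, hsm, fun x => by simp [hS.2], fun x => ?_, fun t => ⟨?_, fun x => ?_⟩⟩
  · have h1 : HasDerivAt (fun t : ℝ => S x + t • X x) (X x) 0 := by
      simpa using ((hasDerivAt_id (0 : ℝ)).smul_const (X x)).const_add (S x)
    have h2 : HasDerivAt (fun t : ℝ => 1 + t ^ 2 * ‖X x‖ ^ 2) 0 0 := by
      simpa using (((hasDerivAt_id (0 : ℝ)).pow 2).mul_const (‖X x‖ ^ 2)).const_add 1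
    have h3 : (fun t : ℝ => ‖S x + t • X x‖⁻¹) = fun t => (Real.sqrt (1 + t ^ 2 * ‖X x‖ ^ 2))⁻¹ := by
      funext t
      rw [← hn, Real.sqrt_sq (norm_nonneg _)]
    have h4 : HasDerivAt (fun t : ℝ => ‖S x + t • X x‖⁻¹) 0 0 := by
      rw [h3]
      have h5 := (h2.sqrt (hpos 0 x).ne').inv (Real.sqrt_pos.2 (hpos 0 x)).ne'
      rw [zero_div, neg_zero, zero_div] at h5
      exact h5
    have h6 := h4.smul h1
    simp only [zero_smul, add_zero, hS.2, inv_one, one_smul] at h6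
    exact h6
  · exact hsm.comp (contDiff_const.prodMk contDiff_id)
  · rw [norm_smul, norm_inv, norm_norm, inv_mul_cancel₀ (hne t x)]

/-- `evol` is defined by leaving the sphere in the ambient jet space. For tangential `ξ` the same
derivative is obtained from a variation through curves on the sphere, so it depends only on the
values there. -/
theorem ev_evol_congr {φ ψ : DFun Vec3 W} (hφ : IsDFun φ) (hψ : IsDFun ψ)
    (h : EqAlong sphereCurves φ ψ) {ξ : DFun Vec3 Vec3} (hξ : IsDFun ξ) {S : ℝ → Vec3}
    (hS : S ∈ sphereCurves) (hSξ : ∀ x, inner ℝ (S x) (ev ξ S x) = 0) :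
    ev (evol ξ φ) S = ev (evol ξ ψ) S := by
  obtain ⟨Γ, hΓ, h0, h1, h2⟩ := exists_sphere_variation hS (contDiff_ev hξ hS.1) hSξ
  funext x
  have h3 := hasDerivAt_ev_variation hφ hξ hΓ hS.1 h0 h1 x
  have h4 := hasDerivAt_ev_variation hψ hξ hΓ hS.1 h0 h1 x
  simp only [h _ (h2 _)] at h3
  exact h3.unique h4

/-- Moving only the explicit `x` amounts to evaluating along a translated curve, and translates stay
on the sphere. -/
theorem ev_partialX_congr {φ ψ : DFun Vec3 W} (h : EqAlong sphereCurves φ ψ) {S : ℝ → Vec3}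
    (hS : S ∈ sphereCurves) : ev (partialX φ) S = ev (partialX ψ) S := by
  funext x
  have key : ∀ (φ : DFun Vec3 W) (t : ℝ),
      φ (x + t) (jet S x) = ev φ (fun y => S (y - t)) (x + t) := by
    intro φ t
    have : jet S x = jet (fun y => S (y - t)) (x + t) := by
      funext k
      simp [jet, iteratedDeriv_comp_sub_const]
    rw [this]; rfl
  simp only [ev, partialX, key]
  congr 1
  funext t
  have hS' : (fun y => S (y - t)) ∈ sphereCurves :=
    ⟨hS.1.comp (contDiff_id.sub contDiff_const), fun x => hS.2 _⟩
  exact congrFun (h _ hS') (x + t)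

end Variations

/-! ### Integration by parts -/

section Parts

variable {V : Type*} [NormedAddCommGroup V] [InnerProductSpace ℝ V]

/-- The last clause makes the boundary term local in `X`; it is what lets boundary terms vanish off
the support of a test field in `ev_varS_eq`. -/
theorem exists_iterate_parts {X : DFun V V} (hX : IsDFun X) (k : ℕ) :
    ∀ {G : DFun V V}, IsDFun G → ∃ B : DFun V ℝ, IsDFun B ∧
      (∀ x s, inner ℝ (G x s) ((totalD^[k] X) x s)
        = inner ℝ ((-1 : ℝ) ^ k • (totalD^[k] G) x s) (X x s) + totalD B x s) ∧
      ∀ x s, (∀ j, (totalD^[j] X) x s = 0) → B x s = 0 := by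
  induction k with
  | zero =>
    intro G hG
    exact ⟨fun _ _ => 0, IsDFun.const 0, fun x s => by simp [totalD_zero], fun _ _ _ => rfl⟩
  | succ k ih =>
    intro G hG
    obtain ⟨B, hB, h1, h2⟩ := ih hG.totalD
    refine ⟨fun x s => inner ℝ (G x s) ((totalD^[k] X) x s) - B x s,
      (hG.inner (hX.iterate_totalD k)).sub hB, fun x s => ?_, fun x s h => ?_⟩
    · rw [totalD_sub (hG.inner (hX.iterate_totalD k)) hB]
      have := h1 x s
      simp only [totalD_eq_lieD (fun x s => inner ℝ (G x s) ((totalD^[k] X) x s)),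
        lieD_inner hG (hX.iterate_totalD k)]
      rw [← totalD_eq_lieD, ← totalD_eq_lieD, this, Function.iterate_succ_apply',
        Function.iterate_succ_apply, pow_succ, mul_smul, neg_one_smul]
      simp only [inner_neg_left, inner_smul_left]
      simp only [map_pow, map_neg, map_one]
      ring
    · simp [h, h2 x s h]

/-! ### Jet gradients and the Euler operator -/

variable [CompleteSpace V]

/-- The inclusion of the `k`-th jet variable. -/
def jetSingle (V : Type*) [NormedAddCommGroup V] [InnerProductSpace ℝ V] (n k : ℕ) :
    V →L[ℝ] ℝ × (Fin n → V) :=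
  (ContinuousLinearMap.inr ℝ ℝ (Fin n → V)).comp
    (ContinuousLinearMap.pi fun i : Fin n =>
      if (i : ℕ) = k then ContinuousLinearMap.id ℝ V else 0)

theorem jetGrad_eq {φ : DFun V ℝ} {n : ℕ} {g : ℝ × (Fin n → V) → ℝ} (hg : ContDiff ℝ ∞ g)
    (h : ∀ x s, φ x s = g (x, fun i => s i)) (k : ℕ) (x : ℝ) (s : ℕ → V) :
    jetGrad k φ x s = (InnerProductSpace.toDual ℝ V).symm
      ((fderiv ℝ g (x, fun i => s i)).comp (jetSingle V n k)) := by
  have h1 : HasFDerivAt (fun v => (x, fun i : Fin n => Function.update s k v i))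
      (jetSingle V n k) (s k) := by
    have h0 : HasFDerivAt (fun (v : V) (i : Fin n) => Function.update s k v i)
        (ContinuousLinearMap.pi fun i : Fin n =>
          if (i : ℕ) = k then ContinuousLinearMap.id ℝ V else 0) (s k) := by
      refine hasFDerivAt_pi.2 fun i => ?_
      by_cases hi : (i : ℕ) = k
      · simp only [hi, Function.update_self, if_true]
        exact hasFDerivAt_id (s k)
      · simpa [hi] using hasFDerivAt_const (𝕜 := ℝ) (s i) (s k)
    have h1 := (hasFDerivAt_const (𝕜 := ℝ) x (s k)).prodMk h0
    have h2 : jetSingle V n k = ContinuousLinearMap.prod 0 (ContinuousLinearMap.pi fun i : Fin n =>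
        if (i : ℕ) = k then ContinuousLinearMap.id ℝ V else 0) := by
      ext v <;> simp [jetSingle]
    rw [h2]
    exact h1
  have h2 := (hg.differentiable (by simp)).differentiableAt (x := (x, fun i : Fin n => s i))
  have h3 := HasFDerivAt.comp (s k) (by simpa using h2.hasFDerivAt) h1
  simp only [jetGrad, gradient, h]
  rw [← h3.fderiv]
  rfl

theorem IsDFun.jetGrad {φ : DFun V ℝ} (hφ : IsDFun φ) (k : ℕ) : IsDFun (jetGrad k φ) := by
  obtain ⟨n, g, hg, h⟩ := hφ
  refine ⟨n, fun z => (InnerProductSpace.toDual ℝ V).symm ((fderiv ℝ g z).comp (jetSingle V n k)),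
    ?_, jetGrad_eq hg h k⟩
  refine (InnerProductSpace.toDual ℝ V).symm.contDiff.comp ?_
  exact (hg.fderiv_right (m := ∞) (by simp)).clm_comp contDiff_const

/-- Chain rule over the finitely many jet variables present; the bound `n` also turns the `finsum`
in `euler` into a finite sum. -/
theorem exists_jetGrad_eq_zero {φ : DFun V ℝ} (hφ : IsDFun φ) :
    ∃ n, (∀ k, n ≤ k → SpinHierarchy.jetGrad k φ = fun _ _ => 0) ∧ ∀ (ξ : DFun V V) x s,
      evol ξ φ x s
        = ∑ k ∈ Finset.range n, inner ℝ (SpinHierarchy.jetGrad k φ x s) ((totalD^[k] ξ) x s) := by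
  obtain ⟨n, g, hg, h⟩ := hφ
  refine ⟨n, fun k hk => ?_, fun ξ x s => ?_⟩
  · funext x s
    rw [jetGrad_eq hg h]
    have : jetSingle V n k = 0 := by
      refine ContinuousLinearMap.ext fun v => Prod.ext rfl (funext fun i => ?_)
      have : (i : ℕ) ≠ k := by omega
      simp [jetSingle, this]
    rw [this]; simp
  · rw [evol_eq_lieD, lieD_eq_fderiv hg h, Finset.sum_range]
    have h1 : ((0 : ℝ), fun i : Fin n => (totalD^[i] ξ) x s)
        = ∑ k : Fin n, jetSingle V n k ((totalD^[k] ξ) x s) := by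
      refine Prod.ext ?_ (funext fun i => ?_)
      · rw [Prod.fst_sum]; simp [jetSingle]
      · rw [Prod.snd_sum, Finset.sum_apply, Finset.sum_eq_single i]
        · simp [jetSingle]
        · intro j _ hj
          have : (i : ℕ) ≠ j := fun h => hj (Fin.ext h.symm)
          simp [jetSingle, this]
        · simp
    rw [h1, map_sum]
    refine Finset.sum_congr rfl fun k _ => ?_
    rw [jetGrad_eq hg h, InnerProductSpace.toDual_symm_apply]
    rfl

theorem euler_eq_sum {φ : DFun V ℝ} {n : ℕ}
    (h : ∀ k, n ≤ k → jetGrad k φ = fun _ _ => 0) (x : ℝ) (s : ℕ → V) :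
    euler φ x s = ∑ k ∈ Finset.range n, (-1 : ℝ) ^ k • (totalD^[k] (jetGrad k φ)) x s := by
  refine finsum_eq_sum_of_support_subset _ fun k hk => ?_
  by_contra hkn
  simp only [Finset.coe_range, Set.mem_Iio, not_lt] at hkn
  exact hk (by simp [h k hkn, totalD_iterate_zero])

theorem IsDFun.euler {φ : DFun V ℝ} (hφ : IsDFun φ) : IsDFun (euler φ) := by
  obtain ⟨n, hn, -⟩ := exists_jetGrad_eq_zero hφ
  have h1 := IsDFun.sum (Finset.range n) fun k _ =>
    ((hφ.jetGrad k).iterate_totalD k).constSmul ((-1 : ℝ) ^ k)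
  convert h1 using 3 with x s
  exact euler_eq_sum hn x s

/-- The first variation formula. -/
theorem exists_first_variation {F : DFun V ℝ} (hF : IsDFun F) {X : DFun V V} (hX : IsDFun X) :
    ∃ B : DFun V ℝ, IsDFun B ∧
      (∀ x s, evol X F x s = inner ℝ (euler F x s) (X x s) + totalD B x s) ∧
      ∀ x s, (∀ j, (totalD^[j] X) x s = 0) → B x s = 0 := by
  obtain ⟨n, hn, h⟩ := exists_jetGrad_eq_zero hF
  choose B hB h1 h2 using fun k => exists_iterate_parts hX k (hF.jetGrad k)
  refine ⟨fun x s => ∑ k ∈ Finset.range n, B k x s, IsDFun.sum _ fun k _ => hB k,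
    fun x s => ?_, fun x s hx => ?_⟩
  · rw [h, totalD_eq_lieD, lieD_sum _ fun k _ => hB k, euler_eq_sum hn, sum_inner,
      ← Finset.sum_add_distrib]
    refine Finset.sum_congr rfl fun k _ => ?_
    rw [h1, ← totalD_eq_lieD]
  · exact Finset.sum_eq_zero fun k _ => h2 k x s hx

end Parts

/-! ### Vector algebra -/

section Cross

theorem inner_vec3 (a b : Vec3) : inner ℝ a b = a 0 * b 0 + a 1 * b 1 + a 2 * b 2 := by
  simp [PiLp.inner_apply, Fin.sum_univ_three]; ring

theorem cross_zero (a b : Vec3) : cross a b 0 = a 1 * b 2 - a 2 * b 1 := by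
  simp [cross, cross_apply]

theorem cross_one (a b : Vec3) : cross a b 1 = a 2 * b 0 - a 0 * b 2 := by
  simp [cross, cross_apply]

theorem cross_two (a b : Vec3) : cross a b 2 = a 0 * b 1 - a 1 * b 0 := by
  simp [cross, cross_apply]

theorem vec3_ext {a b : Vec3} (h0 : a 0 = b 0) (h1 : a 1 = b 1) (h2 : a 2 = b 2) : a = b := by
  ext i; fin_cases i <;> assumption

/-- The vector product as a continuous bilinear map. -/
def crossL : Vec3 →L[ℝ] Vec3 →L[ℝ] Vec3 :=
  LinearMap.toContinuousLinearMap
    ((LinearMap.toContinuousLinearMap : (Vec3 →ₗ[ℝ] Vec3) ≃ₗ[ℝ] (Vec3 →L[ℝ] Vec3)).toLinearMap ∘ₗ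
      LinearMap.mk₂ ℝ cross
        (fun a b c => by
          apply vec3_ext <;> simp only [cross_zero, cross_one, cross_two, PiLp.add_apply] <;> ring)
        (fun r a b => by
          apply vec3_ext <;>
            simp only [cross_zero, cross_one, cross_two, PiLp.smul_apply, smul_eq_mul] <;> ring)
        (fun a b c => by
          apply vec3_ext <;> simp only [cross_zero, cross_one, cross_two, PiLp.add_apply] <;> ring)
        (fun r a b => by
          apply vec3_ext <;>
            simp only [cross_zero, cross_one, cross_two, PiLp.smul_apply, smul_eq_mul] <;> ring))

theorem crossL_apply (a b : Vec3) : crossL a b = cross a b := rfl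

theorem cross_add_right (a b c : Vec3) : cross a (b + c) = cross a b + cross a c := by
  simp only [← crossL_apply, map_add]

theorem cross_sub_right (a b c : Vec3) : cross a (b - c) = cross a b - cross a c := by
  simp only [← crossL_apply, map_sub]

theorem cross_smul_right (r : ℝ) (a b : Vec3) : cross a (r • b) = r • cross a b := by
  simp only [← crossL_apply, map_smul]

theorem cross_self_eq_zero (a : Vec3) : cross a a = 0 := by
  apply vec3_ext <;> simp only [cross_zero, cross_one, cross_two, PiLp.zero_apply] <;> ring

theorem cross_anticomm' (a b : Vec3) : cross a b = -cross b a := by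
  apply vec3_ext <;> simp only [cross_zero, cross_one, cross_two, PiLp.neg_apply] <;> ring

theorem cross_cross_eq (a b c : Vec3) :
    cross a (cross b c) = inner ℝ a c • b - inner ℝ a b • c := by
  apply vec3_ext <;> simp only [cross_zero, cross_one, cross_two, inner_vec3, PiLp.sub_apply,
    PiLp.smul_apply, smul_eq_mul] <;> ring

theorem inner_cross_self_left (a b : Vec3) : inner ℝ a (cross a b) = 0 := by
  simp only [cross_zero, cross_one, cross_two, inner_vec3]; ring

theorem inner_cross_self_right (a b : Vec3) : inner ℝ b (cross a b) = 0 := by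
  simp only [cross_zero, cross_one, cross_two, inner_vec3]; ring

theorem inner_cross_rotate (a b c : Vec3) : inner ℝ a (cross b c) = inner ℝ b (cross c a) := by
  simp only [cross_zero, cross_one, cross_two, inner_vec3]; ring

theorem inner_cross_comm (a b c : Vec3) : inner ℝ a (cross b c) = -inner ℝ b (cross a c) := by
  simp only [cross_zero, cross_one, cross_two, inner_vec3]; ring

theorem cross_cross_self {S a : Vec3} (hS : ‖S‖ = 1) (ha : inner ℝ S a = 0) :
    cross S (cross S a) = -a := by
  rw [cross_cross_eq, ha]; simp [hS]

theorem inner_tproj_self {c : Vec3} (hc : ‖c‖ = 1) (w : Vec3) : inner ℝ c (tproj c w) = 0 := by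
  simp [tproj, inner_sub_right, inner_smul_right, hc]

theorem cross_tproj (c w : Vec3) : cross c (tproj c w) = cross c w := by
  rw [tproj, cross_sub_right, cross_smul_right, cross_self_eq_zero, smul_zero, sub_zero]

/-- Three vectors that are orthogonal to a unit vector are linearly dependent. -/
theorem triple_eq_zero {S a b c : Vec3} (hS : ‖S‖ = 1) (ha : inner ℝ S a = 0)
    (hb : inner ℝ S b = 0) (hc : inner ℝ S c = 0) : inner ℝ a (cross b c) = 0 := by
  have h : inner ℝ S S = (1 : ℝ) := by rw [real_inner_self_eq_norm_sq, hS]; simp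
  simp only [cross_zero, cross_one, cross_two, inner_vec3] at *
  -- Cramer's rule `det(a,b,c) S = (S·a) b∧c + (S·b) c∧a + (S·c) a∧b`, paired with the unit vector
  -- `S`.
  linear_combination (-(a 0 * (b 1 * c 2 - b 2 * c 1) + a 1 * (b 2 * c 0 - b 0 * c 2)
    + a 2 * (b 0 * c 1 - b 1 * c 0))) * h
    + (S 0 * (b 1 * c 2 - b 2 * c 1) + S 1 * (b 2 * c 0 - b 0 * c 2)
      + S 2 * (b 0 * c 1 - b 1 * c 0)) * ha
    + (S 0 * (c 1 * a 2 - c 2 * a 1) + S 1 * (c 2 * a 0 - c 0 * a 2)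
      + S 2 * (c 0 * a 1 - c 1 * a 0)) * hb
    + (S 0 * (a 1 * b 2 - a 2 * b 1) + S 1 * (a 2 * b 0 - a 0 * b 2)
      + S 2 * (a 0 * b 1 - a 1 * b 0)) * hc

variable {V : Type*} [NormedAddCommGroup V] [InnerProductSpace ℝ V]

theorem IsDFun.cross {φ ψ : DFun V Vec3} (hφ : IsDFun φ) (hψ : IsDFun ψ) :
    IsDFun (fun x s => cross (φ x s) (ψ x s)) := hφ.bilin crossL hψ

theorem lieD_cross {a : DFun V ℝ} {A : ℕ → DFun V V} {φ ψ : DFun V Vec3} (hφ : IsDFun φ)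
    (hψ : IsDFun ψ) (x : ℝ) (s : ℕ → V) :
    lieD a A (fun x s => SpinHierarchy.cross (φ x s) (ψ x s)) x s
      = SpinHierarchy.cross (lieD a A φ x s) (ψ x s)
        + SpinHierarchy.cross (φ x s) (lieD a A ψ x s) :=
  lieD_bilin crossL hφ hψ x s

end Cross

/-! ### Total derivatives along a class of curves -/

section Total

variable {V : Type*} [NormedAddCommGroup V] [InnerProductSpace ℝ V] {𝒞 ℬ : Set (ℝ → V)}
  {g g' p p' : DFun V ℝ}

theorem isTotal_of_totalD (h𝒞 : ∀ c ∈ 𝒞, ContDiff ℝ ∞ c) (hp : IsDFun p)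
    (h : ∀ c ∈ 𝒞, ∀ x, totalD p x (jet c x) = g x (jet c x)) : IsTotal 𝒞 g :=
  ⟨p, hp, fun c hc x => by
    have := hasDerivAt_ev hp (h𝒞 c hc) x
    rwa [show ev (totalD p) c x = ev g c x from h c hc x] at this⟩

theorem IsPrimitive.totalD_eq (h𝒞 : ∀ c ∈ 𝒞, ContDiff ℝ ∞ c) (h : IsPrimitive 𝒞 g p)
    {c : ℝ → V} (hc : c ∈ 𝒞) (x : ℝ) : totalD p x (jet c x) = g x (jet c x) :=
  (hasDerivAt_ev h.1 (h𝒞 c hc) x).unique (h.2 c hc x)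

theorem IsTotal.congr (h : IsTotal 𝒞 g) (hg : ∀ c ∈ 𝒞, ∀ x, g x (jet c x) = g' x (jet c x)) :
    IsTotal 𝒞 g' := by
  obtain ⟨p, hp, h⟩ := h
  exact ⟨p, hp, fun c hc x => by
    have := h c hc x
    rwa [show ev g c x = ev g' c x from hg c hc x] at this⟩

theorem IsTotal.add (h : IsTotal 𝒞 g) (h' : IsTotal 𝒞 g') :
    IsTotal 𝒞 (fun x s => g x s + g' x s) := by
  obtain ⟨p, hp, h⟩ := h
  obtain ⟨p', hp', h'⟩ := h'
  exact ⟨_, hp.add hp', fun c hc x => (h c hc x).add (h' c hc x)⟩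

theorem IsTotal.neg (h : IsTotal 𝒞 g) : IsTotal 𝒞 (fun x s => -g x s) := by
  obtain ⟨p, hp, h⟩ := h
  exact ⟨_, hp.neg, fun c hc x => (h c hc x).neg⟩

theorem IsTotal.sub (h : IsTotal 𝒞 g) (h' : IsTotal 𝒞 g') :
    IsTotal 𝒞 (fun x s => g x s - g' x s) := by
  simpa only [sub_eq_add_neg] using h.add h'.neg

/-- If all curves of the class can be deformed into a vacuum curve away from any given point, then
the normalised primitive is unique. -/
theorem IsInvD.eqAlong
    (hdef : ∀ c ∈ 𝒞, ∀ x, ∃ c' ∈ 𝒞, c' =ᶠ[nhds x] c ∧ ∃ y, ∃ b ∈ ℬ, c' =ᶠ[nhds y] b)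
    (h : IsInvD 𝒞 ℬ g p) (h' : IsInvD 𝒞 ℬ g' p') (hg : EqAlong 𝒞 g g') : EqAlong 𝒞 p p' := by
  intro c hc
  funext x
  obtain ⟨c', hc', h1, y, b, hb, h2⟩ := hdef c hc x
  -- On the deformed curve the two primitives differ by a constant, which is read off at the point
  -- `y` where the curve is a vacuum curve.
  have hd : ∀ z, HasDerivAt (fun z => ev p c' z - ev p' c' z) 0 z := fun z => by
    have := (h.1.2 c' hc' z).sub (h'.1.2 c' hc' z)
    rwa [hg c' hc', sub_self] at this
  have hconst := is_const_of_deriv_eq_zero (fun z => (hd z).differentiableAt)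
    (fun z => (hd z).deriv) x y
  have e1 : ∀ q : DFun V ℝ, ev q c' x = ev q c x := fun q => by simp only [ev, jet_congr h1]
  have e2 : ∀ q : DFun V ℝ, ev q c' y = ev q b y := fun q => by simp only [ev, jet_congr h2]
  simp only [e1, e2, h.2 b hb, h'.2 b hb, sub_self] at hconst
  exact sub_eq_zero.1 hconst

theorem invD_spec (h : ∃ p, IsInvD 𝒞 ℬ g p) : IsInvD 𝒞 ℬ g (invD 𝒞 ℬ g) := by
  rw [invD, dif_pos h]
  exact h.choose_spec

theorem IsInvD.congr (h : IsInvD 𝒞 ℬ g p) (hg : EqAlong 𝒞 g g') : IsInvD 𝒞 ℬ g' p :=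
  ⟨⟨h.1.1, fun c hc x => by rw [← hg c hc]; exact h.1.2 c hc x⟩, h.2⟩

theorem invD_eqAlong
    (hdef : ∀ c ∈ 𝒞, ∀ x, ∃ c' ∈ 𝒞, c' =ᶠ[nhds x] c ∧ ∃ y, ∃ b ∈ ℬ, c' =ᶠ[nhds y] b)
    (h : IsInvD 𝒞 ℬ g p) : EqAlong 𝒞 (invD 𝒞 ℬ g) p :=
  (invD_spec ⟨p, h⟩).eqAlong hdef h fun _ _ => rfl

/-- A smooth function that is the identity near `x` and has the value `x` near `x + 3`. -/
theorem exists_smooth_retraction (x : ℝ) : ∃ τ : ℝ → ℝ, ContDiff ℝ ∞ τ ∧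
    τ =ᶠ[nhds x] id ∧ τ =ᶠ[nhds (x + 3)] fun _ => x := by
  let θ : ContDiffBump x := ⟨1, 2, one_pos, one_lt_two⟩
  refine ⟨fun y => x + θ y * (y - x), contDiff_const.add
    (θ.contDiff.mul (contDiff_id.sub contDiff_const)), ?_, ?_⟩
  · filter_upwards [θ.eventuallyEq_one] with y hy
    simp [hy]
  · filter_upwards [Metric.ball_mem_nhds (x + 3) one_pos] with y hy
    have : θ y = 0 := θ.zero_of_le_dist (by
      rw [Metric.mem_ball, Real.dist_eq, abs_lt] at hy
      rw [Real.dist_eq, abs_of_nonneg (by linarith)]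
      change (2 : ℝ) ≤ y - x
      linarith)
    simp [this]

/-- Reparametrising by a map that is constant somewhere keeps the curve on the sphere, which
multiplication by a cut-off would not. -/
theorem sphere_deformation : ∀ c ∈ sphereCurves, ∀ x, ∃ c' ∈ sphereCurves, c' =ᶠ[nhds x] c ∧
    ∃ y, ∃ b ∈ sphereVacuum, c' =ᶠ[nhds y] b := by
  intro c hc x
  obtain ⟨τ, hτ, h1, h2⟩ := exists_smooth_retraction x
  refine ⟨fun y => c (τ y), ⟨hc.1.comp hτ, fun y => hc.2 _⟩, ?_, x + 3, fun _ => c x,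
    ⟨c x, hc.2 x, rfl⟩, ?_⟩
  · filter_upwards [h1] with y hy; rw [hy]; rfl
  · filter_upwards [h2] with y hy; rw [hy]

theorem complex_deformation : ∀ c ∈ uCurves, ∀ x, ∃ c' ∈ uCurves, c' =ᶠ[nhds x] c ∧
    ∃ y, ∃ b ∈ uVacuum, c' =ᶠ[nhds y] b := by
  intro c hc x
  let θ : ContDiffBump x := ⟨1, 2, one_pos, one_lt_two⟩
  refine ⟨fun y => θ y • c y, θ.contDiff.smul hc, ?_, x + 3, fun _ => 0, rfl, ?_⟩
  · filter_upwards [θ.eventuallyEq_one] with y hy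
    simp [hy]
  · filter_upwards [Metric.ball_mem_nhds (x + 3) one_pos] with y hy
    have : θ y = 0 := θ.zero_of_le_dist (by
      rw [Metric.mem_ball, Real.dist_eq, abs_lt] at hy
      rw [Real.dist_eq, abs_of_nonneg (by linarith)]
      change (2 : ℝ) ≤ y - x
      linarith)
    simp [this]

end Total

/-! ### Functionals of curves on the unit sphere -/

section Sphere

theorem contDiff_of_mem_sphereCurves : ∀ c ∈ sphereCurves, ContDiff ℝ ∞ c := fun _ h => h.1

theorem inner_deriv_sphere {S : ℝ → Vec3} (hS : S ∈ sphereCurves) (x : ℝ) :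
    inner ℝ (S x) (deriv S x) = 0 := by
  have h1 := (hS.1.differentiable (by simp) x).hasDerivAt
  have h2 := h1.inner ℝ h1
  have h3 : (fun y => inner ℝ (S y) (S y)) = fun _ => (1 : ℝ) := by
    funext y; rw [real_inner_self_eq_norm_sq, hS.2]; simp
  rw [h3] at h2
  have h4 := h2.unique (hasDerivAt_const x (1 : ℝ))
  rw [real_inner_comm] at h4 ⊢
  rw [real_inner_comm] at h4
  linarith [real_inner_comm (S x) (deriv S x)]

theorem norm_jet_zero {S : ℝ → Vec3} (hS : S ∈ sphereCurves) (x : ℝ) : ‖jet S x 0‖ = 1 := by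
  rw [jet_zero, hS.2]

theorem inner_jet_zero_one {S : ℝ → Vec3} (hS : S ∈ sphereCurves) (x : ℝ) :
    inner ℝ (jet S x 0) (jet S x 1) = 0 := by
  rw [jet_zero, jet_one, inner_deriv_sphere hS]

/-- `X` is tangent to the unit sphere along all curves on it. -/
def IsTangent (X : DFun Vec3 Vec3) : Prop :=
  ∀ S ∈ sphereCurves, ∀ x, inner ℝ (jet S x 0) (X x (jet S x)) = 0

theorem IsDFun.varS {F : DFun Vec3 ℝ} (hF : IsDFun F) : IsDFun (varS F) :=
  hF.euler.sub (((IsDFun.coord 0).inner hF.euler).smul (IsDFun.coord 0))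

theorem isTangent_varS (F : DFun Vec3 ℝ) : IsTangent (varS F) := fun _ hS x =>
  inner_tproj_self (norm_jet_zero hS x) _

theorem inner_varS_eq {F : DFun Vec3 ℝ} {x : ℝ} {s : ℕ → Vec3} {v : Vec3}
    (hv : inner ℝ (s 0) v = 0) : inner ℝ v (varS F x s) = inner ℝ (euler F x s) v := by
  rw [varS, tproj, inner_sub_right, inner_smul_right, real_inner_comm (s 0) v, hv,
    real_inner_comm]
  simp

/-- A field along one fixed curve counts as a differential function of `x` alone; compactly
supported test fields thereby enter the formal calculus. -/
theorem totalD_iterate_ofFun {X : ℝ → Vec3} (k : ℕ) :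
    totalD^[k] (fun x _ => X x : DFun Vec3 Vec3) = fun x _ => iteratedDeriv k X x := by
  induction k with
  | zero => simp
  | succ k ih =>
    rw [Function.iterate_succ_apply', ih]
    funext x s
    rw [iteratedDeriv_succ, totalD]
    simpa using deriv_comp_const_add (iteratedDeriv k X) x 0

/-- A characterisation of the variational derivative along a curve on the unit sphere. -/
theorem ev_varS_eq {F : DFun Vec3 ℝ} (hF : IsDFun F) {S V : ℝ → Vec3} (hS : S ∈ sphereCurves)
    (hV : ContDiff ℝ ∞ V) (hSV : ∀ x, inner ℝ (S x) (V x) = 0)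
    (h : ∀ X : ℝ → Vec3, ContDiff ℝ ∞ X → (∀ x, inner ℝ (S x) (X x) = 0) → ∃ P : ℝ → ℝ,
      (∀ x, HasDerivAt P (ev (evol (fun y _ => X y) F) S x - inner ℝ (X x) (V x)) x) ∧
      ∀ x, X =ᶠ[nhds x] 0 → P x = 0) :
    ev (varS F) S = V := by
  funext x₀
  -- Du Bois-Reymond argument with test field `θ w`. The difference of the two boundary terms has
  -- derivative `θ |w|² ≥ 0` and vanishes at distance more than 2 from `x₀`. Being monotone, it
  -- vanishes around `x₀` as well, and `θ x₀ = 1` forces `w x₀ = 0`.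
  let θ : ContDiffBump x₀ := ⟨1, 2, one_pos, one_lt_two⟩
  set w : ℝ → Vec3 := fun x => ev (varS F) S x - V x with hw
  have hwS : ∀ x, inner ℝ (S x) (w x) = 0 := fun x => by
    have := isTangent_varS F S hS x
    rw [jet_zero] at this
    rw [hw, inner_sub_right, hSV, ev, this, sub_zero]
  have hws : ContDiff ℝ ∞ w := (contDiff_ev hF.varS hS.1).sub hV
  have hX : ContDiff ℝ ∞ (fun x => θ x • w x) := θ.contDiff.smul hws
  have hXS : ∀ x, inner ℝ (S x) (θ x • w x) = 0 := fun x => by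
    rw [inner_smul_right, hwS, mul_zero]
  obtain ⟨P, hP, hP0⟩ := h _ hX hXS
  obtain ⟨B, hB, hB1, hB0⟩ := exists_first_variation hF (IsDFun.ofFun (V := Vec3) hX)
  have hR : ∀ x, HasDerivAt (fun x => P x - ev B S x) (θ x * ‖w x‖ ^ 2) x := by
    intro x
    have h1 := (hP x).sub (hasDerivAt_ev hB hS.1 x)
    refine h1.congr_deriv ?_
    change evol (fun y _ => θ y • w y) F x (jet S x) - inner ℝ (θ x • w x) (V x)
      - totalD B x (jet S x) = _
    have h2 := hB1 x (jet S x)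
    have h3 : inner ℝ (θ x • w x) (varS F x (jet S x))
        = inner ℝ (euler F x (jet S x)) (θ x • w x) :=
      inner_varS_eq (by rw [jet_zero]; exact hXS x)
    have h4 : inner ℝ (w x) (w x) = ‖w x‖ ^ 2 := real_inner_self_eq_norm_sq _
    have h5 : inner ℝ (w x) (w x)
        = inner ℝ (w x) (varS F x (jet S x)) - inner ℝ (w x) (V x) := by
      rw [← inner_sub_right]; rfl
    rw [h2, ← h3, ← h4, h5, real_inner_smul_left, real_inner_smul_left]
    ring
  have hzero : ∀ x, 2 < dist x x₀ → P x - ev B S x = 0 := by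
    intro x hx
    have h0 : (fun x => θ x • w x) =ᶠ[nhds x] 0 := by
      have : ∀ᶠ y in nhds x, 2 < dist y x₀ :=
        (isOpen_lt continuous_const (continuous_id.dist continuous_const)).mem_nhds hx
      filter_upwards [this] with y hy
      simp [θ.zero_of_le_dist hy.le]
    rw [hP0 x h0, ev, hB0 x, sub_zero]
    intro j
    rw [totalD_iterate_ofFun]
    simpa using h0.iteratedDeriv_eq j
  have hmono : Monotone fun x => P x - ev B S x :=
    monotone_of_deriv_nonneg (fun x => (hR x).differentiableAt) fun x => by
      rw [(hR x).deriv]; exact mul_nonneg θ.nonneg (sq_nonneg _)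
  have hev : (fun x => P x - ev B S x) =ᶠ[nhds x₀] fun _ => 0 := by
    filter_upwards [Metric.ball_mem_nhds x₀ one_pos] with y hy
    rw [Metric.mem_ball, Real.dist_eq, abs_lt] at hy
    have h1 := hmono (show x₀ - 3 ≤ y by linarith)
    have h2 := hmono (show y ≤ x₀ + 3 by linarith)
    have h3 := hzero (x₀ - 3) (by rw [Real.dist_eq]; norm_num)
    have h4 := hzero (x₀ + 3) (by rw [Real.dist_eq]; norm_num)
    simp only [h3, h4] at h1 h2
    exact le_antisymm h2 h1
  have h5 := ((hR x₀).congr_of_eventuallyEq hev.symm).unique (hasDerivAt_const x₀ (0 : ℝ))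
  rw [θ.one_of_mem_closedBall (Metric.mem_closedBall_self zero_le_one), one_mul] at h5
  exact sub_eq_zero.1 (norm_eq_zero.1 (pow_eq_zero_iff two_ne_zero |>.1 h5))

/-- If `g = D_x p` on the sphere, then `X(g) = X(D_x p) = D_x X(p)`; tangency of `X` justifies the
first equality. -/
theorem IsTotal.evol {g : DFun Vec3 ℝ} (h : IsTotal sphereCurves g) (hg : IsDFun g)
    {X : DFun Vec3 Vec3} (hX : IsDFun X) (hXt : IsTangent X) :
    IsTotal sphereCurves (evol X g) := by
  obtain ⟨p, hp⟩ := h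
  refine isTotal_of_totalD contDiff_of_mem_sphereCurves (hp.1.evol hX) fun S hS x => ?_
  rw [totalD_evol hp.1 hX]
  refine congrFun (ev_evol_congr (φ := SpinHierarchy.totalD p) (ψ := g) hp.1.totalD hg (fun S hS => funext fun x => ?_) hX hS
    fun x => ?_) x
  · exact hp.totalD_eq contDiff_of_mem_sphereCurves hS x
  · have := hXt S hS x
    rwa [jet_zero] at this

theorem IsTotal.partialX {g : DFun Vec3 ℝ} (h : IsTotal sphereCurves g) :
    IsTotal sphereCurves (partialX g) := by
  obtain ⟨p, hp⟩ := h
  refine isTotal_of_totalD contDiff_of_mem_sphereCurves hp.1.partialX fun S hS x => ?_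
  rw [totalD_partialX hp.1]
  exact congrFun (ev_partialX_congr (φ := totalD p) (ψ := g) (fun S hS => funext fun x =>
    hp.totalD_eq contDiff_of_mem_sphereCurves hS x) hS) x

theorem isTotal_evol_sub_inner_varS {F : DFun Vec3 ℝ} (hF : IsDFun F) {X : DFun Vec3 Vec3}
    (hX : IsDFun X) (hXt : IsTangent X) :
    IsTotal sphereCurves (fun x s => SpinHierarchy.evol X F x s - inner ℝ (X x s) (varS F x s)) := by
  obtain ⟨B, hB, h, -⟩ := exists_first_variation hF hX
  refine isTotal_of_totalD contDiff_of_mem_sphereCurves hB fun S hS x => ?_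
  rw [h, inner_varS_eq (hXt S hS x)]
  ring

end Sphere

/-! ### The hierarchy of vector models -/

section Hierarchy

open Finset.HasAntidiagonal (antidiagonal mem_antidiagonal)

/-- The coefficients of the formal solution `m = S + O(λ)` of `λ m_x = m ∧ S`, `|m| = 1`. -/
def spinM : ℕ → DFun Vec3 Vec3
  | 0 => fun _ s => s 0
  | n + 1 => fun x s => cross (s 0) (totalD (spinM n) x s)
      - (2⁻¹ * ∑ i : Fin n, inner ℝ (spinM (i + 1) x s) (spinM (n - i) x s)) • s 0
termination_by n => n
decreasing_by all_goals omega

/-- The density `D_x⁻¹ ((S ∧ S_x) · f^{(n)})`. -/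
def spinH (n : ℕ) : DFun Vec3 ℝ := fun x s => -inner ℝ (s 0) (spinM (n + 1) x s)

theorem spinM_zero : spinM 0 = fun _ s => s 0 := by rw [spinM]

theorem spinM_succ (n : ℕ) : spinM (n + 1) = fun x s => cross (s 0) (totalD (spinM n) x s)
      - (2⁻¹ * ∑ i ∈ Finset.range n, inner ℝ (spinM (i + 1) x s) (spinM (n - i) x s)) • s 0 := by
  rw [spinM]
  funext x s
  rw [Finset.sum_range]

theorem isDFun_spinM (n : ℕ) : IsDFun (spinM n) := by
  induction n using Nat.strong_induction_on with
  | _ n ih =>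
    cases n with
    | zero => rw [spinM_zero]; exact IsDFun.coord 0
    | succ n =>
      rw [spinM_succ]
      refine ((IsDFun.coord 0).cross (ih n (by omega)).totalD).sub
        (((IsDFun.const 2⁻¹).mul (IsDFun.sum _ fun i hi => ?_)).smul (IsDFun.coord 0))
      rw [Finset.mem_range] at hi
      exact (ih _ (by omega)).inner (ih _ (by omega))

theorem isDFun_spinH (n : ℕ) : IsDFun (spinH n) :=
  ((IsDFun.coord 0).inner (isDFun_spinM _)).neg

theorem spinH_eq {x : ℝ} {s : ℕ → Vec3} (hs : ‖s 0‖ = 1) (n : ℕ) : spinH n x s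
    = 2⁻¹ * ∑ i ∈ Finset.range n, inner ℝ (spinM (i + 1) x s) (spinM (n - i) x s) := by
  simp only [spinH, spinM_succ n, inner_sub_right, inner_smul_right, inner_cross_self_left,
    real_inner_self_eq_norm_sq, hs]
  ring

theorem spinM_succ_eq {x : ℝ} {s : ℕ → Vec3} (hs : ‖s 0‖ = 1) (n : ℕ) :
    spinM (n + 1) x s = cross (s 0) (totalD (spinM n) x s) - spinH n x s • s 0 := by
  rw [spinH_eq hs, spinM_succ]

/-- This is `|m|² = 1`: the two end terms contribute `2 S · m_{n+1} = -2 h_n`, the inner ones `2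
h_n` by `spinH_eq`. -/
theorem sum_inner_spinM {x : ℝ} {s : ℕ → Vec3} (hs : ‖s 0‖ = 1) (n : ℕ) :
    ∑ ij ∈ antidiagonal n, inner ℝ (spinM ij.1 x s) (spinM ij.2 x s)
      = if n = 0 then (1 : ℝ) else 0 := by
  cases n with
  | zero => simp [spinM_zero, hs]
  | succ n =>
    have h1 := spinH_eq (x := x) hs n
    have h2 : spinH n x s = -inner ℝ (s 0) (spinM (n + 1) x s) := rfl
    rw [Finset.Nat.sum_antidiagonal_eq_sum_range_succ_mk, Finset.sum_range_succ,
      Finset.sum_range_succ']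
    simp only [Nat.add_sub_add_right, Nat.sub_zero, Nat.sub_self, spinM_zero,
      Nat.add_eq_zero_iff, one_ne_zero, and_false, if_false]
    rw [real_inner_comm (s 0)]
    linarith

theorem lieD_sum_inner {a : DFun Vec3 ℝ} {A : ℕ → DFun Vec3 Vec3} {M : ℕ → DFun Vec3 Vec3}
    (hM : ∀ n, IsDFun (M n)) (n : ℕ) (x : ℝ) (s : ℕ → Vec3) :
    lieD a A (fun x s => ∑ ij ∈ antidiagonal n, inner ℝ (M ij.1 x s) (M ij.2 x s)) x s
      = 2 * ∑ ij ∈ antidiagonal n, inner ℝ (M ij.1 x s) (lieD a A (M ij.2) x s) := by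
  rw [lieD_sum _ fun ij _ => (hM ij.1).inner (hM ij.2)]
  simp only [lieD_inner (hM _) (hM _), Finset.sum_add_distrib]
  rw [← Finset.Nat.sum_antidiagonal_swap, two_mul]
  congr 1
  exact Finset.sum_congr rfl fun ij _ => real_inner_comm _ _

theorem sum_inner_totalD_spinM {S : ℝ → Vec3} (hS : S ∈ sphereCurves) (x : ℝ) (n : ℕ) :
    ∑ ij ∈ antidiagonal n,
      inner ℝ (spinM ij.1 x (jet S x)) (totalD (spinM ij.2) x (jet S x)) = (0 : ℝ) := by
  have h1 : IsDFun (fun x s => ∑ ij ∈ antidiagonal n,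
      (inner ℝ (spinM ij.1 x s) (spinM ij.2 x s) : ℝ)) :=
    IsDFun.sum _ fun ij _ => (isDFun_spinM _).inner (isDFun_spinM _)
  have h2 := ev_totalD_congr h1 (IsDFun.const (if n = 0 then (1 : ℝ) else 0)) hS.1
    (funext fun y => sum_inner_spinM (norm_jet_zero hS y) n)
  have h3 := congrFun h2 x
  simp only [ev] at h3
  rw [totalD_eq_lieD, totalD_eq_lieD, lieD_sum_inner isDFun_spinM, lieD_const] at h3
  simp only [totalD_eq_lieD]
  linarith

/-- The two claims support each other. Differentiating `|m|² = 1` isolates `S · D_x m_n`; by the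
equation already known for lower orders the other terms are `m_i · (m_j ∧ S)`, which cancel in
pairs. Tangency of `D_x m_n` then allows `S ∧` to be inverted in the recursion. -/
theorem totalD_spinM_aux {S : ℝ → Vec3} (hS : S ∈ sphereCurves) (x : ℝ) (n : ℕ) :
    inner ℝ (jet S x 0) (totalD (spinM n) x (jet S x)) = 0 ∧
    totalD (spinM n) x (jet S x) = cross (spinM (n + 1) x (jet S x)) (jet S x 0) := by
  induction n using Nat.strong_induction_on with
  | _ n ih =>
    have h1 : inner ℝ (jet S x 0) (totalD (spinM n) x (jet S x)) = 0 := by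
      cases n with
      | zero =>
        rw [spinM_zero, totalD_coord]
        exact inner_jet_zero_one hS x
      | succ n =>
        have h := sum_inner_totalD_spinM hS x (n + 1)
        rw [Finset.Nat.sum_antidiagonal_succ] at h
        have h2 : ∑ ij ∈ antidiagonal n, inner ℝ (spinM (ij.1 + 1) x (jet S x))
            (totalD (spinM ij.2) x (jet S x)) = ∑ ij ∈ antidiagonal n,
              inner ℝ (spinM (ij.1 + 1) x (jet S x))
                (cross (spinM (ij.2 + 1) x (jet S x)) (jet S x 0)) := by
          refine Finset.sum_congr rfl fun ij hij => ?_
          rw [(ih ij.2 (by have := mem_antidiagonal.1 hij; omega)).2]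
        have h3 : ∑ ij ∈ antidiagonal n, inner ℝ (spinM (ij.1 + 1) x (jet S x))
            (cross (spinM (ij.2 + 1) x (jet S x)) (jet S x 0)) = -∑ ij ∈ antidiagonal n,
              inner ℝ (spinM (ij.1 + 1) x (jet S x))
                (cross (spinM (ij.2 + 1) x (jet S x)) (jet S x 0)) := by
          nth_rw 1 [← Finset.Nat.sum_antidiagonal_swap]
          rw [← Finset.sum_neg_distrib]
          exact Finset.sum_congr rfl fun ij _ => inner_cross_comm _ _ _
        simp only [spinM_zero] at h
        rw [h2] at h
        linarith
    refine ⟨h1, ?_⟩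
    have hs := norm_jet_zero hS x
    rw [cross_anticomm', spinM_succ_eq hs, cross_sub_right, cross_smul_right, cross_self_eq_zero,
      smul_zero, sub_zero, cross_cross_self hs h1, neg_neg]

theorem inner_totalD_spinM {S : ℝ → Vec3} (hS : S ∈ sphereCurves) (x : ℝ) (n : ℕ) :
    inner ℝ (jet S x 0) (totalD (spinM n) x (jet S x)) = 0 := (totalD_spinM_aux hS x n).1

theorem totalD_spinM {S : ℝ → Vec3} (hS : S ∈ sphereCurves) (x : ℝ) (n : ℕ) :
    totalD (spinM n) x (jet S x) = cross (spinM (n + 1) x (jet S x)) (jet S x 0) :=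
  (totalD_spinM_aux hS x n).2

theorem cross_eq_smul {S a b : Vec3} (hS : ‖S‖ = 1) (ha : inner ℝ S a = 0)
    (hb : inner ℝ S b = 0) : cross a b = inner ℝ S (cross a b) • S := by
  have h := cross_cross_eq S S (cross a b)
  rw [cross_cross_eq S a b, ha, hb] at h
  simp only [zero_smul, sub_zero, real_inner_self_eq_norm_sq, hS] at h
  rw [← crossL_apply, map_zero] at h
  simpa [sub_eq_zero, eq_comm] using h

/-- As `D_x m_{n+1}` is orthogonal to `S`, the left side is `-S_x · m_{n+1}`, and only the
tangential part `S ∧ D_x m_n` of `m_{n+1}` meets `S_x`. This makes the integral in the recursion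
local. -/
theorem totalD_spinH {S : ℝ → Vec3} (hS : S ∈ sphereCurves) (x : ℝ) (n : ℕ) :
    totalD (spinH n) x (jet S x)
      = inner ℝ (cross (jet S x 0) (jet S x 1)) (totalD (spinM n) x (jet S x)) := by
  have h1 : totalD (spinH n) x (jet S x) = -(inner ℝ (jet S x 1) (spinM (n + 1) x (jet S x))
      + inner ℝ (jet S x 0) (totalD (spinM (n + 1)) x (jet S x))) := by
    simp only [totalD_eq_lieD]
    refine (lieD_neg ((IsDFun.coord 0).inner (isDFun_spinM _)) x _).trans ?_
    rw [lieD_inner (IsDFun.coord 0) (isDFun_spinM _), lieD_coord]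
  rw [h1, inner_totalD_spinM hS, spinM_succ_eq (norm_jet_zero hS x), inner_sub_right,
    inner_smul_right, real_inner_comm (jet S x 0) (jet S x 1), inner_jet_zero_one hS,
    inner_cross_comm, real_inner_comm (totalD (spinM n) x (jet S x)) (cross _ _),
    inner_cross_comm, real_inner_comm]
  simp only [cross_zero, cross_one, cross_two, inner_vec3]
  ring

/-- Differentiate `m_{n+1} = S ∧ D_x m_n - h_n S`. The vector `S_x ∧ D_x m_n` is normal, equals
`(D_x h_n) S`, and cancels; what is left is the recursion defining `f^{(n+1)}`. -/
theorem totalD_spinM_succ {S : ℝ → Vec3} (hS : S ∈ sphereCurves) (x : ℝ) (n : ℕ) :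
    totalD (spinM (n + 1)) x (jet S x)
      = cross (jet S x 0) (totalD (totalD (spinM n)) x (jet S x))
        - spinH n x (jet S x) • jet S x 1 := by
  have hf := (isDFun_spinM n).totalD
  have h1 := ev_totalD_congr (isDFun_spinM (n + 1))
    (((IsDFun.coord 0).cross hf).sub ((isDFun_spinH n).smul (IsDFun.coord 0))) hS.1
    (funext fun y => spinM_succ_eq (norm_jet_zero hS y) n)
  have h2 := congrFun h1 x
  simp only [ev] at h2
  rw [h2, totalD_eq_lieD, lieD_sub ((IsDFun.coord 0).cross hf)
    ((isDFun_spinH n).smul (IsDFun.coord 0)), lieD_cross (IsDFun.coord 0) hf,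
    lieD_smul (isDFun_spinH n) (IsDFun.coord 0), lieD_coord]
  simp only [← totalD_eq_lieD]
  rw [totalD_spinH hS, zero_add, cross_eq_smul (norm_jet_zero hS x) (inner_jet_zero_one hS x)
    (inner_totalD_spinM hS x n)]
  have : inner ℝ (jet S x 0) (cross (jet S x 1) (totalD (spinM n) x (jet S x)))
      = inner ℝ (cross (jet S x 0) (jet S x 1)) (totalD (spinM n) x (jet S x)) := by
    simp only [cross_zero, cross_one, cross_two, inner_vec3]; ring
  rw [this]
  abel

theorem spinM_vacuum (e : Vec3) (n : ℕ) (x : ℝ) : ev (spinM (n + 1)) (fun _ => e) x = 0 := by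
  induction n using Nat.strong_induction_on generalizing x with
  | _ n ih =>
    have h1 : ev (totalD (spinM n)) (fun _ => e) x = 0 := by
      rw [← (hasDerivAt_ev (isDFun_spinM n) contDiff_const x).deriv]
      cases n with
      | zero =>
        have : ev (spinM 0) (fun _ => e) = fun _ => e := by
          funext y; simp [ev, spinM_zero, jet]
        rw [this]; simp
      | succ n =>
        have : ev (spinM (n + 1)) (fun _ => e) = fun _ => 0 := funext (ih n (by omega))
        rw [this]; simp
    simp only [ev] at h1 ih
    have h2 : ∑ i ∈ Finset.range n, inner ℝ (spinM (i + 1) x (jet (fun _ => e) x))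
        (spinM (n - i) x (jet (fun _ => e) x)) = (0 : ℝ) :=
      Finset.sum_eq_zero fun i hi => by
        rw [Finset.mem_range] at hi
        rw [ih i hi, inner_zero_left]
    rw [ev, spinM_succ]
    simp only [h1, h2, mul_zero, zero_smul, sub_zero]
    rw [← crossL_apply, map_zero]

theorem spinH_vacuum (n : ℕ) : ∀ c ∈ sphereVacuum, ∀ x, ev (spinH n) c x = 0 := by
  rintro c ⟨e, -, rfl⟩ x
  have := spinM_vacuum e n x
  simp only [ev, spinH] at this ⊢
  rw [this, inner_zero_right, neg_zero]

/-- The integral in the recursion for the flows. -/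
theorem isInvD_spinH {f : DFun Vec3 Vec3} (n : ℕ) (hf : EqAlong sphereCurves f (totalD (spinM n))) :
    IsInvD sphereCurves sphereVacuum
      (fun x s => inner ℝ (cross (s 0) (s 1)) (f x s)) (spinH n) := by
  refine ⟨⟨isDFun_spinH n, fun S hS x => ?_⟩, spinH_vacuum n⟩
  have h := hasDerivAt_ev (isDFun_spinH n) hS.1 x
  have h1 := totalD_spinH hS x n
  have h2 : f x (jet S x) = totalD (spinM n) x (jet S x) := congrFun (hf S hS) x
  rw [← h2] at h1
  exact h.congr_deriv h1

/-- `S ∧` is an isometry of the tangent plane and `S ∧ S_x` is orthogonal to `S_x`, so the recursion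
gives `(S ∧ S_x) · D_x m_{n+1} = S_x · D_x² m_n`. Only the component of `f` along `S_x` enters, so
`D_x f^{(n)}` and `∇_x F^{(n)}` both qualify. -/
theorem isInvD_spinH_succ {f : DFun Vec3 Vec3} (n : ℕ)
    (hf : ∀ S ∈ sphereCurves, ∀ x,
      inner ℝ (jet S x 1) (f x (jet S x))
        = inner ℝ (jet S x 1) (totalD (totalD (spinM n)) x (jet S x))) :
    IsInvD sphereCurves sphereVacuum
      (fun x s => inner ℝ (s 1) (f x s)) (spinH (n + 1)) := by
  refine (isInvD_spinH (n + 1) fun _ _ => rfl).congr fun S hS => funext fun x => ?_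
  simp only [ev, hf S hS]
  have h1 := inner_jet_zero_one hS x
  have h2 : inner ℝ (jet S x 0) (jet S x 0) = (1 : ℝ) := by
    rw [real_inner_self_eq_norm_sq, norm_jet_zero hS]; simp
  rw [totalD_spinM_succ hS]
  simp only [cross_zero, cross_one, cross_two, inner_vec3, PiLp.sub_apply, PiLp.smul_apply,
    smul_eq_mul] at *
  set w := totalD (totalD (spinM n)) x (jet S x)
  linear_combination (jet S x 1 0 * w 0 + jet S x 1 1 * w 1 + jet S x 1 2 * w 2) * h2
    - (jet S x 0 0 * w 0 + jet S x 0 1 * w 1 + jet S x 0 2 * w 2) * h1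

/-- The chosen `invD` is determined only along curves on the sphere, so the identification with `D_x
m_n` is an equality along these curves. -/
theorem spinFlow_spec (n : ℕ) :
    IsDFun (spinFlow n) ∧ EqAlong sphereCurves (spinFlow n) (totalD (spinM n)) := by
  induction n with
  | zero =>
    have : spinFlow 0 = totalD (spinM 0) := by rw [spinM_zero, totalD_coord]; rfl
    rw [this]
    exact ⟨(isDFun_spinM 0).totalD, fun _ _ => rfl⟩
  | succ n ih =>
    have h1 := isInvD_spinH n ih.2
    have h2 := invD_spec ⟨_, h1⟩
    have h3 := invD_eqAlong sphere_deformation h1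
    refine ⟨((IsDFun.coord 0).cross ih.1.totalD).sub (h2.1.1.smul (IsDFun.coord 1)),
      fun S hS => funext fun x => ?_⟩
    have h4 : totalD (spinFlow n) x (jet S x) = totalD (totalD (spinM n)) x (jet S x) :=
      congrFun (ev_totalD_congr ih.1 (isDFun_spinM n).totalD hS.1 (ih.2 S hS)) x
    have h5 := congrFun (h3 S hS) x
    simp only [ev] at h5 ⊢
    rw [totalD_spinM_succ hS, ← h4, ← h5]
    rfl

theorem isInvD_spinHam (n : ℕ) : IsInvD sphereCurves sphereVacuum
    (fun x s => inner ℝ (s 1) (totalD (spinFlow n) x s)) (spinH (n + 1)) :=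
  isInvD_spinH_succ n fun S hS x => by
    have h := congrFun (ev_totalD_congr (spinFlow_spec n).1 (isDFun_spinM n).totalD hS.1
      ((spinFlow_spec n).2 S hS)) x
    simp only [ev] at h
    rw [h]

theorem spinHam_spec (n : ℕ) : IsDFun (spinHam n) ∧
    EqAlong sphereCurves (spinHam n) fun x s => ((n : ℝ) + 1)⁻¹ * spinH (n + 1) x s := by
  refine ⟨(IsDFun.const _).mul (invD_spec ⟨_, isInvD_spinHam n⟩).1.1, fun S hS => funext fun x => ?_⟩
  have h := congrFun (invD_eqAlong sphere_deformation (isInvD_spinHam n) S hS) x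
  simp only [ev, spinHam, spinInvD] at h ⊢
  rw [h]

/-- `J` annihilates the normal part of `D_x`, so both recursions are literally the same. -/
theorem mapFlow_eq (n : ℕ) : mapFlow n = spinFlow n := by
  induction n with
  | zero => rfl
  | succ n ih =>
    funext x s
    simp only [mapFlow, spinFlow, ih, sphereJ, covD, cross_tproj]

theorem isInvD_mapHam (n : ℕ) : IsInvD sphereCurves sphereVacuum
    (fun x s => inner ℝ (s 1) (covD (mapFlow n) x s)) (spinH (n + 1)) :=
  isInvD_spinH_succ n fun S hS x => by
    have h := congrFun (ev_totalD_congr (spinFlow_spec n).1 (isDFun_spinM n).totalD hS.1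
      ((spinFlow_spec n).2 S hS)) x
    simp only [ev] at h
    rw [covD, mapFlow_eq, h, tproj, inner_sub_right, inner_smul_right,
      real_inner_comm (jet S x 0) (jet S x 1), inner_jet_zero_one hS, mul_zero, sub_zero]

theorem mapHam_spec (n : ℕ) : IsDFun (mapHam n) ∧
    EqAlong sphereCurves (mapHam n) fun x s => ((n : ℝ) + 1)⁻¹ * spinH (n + 1) x s := by
  refine ⟨(IsDFun.const _).mul (invD_spec ⟨_, isInvD_mapHam n⟩).1.1, fun S hS => funext fun x => ?_⟩
  have h := congrFun (invD_eqAlong sphere_deformation (isInvD_mapHam n) S hS) x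
  simp only [ev, mapHam, spinInvD] at h ⊢
  rw [h]

/-- The recursion for the densities in terms of the flows. -/
theorem spinH_eq_sum {S : ℝ → Vec3} (hS : S ∈ sphereCurves) (x : ℝ) (n : ℕ) :
    spinH n x (jet S x) = 2⁻¹ * ∑ i ∈ Finset.range n,
      (spinH i x (jet S x) * spinH (n - 1 - i) x (jet S x)
        + inner ℝ (totalD (spinM i) x (jet S x)) (totalD (spinM (n - 1 - i)) x (jet S x))) := by
  rw [spinH_eq (norm_jet_zero hS x)]
  congr 1
  refine Finset.sum_congr rfl fun i hi => ?_
  rw [Finset.mem_range] at hi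
  obtain ⟨k, rfl⟩ : ∃ k, n = i + k + 1 := ⟨n - i - 1, by omega⟩
  have e1 : i + k + 1 - i = k + 1 := by omega
  have e2 : i + k + 1 - 1 - i = k := by omega
  rw [e1, e2, spinM_succ_eq (norm_jet_zero hS x), spinM_succ_eq (norm_jet_zero hS x)]
  have h0 : inner ℝ (jet S x 0) (jet S x 0) = (1 : ℝ) := by
    rw [real_inner_self_eq_norm_sq, norm_jet_zero hS]; simp
  have h1 := inner_totalD_spinM hS x i
  have h2 := inner_totalD_spinM hS x k
  set a := totalD (spinM i) x (jet S x)
  set b := totalD (spinM k) x (jet S x)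
  simp only [inner_sub_left, inner_sub_right, inner_smul_left, inner_smul_right,
    real_inner_comm (cross _ _) (jet S x 0), h0]
  simp only [cross_zero, cross_one, cross_two, inner_vec3] at *
  simp
  linear_combination (a 0 * b 0 + a 1 * b 1 + a 2 * b 2) * h0
    - (jet S x 0 0 * b 0 + jet S x 0 1 * b 1 + jet S x 0 2 * b 2) * h1

end Hierarchy

/-! ### The variational derivatives of the densities -/

section LaxVariation

open PowerSeries
open Finset.HasAntidiagonal (antidiagonal mem_antidiagonal)

/-- The determinant of three vectors. -/
def det3 {R : Type*} [CommRing R] (a b c : Fin 3 → R) : R :=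
  a 0 * (b 1 * c 2 - b 2 * c 1) + a 1 * (b 2 * c 0 - b 0 * c 2) + a 2 * (b 0 * c 1 - b 1 * c 0)

/-- The variation of the formal solution of `λ m_x = m ∧ S`: here `m'` is the derivative of `m`
in the spectral parameter `l = λ`, and `d` is the variation of `m` under the variation `X`
of `S`. -/
theorem lax_variation_identity {R : Type*} [CommRing R] (l : R)
    (S X m m' d Dm Dm' Dd : Fin 3 → R)
    (e10 : l * Dm 0 = m 1 * S 2 - m 2 * S 1)
    (e11 : l * Dm 1 = m 2 * S 0 - m 0 * S 2)
    (e12 : l * Dm 2 = m 0 * S 1 - m 1 * S 0)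
    (e20 : Dm 0 + l * Dm' 0 = m' 1 * S 2 - m' 2 * S 1)
    (e21 : Dm 1 + l * Dm' 1 = m' 2 * S 0 - m' 0 * S 2)
    (e22 : Dm 2 + l * Dm' 2 = m' 0 * S 1 - m' 1 * S 0)
    (e30 : l * Dd 0 = (d 1 * S 2 - d 2 * S 1) + (m 1 * X 2 - m 2 * X 1))
    (e31 : l * Dd 1 = (d 2 * S 0 - d 0 * S 2) + (m 2 * X 0 - m 0 * X 2))
    (e32 : l * Dd 2 = (d 0 * S 1 - d 1 * S 0) + (m 0 * X 1 - m 1 * X 0))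
    (hn : m 0 * m 0 + m 1 * m 1 + m 2 * m 2 = 1)
    (hn' : m 0 * m' 0 + m 1 * m' 1 + m 2 * m' 2 = 0)
    (hd : m 0 * d 0 + m 1 * d 1 + m 2 * d 2 = 0) :
    l * (l * (det3 Dm m' d + det3 m Dm' d + det3 m m' Dd))
      = (d 0 * S 0 + d 1 * S 1 + d 2 * S 2)
        + l * (m' 0 * X 0 + m' 1 * X 1 + m' 2 * X 2) := by
  unfold det3
  -- The three equations replace `λ m_x`, `λ m'_x` and `λ δm_x` in the expanded determinant. The
  -- bare `m_x` in the `λ`-differentiated equation needs the first one again, whence the term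
  -- without factor `l`; the normalisations `m·m = 1`, `m·m' = 0`, `m·δm = 0` do the rest.
  linear_combination l * (e10 * (m' 1 * d 2 - m' 2 * d 1) + e11 * (m' 2 * d 0 - m' 0 * d 2)
      + e12 * (m' 0 * d 1 - m' 1 * d 0))
    + l * (e20 * (d 1 * m 2 - d 2 * m 1) + e21 * (d 2 * m 0 - d 0 * m 2)
      + e22 * (d 0 * m 1 - d 1 * m 0))
    + l * (e30 * (m 1 * m' 2 - m 2 * m' 1) + e31 * (m 2 * m' 0 - m 0 * m' 2)
      + e32 * (m 0 * m' 1 - m 1 * m' 0))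
    - (e10 * (d 1 * m 2 - d 2 * m 1) + e11 * (d 2 * m 0 - d 0 * m 2)
      + e12 * (d 0 * m 1 - d 1 * m 0))
    - hd * (S 0 * m 0 + S 1 * m 1 + S 2 * m 2)
    + hn * (S 0 * d 0 + S 1 * d 1 + S 2 * d 2)
    + l * hn * (m' 0 * X 0 + m' 1 * X 1 + m' 2 * X 2)
    - l * hn' * (m 0 * X 0 + m 1 * X 1 + m 2 * X 2)

/-- Coefficientwise differentiability of a function with values in formal power series. -/
def HasCoeffDerivAt (f : ℝ → ℝ⟦X⟧) (f' : ℝ⟦X⟧) (x : ℝ) : Prop :=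
  ∀ n, HasDerivAt (fun y => coeff n (f y)) (coeff n f') x

/-! ### Coefficientwise calculus of power series and the generating function of `m` -/

variable {f g : ℝ → ℝ⟦X⟧} {f' g' : ℝ⟦X⟧} {x : ℝ}

theorem HasCoeffDerivAt.congr_val (hf : HasCoeffDerivAt f f' x) (h : f' = g') :
    HasCoeffDerivAt f g' x := h ▸ hf

theorem HasCoeffDerivAt.add (hf : HasCoeffDerivAt f f' x) (hg : HasCoeffDerivAt g g' x) :
    HasCoeffDerivAt (fun y => f y + g y) (f' + g') x := fun n => by
  simpa only [map_add] using (hf n).fun_add (hg n)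

theorem HasCoeffDerivAt.sub (hf : HasCoeffDerivAt f f' x) (hg : HasCoeffDerivAt g g' x) :
    HasCoeffDerivAt (fun y => f y - g y) (f' - g') x := fun n => by
  simpa only [map_sub] using (hf n).fun_sub (hg n)

theorem HasCoeffDerivAt.mul (hf : HasCoeffDerivAt f f' x) (hg : HasCoeffDerivAt g g' x) :
    HasCoeffDerivAt (fun y => f y * g y) (f' * g x + f x * g') x := fun n => by
  simp only [map_add, coeff_mul, ← Finset.sum_add_distrib]
  exact HasDerivAt.fun_sum fun ij _ => (hf ij.1).fun_mul (hg ij.2)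

theorem HasCoeffDerivAt.derivative (hf : HasCoeffDerivAt f f' x) :
    HasCoeffDerivAt (fun y => d⁄dX ℝ (f y)) (d⁄dX ℝ f') x := fun n => by
  simp only [coeff_derivative]
  exact (hf (n + 1)).mul_const _

theorem hasCoeffDerivAt_det3 {a b c : ℝ → Fin 3 → ℝ⟦X⟧} {a' b' c' : Fin 3 → ℝ⟦X⟧}
    (ha : ∀ i, HasCoeffDerivAt (fun y => a y i) (a' i) x)
    (hb : ∀ i, HasCoeffDerivAt (fun y => b y i) (b' i) x)
    (hc : ∀ i, HasCoeffDerivAt (fun y => c y i) (c' i) x) :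
    HasCoeffDerivAt (fun y => det3 (a y) (b y) (c y))
      (det3 a' (b x) (c x) + det3 (a x) b' (c x)
        + det3 (a x) (b x) c') x := by
  have h := (((ha 0).mul (((hb 1).mul (hc 2)).sub ((hb 2).mul (hc 1)))).add
    ((ha 1).mul (((hb 2).mul (hc 0)).sub ((hb 0).mul (hc 2))))).add
    ((ha 2).mul (((hb 0).mul (hc 1)).sub ((hb 1).mul (hc 0))))
  refine h.congr_val ?_
  simp only [det3]
  ring

/-- The components of the generating function of a sequence of vectors. -/
def genFun (v : ℕ → Vec3) (i : Fin 3) : ℝ⟦X⟧ := PowerSeries.mk fun n => v n i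

theorem coeff_genFun (v : ℕ → Vec3) (i : Fin 3) (n : ℕ) : coeff n (genFun v i) = v n i :=
  coeff_mk _ _

theorem genFun_mul_sum (v w : ℕ → Vec3) (n : ℕ) :
    coeff n (genFun v 0 * genFun w 0 + genFun v 1 * genFun w 1 + genFun v 2 * genFun w 2)
      = ∑ ij ∈ antidiagonal n, inner ℝ (v ij.1) (w ij.2) := by
  simp only [map_add, coeff_mul, coeff_genFun, ← Finset.sum_add_distrib, inner_vec3]

theorem hasCoeffDerivAt_genFun {M : ℕ → DFun Vec3 Vec3} (hM : ∀ n, IsDFun (M n)) {S : ℝ → Vec3}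
    (hS : ContDiff ℝ ∞ S) (i : Fin 3) (x : ℝ) :
    HasCoeffDerivAt (fun y => genFun (fun n => ev (M n) S y) i)
      (genFun (fun n => ev (totalD (M n)) S x) i) x := fun n => by
  simp only [coeff_genFun]
  exact ((EuclideanSpace.proj i : Vec3 →L[ℝ] ℝ).hasFDerivAt.comp_hasDerivAt x
    (hasDerivAt_ev (hM n) hS x))

/-- The coefficient of `λ^{n+2}` in the determinant identity. The `λ`-derivative of `m` has
coefficient `(n+2) m_{n+2}` at `λ^{n+1}`, the source of the numerical factors in the hierarchy. -/
theorem genFun_lax {S : Vec3} {m Dm d Dd : ℕ → Vec3} {X : Vec3} (hm : m 0 = S) (hd : d 0 = X)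
    (h : ∀ n, Dm n = cross (m (n + 1)) S)
    (h' : ∀ n, Dd n = cross (d (n + 1)) S + cross (m (n + 1)) X)
    (hnorm : ∀ n, ∑ ij ∈ antidiagonal n, inner ℝ (m ij.1) (m ij.2) = if n = 0 then (1 : ℝ) else 0)
    (horth : ∀ n, ∑ ij ∈ antidiagonal n, inner ℝ (m ij.1) (d ij.2) = (0 : ℝ)) (n : ℕ) :
    coeff n (det3 (genFun Dm) (fun i => d⁄dX ℝ (genFun m i)) (genFun d)
        + det3 (genFun m) (fun i => d⁄dX ℝ (genFun Dm i)) (genFun d)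
        + det3 (genFun m) (fun i => d⁄dX ℝ (genFun m i)) (genFun Dd))
      = inner ℝ S (d (n + 2)) + ((n : ℝ) + 2) * inner ℝ X (m (n + 2)) := by
  -- Multiplication by `λ` shifts coefficients; the constant term is accounted for by `m₀ ∧ S = 0`,
  -- and in `key'` by `δm₀ ∧ S + m₀ ∧ X = 0`.
  have key : ∀ (a b : Fin 3), ∀ (v w : ℕ → Vec3) (S : Vec3) (i : Fin 3),
      v 0 a * S b - v 0 b * S a = 0 → (∀ n, w n i = v (n + 1) a * S b - v (n + 1) b * S a) →
      PowerSeries.X * genFun w i = genFun v a * C (S b) - genFun v b * C (S a) := by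
    intro a b v w S i h0 hs
    ext n
    cases n with
    | zero =>
      rw [coeff_zero_X_mul]
      simp only [map_sub, coeff_mul_C, coeff_genFun]
      linarith
    | succ n => rw [coeff_succ_X_mul]; simp [coeff_genFun, hs]
  have key' : ∀ (a b : Fin 3), ∀ (i : Fin 3),
      (d 0 a * S b - d 0 b * S a) + (m 0 a * X b - m 0 b * X a) = 0 →
      (∀ n, Dd n i = (d (n + 1) a * S b - d (n + 1) b * S a)
        + (m (n + 1) a * X b - m (n + 1) b * X a)) →
      PowerSeries.X * genFun Dd i = (genFun d a * C (S b) - genFun d b * C (S a))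
        + (genFun m a * C (X b) - genFun m b * C (X a)) := by
    intro a b i h0 hs
    ext n
    cases n with
    | zero =>
      rw [coeff_zero_X_mul]
      simp only [map_add, map_sub, coeff_mul_C, coeff_genFun]
      linarith
    | succ n => rw [coeff_succ_X_mul]; simp [coeff_genFun, hs]
  have e10 := key 1 2 m Dm S 0 (by rw [hm]; ring) fun n => by rw [h, cross_zero]
  have e11 := key 2 0 m Dm S 1 (by rw [hm]; ring) fun n => by rw [h, cross_one]
  have e12 := key 0 1 m Dm S 2 (by rw [hm]; ring) fun n => by rw [h, cross_two]
  have e30 := key' 1 2 0 (by rw [hm, hd]; ring) fun n => by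
    rw [h', PiLp.add_apply, cross_zero, cross_zero]
  have e31 := key' 2 0 1 (by rw [hm, hd]; ring) fun n => by
    rw [h', PiLp.add_apply, cross_one, cross_one]
  have e32 := key' 0 1 2 (by rw [hm, hd]; ring) fun n => by
    rw [h', PiLp.add_apply, cross_two, cross_two]
  have hder : ∀ (i a b : Fin 3), PowerSeries.X * genFun Dm i
        = genFun m a * C (S b) - genFun m b * C (S a) →
      genFun Dm i + PowerSeries.X * d⁄dX ℝ (genFun Dm i)
        = d⁄dX ℝ (genFun m a) * C (S b) - d⁄dX ℝ (genFun m b) * C (S a) := by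
    intro i a b e
    have := congrArg (d⁄dX ℝ) e
    simp only [map_sub, Derivation.leibniz, derivative_C, derivative_X, smul_eq_mul] at this
    linear_combination this
  have hn : genFun m 0 * genFun m 0 + genFun m 1 * genFun m 1 + genFun m 2 * genFun m 2 = 1 := by
    ext n
    rw [genFun_mul_sum, hnorm, coeff_one]
  have hn' : genFun m 0 * d⁄dX ℝ (genFun m 0) + genFun m 1 * d⁄dX ℝ (genFun m 1)
      + genFun m 2 * d⁄dX ℝ (genFun m 2) = 0 := by
    have := congrArg (d⁄dX ℝ) hn
    simp only [map_add, Derivation.leibniz, smul_eq_mul] at this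
    rw [← map_one (C (R := ℝ)), derivative_C] at this
    have h2 : C (2⁻¹ : ℝ) * 2 = 1 := by
      rw [← map_ofNat (C (R := ℝ)) 2, ← map_mul]; norm_num
    linear_combination C (2⁻¹ : ℝ) * this - (genFun m 0 * d⁄dX ℝ (genFun m 0)
      + genFun m 1 * d⁄dX ℝ (genFun m 1) + genFun m 2 * d⁄dX ℝ (genFun m 2)) * h2
  have hdz : genFun m 0 * genFun d 0 + genFun m 1 * genFun d 1 + genFun m 2 * genFun d 2 = 0 := by
    ext n
    rw [genFun_mul_sum, horth, map_zero]
  have hfin := lax_variation_identity PowerSeries.X (fun i => C (S i)) (fun i => C (X i))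
    (genFun m) (fun i => d⁄dX ℝ (genFun m i)) (genFun d) (genFun Dm)
    (fun i => d⁄dX ℝ (genFun Dm i)) (genFun Dd) e10 e11 e12 (hder 0 1 2 e10) (hder 1 2 0 e11)
    (hder 2 0 1 e12) e30 e31 e32 hn hn' hdz
  have hc := congrArg (coeff (n + 2)) hfin
  rw [show n + 2 = n + 1 + 1 from rfl, coeff_succ_X_mul, coeff_succ_X_mul] at hc
  rw [hc, map_add, coeff_succ_X_mul]
  simp only [map_add, coeff_mul_C, coeff_derivative, coeff_genFun, inner_vec3]
  push_cast
  ring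

theorem hasDerivAt_coeff_det3 {M D : ℕ → DFun Vec3 Vec3} (hM : ∀ n, IsDFun (M n))
    (hD : ∀ n, IsDFun (D n)) {S : ℝ → Vec3} (hS : ContDiff ℝ ∞ S) (n : ℕ) (x : ℝ) :
    HasDerivAt (fun x => coeff n (det3 (genFun fun k => ev (M k) S x)
        (fun i => d⁄dX ℝ (genFun (fun k => ev (M k) S x) i)) (genFun fun k => ev (D k) S x)))
      (coeff n (det3 (genFun fun k => ev (totalD (M k)) S x)
          (fun i => d⁄dX ℝ (genFun (fun k => ev (M k) S x) i)) (genFun fun k => ev (D k) S x)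
        + det3 (genFun fun k => ev (M k) S x)
          (fun i => d⁄dX ℝ (genFun (fun k => ev (totalD (M k)) S x) i))
          (genFun fun k => ev (D k) S x)
        + det3 (genFun fun k => ev (M k) S x)
          (fun i => d⁄dX ℝ (genFun (fun k => ev (M k) S x) i))
          (genFun fun k => ev (totalD (D k)) S x))) x :=
  hasCoeffDerivAt_det3 (fun i => hasCoeffDerivAt_genFun hM hS i x)
    (fun i => (hasCoeffDerivAt_genFun hM hS i x).derivative)
    (fun i => hasCoeffDerivAt_genFun hD hS i x) n

/-- The variation of the densities. -/
theorem exists_variation_spinH {S : ℝ → Vec3} (hS : S ∈ sphereCurves) {ξ : ℝ → Vec3}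
    (hξ : ContDiff ℝ ∞ ξ) (hξS : ∀ x, inner ℝ (S x) (ξ x) = 0) (n : ℕ) : ∃ P : ℝ → ℝ,
      (∀ x, HasDerivAt P (ev (evol (fun y _ => ξ y) (spinH (n + 1))) S x
        - ((n : ℝ) + 1) * inner ℝ (ξ x) (cross (S x) (ev (totalD (spinM (n + 1))) S x))) x) ∧
      ∀ x, ξ =ᶠ[nhds x] 0 → P x = 0 := by
  have hX : IsDFun (fun y _ => ξ y : DFun Vec3 Vec3) := IsDFun.ofFun hξ
  have hd : ∀ n, IsDFun (evol (fun y _ => ξ y) (spinM n)) := fun n => (isDFun_spinM n).evol hX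
  have hm0 : ∀ x, ev (spinM 0) S x = S x := fun x => by
    rw [spinM_zero]; exact jet_zero S x
  have hd0 : ∀ x, ev (evol (fun y _ => ξ y) (spinM 0)) S x = ξ x := fun x => by
    rw [ev, spinM_zero, evol_coord]; rfl
  have hDd : ∀ n x, ev (totalD (evol (fun y _ => ξ y) (spinM n))) S x
      = cross (ev (evol (fun y _ => ξ y) (spinM (n + 1))) S x) (S x)
        + cross (ev (spinM (n + 1)) S x) (ξ x) := by
    intro n x
    rw [totalD_evol (isDFun_spinM n) hX]
    have h1 := congrFun (ev_evol_congr (φ := totalD (spinM n))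
      (ψ := fun x s => cross (spinM (n + 1) x s) (s 0)) (isDFun_spinM n).totalD
      ((isDFun_spinM (n + 1)).cross (IsDFun.coord 0))
      (fun S hS => funext fun x => totalD_spinM hS x n) hX hS hξS) x
    rw [h1, ev, evol_eq_lieD, lieD_cross (isDFun_spinM (n + 1)) (IsDFun.coord 0), lieD_coord,
      jet_zero]
    simp only [ev, evol_eq_lieD]
    rfl
  have horth : ∀ n x, ∑ ij ∈ antidiagonal n, inner ℝ (ev (spinM ij.1) S x)
      (ev (evol (fun y _ => ξ y) (spinM ij.2)) S x) = (0 : ℝ) := by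
    intro n x
    have h1 : IsDFun (fun x s => ∑ ij ∈ antidiagonal n,
        (inner ℝ (spinM ij.1 x s) (spinM ij.2 x s) : ℝ)) :=
      IsDFun.sum _ fun ij _ => (isDFun_spinM _).inner (isDFun_spinM _)
    have h2 := ev_evol_congr h1 (IsDFun.const (if n = 0 then (1 : ℝ) else 0))
      (fun S hS => funext fun y => sum_inner_spinM (norm_jet_zero hS y) n) hX hS hξS
    have h3 := congrFun h2 x
    simp only [ev] at h3 ⊢
    rw [evol_eq_lieD, evol_eq_lieD, lieD_sum_inner isDFun_spinM, lieD_const] at h3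
    simp only [evol_eq_lieD]
    linarith
  -- The boundary term is the `λ^n` coefficient of `-det(m, m', δm)`. It vanishes wherever all jets
  -- of `ξ` vanish, because `δm` does.
  refine ⟨fun x => -coeff n (det3 (genFun fun k => ev (spinM k) S x)
    (fun i => d⁄dX ℝ (genFun (fun k => ev (spinM k) S x) i))
    (genFun fun k => ev (evol (fun y _ => ξ y) (spinM k)) S x)), fun x => ?_, fun x hx => ?_⟩
  · refine (hasDerivAt_coeff_det3 isDFun_spinM hd hS.1 n x).fun_neg.congr_deriv ?_
    have h2 := genFun_lax (m := fun k => ev (spinM k) S x)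
      (Dm := fun k => ev (totalD (spinM k)) S x)
      (d := fun k => ev (evol (fun y _ => ξ y) (spinM k)) S x)
      (Dd := fun k => ev (totalD (evol (fun y _ => ξ y) (spinM k))) S x) (hm0 x) (hd0 x)
      (fun n => by
        have := totalD_spinM hS x n
        rwa [jet_zero] at this)
      (fun n => hDd n x) (fun n => sum_inner_spinM (norm_jet_zero hS x) n)
      (fun n => horth n x) n
    refine (congrArg Neg.neg h2).trans ?_
    have h3 : ev (evol (fun y _ => ξ y) (spinH (n + 1))) S x
        = -(inner ℝ (ξ x) (ev (spinM (n + 2)) S x)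
          + inner ℝ (S x) (ev (evol (fun y _ => ξ y) (spinM (n + 2))) S x)) := by
      rw [ev, evol_eq_lieD]
      refine (lieD_neg ((IsDFun.coord 0).inner (isDFun_spinM _)) x _).trans ?_
      rw [lieD_inner (IsDFun.coord 0) (isDFun_spinM _), lieD_coord, jet_zero]
      simp only [ev, evol_eq_lieD]
      rfl
    have h4 : inner ℝ (ξ x) (cross (S x) (ev (totalD (spinM (n + 1))) S x))
        = inner ℝ (ξ x) (ev (spinM (n + 2)) S x) := by
      have := spinM_succ_eq (x := x) (norm_jet_zero hS x) (n + 1)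
      simp only [ev]
      rw [this, inner_sub_right, inner_smul_right, jet_zero, real_inner_comm (S x) (ξ x), hξS,
        mul_zero, sub_zero]
    -- The factor is `(n+2) - 1 = n+1`: the determinant supplies `n+2`, and the direct variation of
    -- `S` in `-S · m_{n+2}` removes one.
    rw [h3, h4]
    ring
  · have h1 : ∀ n, ev (evol (fun y _ => ξ y) (spinM n)) S x = 0 := by
      intro n
      have h2 : ∀ k, (totalD^[k] (fun y _ => ξ y : DFun Vec3 Vec3)) x (jet S x) = 0 := by
        intro k
        rw [totalD_iterate_ofFun]
        simpa using hx.iteratedDeriv_eq k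
      simp only [ev, evol, h2, smul_zero, add_zero, deriv_const]
    have h2 : ∀ i, genFun (fun k => ev (evol (fun y _ => ξ y) (spinM k)) S x) i = 0 := by
      intro i
      ext k
      rw [coeff_genFun, h1]; simp
    simp [det3, h2]

/-- The variational derivatives of the Hamiltonians of the hierarchy. -/
theorem ev_varS_of_eqAlong {F : DFun Vec3 ℝ} (hF : IsDFun F) {n : ℕ}
    (h : EqAlong sphereCurves F fun x s => ((n : ℝ) + 1)⁻¹ * spinH (n + 1) x s)
    {S : ℝ → Vec3} (hS : S ∈ sphereCurves) :
    ev (varS F) S = fun x => cross (S x) (ev (totalD (spinM (n + 1))) S x) := by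
  have hne : ((n : ℝ) + 1) ≠ 0 := by positivity
  refine ev_varS_eq hF hS ?_ (fun x => inner_cross_self_left _ _) fun X hX hXS => ?_
  · have := contDiff_ev ((IsDFun.coord 0).cross (isDFun_spinM (n + 1)).totalD) hS.1
    simpa only [ev, jet_zero] using! this
  · obtain ⟨P, hP, hP0⟩ := exists_variation_spinH hS hX hXS n
    refine ⟨fun x => ((n : ℝ) + 1)⁻¹ * P x, fun x => ?_, fun x hx => by
      simp only [hP0 x hx, mul_zero]⟩
    refine ((hP x).const_mul ((n : ℝ) + 1)⁻¹).congr_deriv ?_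
    have h1 := ev_evol_congr hF ((IsDFun.const _).mul (isDFun_spinH (n + 1))) h
      (IsDFun.ofFun hX) hS hXS
    have h2 := congrFun h1 x
    rw [h2]
    have h3 : ev (evol (fun y _ => X y) fun x s => ((n : ℝ) + 1)⁻¹ * spinH (n + 1) x s) S x
        = ((n : ℝ) + 1)⁻¹ * ev (evol (fun y _ => X y) (spinH (n + 1))) S x := by
      simp only [ev, evol_eq_lieD]
      exact lieD_constSmul _ (isDFun_spinH (n + 1)) _ _
    rw [h3, mul_sub, ← mul_assoc _ ((n : ℝ) + 1), inv_mul_cancel₀ hne, one_mul]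

end LaxVariation

/-! ### The Hamiltonian operators -/

section Hamiltonian

/-- The vector field `α S ∧ a + β (D_x a + (S_x · a) S + p S_x)`. -/
def hamField (α β : ℝ) (a : DFun Vec3 Vec3) (p : DFun Vec3 ℝ) : DFun Vec3 Vec3 := fun x s =>
  α • cross (s 0) (a x s) + β • (totalD a x s + inner ℝ (s 1) (a x s) • s 0 + p x s • s 1)

theorem IsDFun.hamField (α β : ℝ) {a : DFun Vec3 Vec3} {p : DFun Vec3 ℝ} (ha : IsDFun a)
    (hp : IsDFun p) : IsDFun (hamField α β a p) :=
  (((IsDFun.coord 0).cross ha).constSmul α).add ((((ha.totalD).add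
    (((IsDFun.coord 1).inner ha).smul (IsDFun.coord 0))).add
    (hp.smul (IsDFun.coord 1))).constSmul β)

/-- Stated for arbitrary fields on jet space, so that it serves both for variations and for `∂/∂x`.
-/
theorem lieD_hamField {e : DFun Vec3 ℝ} {E : ℕ → DFun Vec3 Vec3} (α β : ℝ) {a : DFun Vec3 Vec3}
    {p : DFun Vec3 ℝ} (ha : IsDFun a) (hp : IsDFun p) (x : ℝ) (s : ℕ → Vec3) :
    lieD e E (hamField α β a p) x s
      = α • (cross (E 0 x s) (a x s) + cross (s 0) (lieD e E a x s))
        + β • (lieD e E (totalD a) x s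
          + ((inner ℝ (E 1 x s) (a x s) + inner ℝ (s 1) (lieD e E a x s)) • s 0
            + inner ℝ (s 1) (a x s) • E 0 x s)
          + (lieD e E p x s • s 1 + p x s • E 1 x s)) := by
  have c0 := IsDFun.coord (V := Vec3) 0
  have c1 := IsDFun.coord (V := Vec3) 1
  have h1 := (c1.inner ha).smul c0
  have h2 := hp.smul c1
  unfold hamField
  rw [lieD_add ((c0.cross ha).constSmul α) (((ha.totalD.add h1).add h2).constSmul β),
    lieD_constSmul α (c0.cross ha), lieD_constSmul β ((ha.totalD.add h1).add h2),
    lieD_cross c0 ha, lieD_add (ha.totalD.add h1) h2, lieD_add ha.totalD h1,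
    lieD_smul (c1.inner ha) c0, lieD_smul hp c1, lieD_inner c1 ha, lieD_coord, lieD_coord]

theorem inner_totalD_of_isTangent {a : DFun Vec3 Vec3} (ha : IsDFun a) (hat : IsTangent a)
    {S : ℝ → Vec3} (hS : S ∈ sphereCurves) (x : ℝ) :
    inner ℝ (jet S x 1) (a x (jet S x)) + inner ℝ (jet S x 0) (totalD a x (jet S x)) = 0 := by
  have h := congrFun (ev_totalD_congr ((IsDFun.coord 0).inner ha) (IsDFun.const 0) hS.1
    (funext fun y => hat S hS y)) x
  simp only [ev, totalD_eq_lieD] at h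
  rw [lieD_inner (IsDFun.coord 0) ha, lieD_const, lieD_coord, ← totalD_eq_lieD] at h
  exact h

theorem inner_evol_of_isTangent {a X : DFun Vec3 Vec3} (ha : IsDFun a) (hat : IsTangent a)
    (hX : IsDFun X) (hXt : IsTangent X) {S : ℝ → Vec3} (hS : S ∈ sphereCurves) (x : ℝ) :
    inner ℝ (X x (jet S x)) (a x (jet S x)) + inner ℝ (jet S x 0) (evol X a x (jet S x)) = 0 := by
  have h := congrFun (ev_evol_congr ((IsDFun.coord 0).inner ha) (IsDFun.const (0 : ℝ))
    (fun S hS => funext fun y => hat S hS y) hX hS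
    (fun y => by simpa only [jet_zero] using! hXt S hS y)) x
  simp only [ev, evol_eq_lieD] at h
  rw [lieD_inner (IsDFun.coord 0) ha, lieD_const, lieD_coord, ← evol_eq_lieD] at h
  exact h

theorem IsTangent.partialX {a : DFun Vec3 Vec3} (ha : IsDFun a) (hat : IsTangent a) :
    IsTangent (partialX a) := by
  intro S hS x
  have h := congrFun (ev_partialX_congr (φ := fun x s => inner ℝ (s 0) (a x s))
    (ψ := fun _ _ => (0 : ℝ)) (fun S hS => funext fun y => hat S hS y) hS) x
  simp only [ev, partialX_eq_lieD] at h
  rw [lieD_inner (IsDFun.coord 0) ha, lieD_const, lieD_coord, ← partialX_eq_lieD,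
    inner_zero_left, zero_add] at h
  exact h

theorem isTangent_coord_one : IsTangent fun _ s => s 1 := fun _ hS x => inner_jet_zero_one hS x

theorem isTangent_of_eq_hamField {α β : ℝ} {a X : DFun Vec3 Vec3} {p : DFun Vec3 ℝ}
    (ha : IsDFun a) (hat : IsTangent a)
    (hX : ∀ S ∈ sphereCurves, ∀ x, X x (jet S x) = hamField α β a p x (jet S x)) :
    IsTangent X := by
  intro S hS x
  have h := inner_totalD_of_isTangent ha hat hS x
  have h1 : inner ℝ (jet S x 0) (jet S x 0) = (1 : ℝ) := by
    rw [real_inner_self_eq_norm_sq, norm_jet_zero hS]; simp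
  rw [hX S hS, hamField, inner_add_right, inner_smul_right, inner_smul_right,
    inner_cross_self_left, inner_add_right, inner_add_right, inner_smul_right, inner_smul_right,
    h1, inner_jet_zero_one hS]
  linear_combination β * h

theorem isTotal_totalD {F : DFun Vec3 ℝ} (hF : IsDFun F) : IsTotal sphereCurves (totalD F) :=
  isTotal_of_totalD contDiff_of_mem_sphereCurves hF fun _ _ _ => rfl

/-- Skew-symmetry of the operators. -/
theorem isTotal_skew {α β : ℝ} {a b X Y : DFun Vec3 Vec3} {p q : DFun Vec3 ℝ}
    (ha : IsDFun a) (hat : IsTangent a) (hb : IsDFun b) (hbt : IsTangent b)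
    (hp : IsDFun p) (hq : IsDFun q)
    (hpx : ∀ S ∈ sphereCurves, ∀ x,
      β * totalD p x (jet S x) = β * inner ℝ (jet S x 1) (a x (jet S x)))
    (hqx : ∀ S ∈ sphereCurves, ∀ x,
      β * totalD q x (jet S x) = β * inner ℝ (jet S x 1) (b x (jet S x)))
    (hX : ∀ S ∈ sphereCurves, ∀ x, X x (jet S x) = hamField α β a p x (jet S x))
    (hY : ∀ S ∈ sphereCurves, ∀ x, Y x (jet S x) = hamField α β b q x (jet S x)) :
    IsTotal sphereCurves (fun x s => inner ℝ (X x s) (b x s) + inner ℝ (Y x s) (a x s)) := by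
  -- The primitive is `β (a·b + p q)`: the `α`-part is pointwise skew, and `p q` absorbs the
  -- nonlocal terms.
  refine isTotal_of_totalD contDiff_of_mem_sphereCurves
    (((ha.inner hb).add (hp.mul hq)).constSmul β) fun S hS x => ?_
  rw [totalD_eq_lieD, lieD_constSmul β ((ha.inner hb).add (hp.mul hq)),
    lieD_add (ha.inner hb) (hp.mul hq), lieD_inner ha hb, lieD_mul hp hq]
  simp only [← totalD_eq_lieD]
  have h1 := hpx S hS x
  have h2 := hqx S hS x
  have h3 := hat S hS x
  have h4 := hbt S hS x
  rw [hX S hS, hY S hS]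
  simp only [hamField, smul_eq_mul]
  simp only [inner_vec3, cross_zero, cross_one, cross_two, PiLp.add_apply, PiLp.smul_apply,
    smul_eq_mul] at *
  generalize totalD a x (jet S x) = ax
  generalize totalD b x (jet S x) = bx
  generalize a x (jet S x) = a at *
  generalize b x (jet S x) = b at *
  generalize p x (jet S x) = p at *
  generalize q x (jet S x) = q at *
  generalize jet S x 0 = S0 at *
  generalize jet S x 1 = S1 at *
  linear_combination q * h1 + p * h2
    - β * (S1 0 * a 0 + S1 1 * a 1 + S1 2 * a 2) * h4
    - β * (S1 0 * b 0 + S1 1 * b 1 + S1 2 * b 2) * h3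

/-- The linearisation of a variational derivative is self-adjoint. -/
theorem isTotal_helmholtz {H : DFun Vec3 ℝ} (hH : IsDFun H) {X Y : DFun Vec3 Vec3}
    (hX : IsDFun X) (hXt : IsTangent X) (hY : IsDFun Y) (hYt : IsTangent Y) :
    IsTotal sphereCurves (fun x s => inner ℝ (Y x s) (evol X (varS H) x s)
      - inner ℝ (X x s) (evol Y (varS H) x s)) := by
  have hc := hH.varS
  have hXY : IsDFun (fun x s => evol X Y x s - evol Y X x s) := (hY.evol hX).sub (hX.evol hY)
  have hXYt : IsTangent (fun x s => evol X Y x s - evol Y X x s) := by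
    intro S hS x
    have h1 := inner_evol_of_isTangent hY hYt hX hXt hS x
    have h2 := inner_evol_of_isTangent hX hXt hY hYt hS x
    rw [real_inner_comm] at h2
    rw [inner_sub_right]
    linarith
  -- With `c = δH/δS`, vary `Y(H) ≡ Y·c` along `X` and `X(H) ≡ X·c` along `Y`. In the difference,
  -- `[X,Y](H) ≡ [X,Y]·c` removes everything except the two linearisation terms.
  have t1 := (isTotal_evol_sub_inner_varS hH hY hYt).evol ((hH.evol hY).sub (hY.inner hc)) hX hXt
  have t2 := (isTotal_evol_sub_inner_varS hH hX hXt).evol ((hH.evol hX).sub (hX.inner hc)) hY hYt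
  have t3 := isTotal_evol_sub_inner_varS hH hXY hXYt
  refine ((t2.sub t1).add t3).congr fun S hS x => ?_
  have h := evol_evol_sub hH hX hY x (jet S x)
  have e : ∀ {X Y : DFun Vec3 Vec3}, IsDFun Y →
      evol X (fun x s => evol Y H x s - inner ℝ (Y x s) (varS H x s)) x (jet S x)
        = evol X (evol Y H) x (jet S x) - (inner ℝ (evol X Y x (jet S x)) (varS H x (jet S x))
          + inner ℝ (Y x (jet S x)) (evol X (varS H) x (jet S x))) := by
    intro X Y hY
    rw [evol_eq_lieD, lieD_sub (hH.evol hY) (hY.inner hc), lieD_inner hY hc]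
    simp only [← evol_eq_lieD]
  rw [e hX, e hY, ← h, inner_sub_left]
  ring

/-- Pointwise core of `isTotal_linearization`: `db`, `dq` stand for the variations of `b`, `q`, and
a prefix `D` for `D_x`. Varying `S` in `S ∧` contributes only `X · (b ∧ c)`, which is zero for
tangent vectors, so no `α`-term remains. -/
theorem linearization_identity {α β : ℝ} {S Sx X Xx b c db Ddb Dc : Vec3} {q r dq Ddq Dr : ℝ}
    (h1 : inner ℝ S c = 0) (h2 : inner ℝ X b + inner ℝ S db = 0)
    (h3 : inner ℝ X (cross b c) = 0)
    (h4 : β * Ddq = β * (inner ℝ Xx b + inner ℝ Sx db)) (h5 : β * Dr = β * inner ℝ Sx c) :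
    β * (inner ℝ Ddb c + inner ℝ db Dc + (Ddq * r + dq * Dr))
      = inner ℝ (α • (cross X b + cross S db)
          + β • (Ddb + ((inner ℝ Xx b + inner ℝ Sx db) • S + inner ℝ Sx b • X)
            + (dq • Sx + q • Xx))) c
        + inner ℝ (α • cross S c + β • (Dc + inner ℝ Sx c • S + r • Sx)) db
        - β * (inner ℝ Sx b * inner ℝ X c - inner ℝ Sx c * inner ℝ X b
          + q * inner ℝ Xx c - r * inner ℝ Xx b) := by
  simp only [inner_vec3, cross_zero, cross_one, cross_two, PiLp.add_apply, PiLp.smul_apply,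
    smul_eq_mul] at *
  linear_combination r * h4 + dq * h5
    - β * (Xx 0 * b 0 + Xx 1 * b 1 + Xx 2 * b 2 + (Sx 0 * db 0 + Sx 1 * db 1 + Sx 2 * db 2)) * h1
    - β * (Sx 0 * c 0 + Sx 1 * c 1 + Sx 2 * c 2) * h2 - α * h3

/-- The trilinear expression in the linearisation of the operators. -/
def linTerm (X b c : DFun Vec3 Vec3) (q r : DFun Vec3 ℝ) : DFun Vec3 ℝ := fun x s =>
  inner ℝ (s 1) (b x s) * inner ℝ (X x s) (c x s) - inner ℝ (s 1) (c x s) * inner ℝ (X x s) (b x s)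
    + q x s * inner ℝ (totalD X x s) (c x s) - r x s * inner ℝ (totalD X x s) (b x s)

/-- Vary `Y = A(b)` along `X`. Skew-symmetry moves the operator from `X(b)` onto `c`, giving `-Z ·
X(b)`; the variation of the coefficients of `A` remains and is collected in `linTerm`. The primitive
is that of skew-symmetry with `X(b)`, `X(q)` in place of `b`, `q`. -/
theorem isTotal_linearization {α β : ℝ} {X b c Y Z : DFun Vec3 Vec3} {q r : DFun Vec3 ℝ}
    (hX : IsDFun X) (hXt : IsTangent X) (hb : IsDFun b) (hbt : IsTangent b)
    (hc : IsDFun c) (hct : IsTangent c) (hq : IsDFun q) (hr : IsDFun r) (hYd : IsDFun Y)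
    (hqx : ∀ S ∈ sphereCurves, ∀ x,
      β * totalD q x (jet S x) = β * inner ℝ (jet S x 1) (b x (jet S x)))
    (hrx : ∀ S ∈ sphereCurves, ∀ x,
      β * totalD r x (jet S x) = β * inner ℝ (jet S x 1) (c x (jet S x)))
    (hY : ∀ S ∈ sphereCurves, ∀ x, Y x (jet S x) = hamField α β b q x (jet S x))
    (hZ : ∀ S ∈ sphereCurves, ∀ x, Z x (jet S x) = hamField α β c r x (jet S x)) :
    IsTotal sphereCurves (fun x s => inner ℝ (evol X Y x s) (c x s)
      + inner ℝ (Z x s) (evol X b x s) - β * linTerm X b c q r x s) := by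
  have hbe := hb.evol hX
  have hqe := hq.evol hX
  refine isTotal_of_totalD contDiff_of_mem_sphereCurves
    (((hbe.inner hc).add (hqe.mul hr)).constSmul β) fun S hS x => ?_
  have hXS : ∀ y, inner ℝ (S y) (ev X S y) = 0 := fun y => by
    simpa only [jet_zero] using! hXt S hS y
  rw [totalD_eq_lieD, lieD_constSmul β ((hbe.inner hc).add (hqe.mul hr)),
    lieD_add (hbe.inner hc) (hqe.mul hr), lieD_inner hbe hc, lieD_mul hqe hr]
  simp only [← totalD_eq_lieD]
  have e1 : evol X Y x (jet S x) = evol X (hamField α β b q) x (jet S x) :=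
    congrFun (ev_evol_congr hYd (IsDFun.hamField α β hb hq)
      (fun S hS => funext fun y => hY S hS y) hX hS hXS) x
  have e2 : β * totalD (evol X q) x (jet S x) = β * (inner ℝ (totalD X x (jet S x)) (b x (jet S x))
      + inner ℝ (jet S x 1) (evol X b x (jet S x))) := by
    have hSb := (IsDFun.coord (V := Vec3) 1).inner hb
    have h1 := congrFun (ev_evol_congr (hq.totalD.constSmul β) (hSb.constSmul β)
      (fun S hS => funext fun y => hqx S hS y) hX hS hXS) x
    simp only [ev, evol_eq_lieD] at h1
    rw [lieD_constSmul β hq.totalD, lieD_constSmul β hSb, lieD_inner (IsDFun.coord 1) hb,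
      lieD_coord] at h1
    simp only [← evol_eq_lieD] at h1
    rw [totalD_evol hq hX]
    exact h1
  rw [e1, hZ S hS, evol_eq_lieD X (hamField α β b q), lieD_hamField α β hb hq]
  simp only [← evol_eq_lieD]
  rw [← totalD_evol hb hX]
  exact linearization_identity (hct S hS x) (inner_evol_of_isTangent hb hbt hX hXt hS x)
    (triple_eq_zero (norm_jet_zero hS x) (hXt S hS x) (hbt S hS x) (hct S hS x)) e2 (hrx S hS x)

/-- The left side is the expanded total derivative of `β Σ (q X·c - r X·b) - αβ Σ q S·(a ∧ c)`, the
sums being cyclic; the right side is `β` times the cyclic sum of `linTerm`. The second primitive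
compensates the mixed `αβ` terms and is absent for either operator alone. -/
theorem jacobi_identity_aux {α β : ℝ} {S Sx a b c ax bx cx X Y Z Xx Yx Zx : Vec3}
    {p q r px qx rx : ℝ} (hS : ‖S‖ = 1) (hSx : inner ℝ S Sx = 0)
    (ha : inner ℝ S a = 0) (hb : inner ℝ S b = 0) (hc : inner ℝ S c = 0)
    (hax : inner ℝ Sx a + inner ℝ S ax = 0) (hbx : inner ℝ Sx b + inner ℝ S bx = 0)
    (hcx : inner ℝ Sx c + inner ℝ S cx = 0)
    (hp : β * px = β * inner ℝ Sx a) (hq : β * qx = β * inner ℝ Sx b)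
    (hr : β * rx = β * inner ℝ Sx c)
    (hX : X = α • cross S a + β • (ax + inner ℝ Sx a • S + p • Sx))
    (hY : Y = α • cross S b + β • (bx + inner ℝ Sx b • S + q • Sx))
    (hZ : Z = α • cross S c + β • (cx + inner ℝ Sx c • S + r • Sx)) :
    β * ((qx * inner ℝ X c + q * (inner ℝ Xx c + inner ℝ X cx)
          - (rx * inner ℝ X b + r * (inner ℝ Xx b + inner ℝ X bx)))
        + (rx * inner ℝ Y a + r * (inner ℝ Yx a + inner ℝ Y ax)
          - (px * inner ℝ Y c + p * (inner ℝ Yx c + inner ℝ Y cx)))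
        + (px * inner ℝ Z b + p * (inner ℝ Zx b + inner ℝ Z bx)
          - (qx * inner ℝ Z a + q * (inner ℝ Zx a + inner ℝ Z ax))))
      - α * (β * ((qx * inner ℝ S (cross a c) + q * (inner ℝ Sx (cross a c)
            + inner ℝ S (cross ax c + cross a cx)))
          + (rx * inner ℝ S (cross b a) + r * (inner ℝ Sx (cross b a)
            + inner ℝ S (cross bx a + cross b ax)))
          + (px * inner ℝ S (cross c b) + p * (inner ℝ Sx (cross c b)
            + inner ℝ S (cross cx b + cross c bx)))))
      = β * ((inner ℝ Sx b * inner ℝ X c - inner ℝ Sx c * inner ℝ X b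
            + q * inner ℝ Xx c - r * inner ℝ Xx b)
          + (inner ℝ Sx c * inner ℝ Y a - inner ℝ Sx a * inner ℝ Y c
            + r * inner ℝ Yx a - p * inner ℝ Yx c)
          + (inner ℝ Sx a * inner ℝ Z b - inner ℝ Sx b * inner ℝ Z a
            + p * inner ℝ Zx b - q * inner ℝ Zx a)) := by
  have t1 := triple_eq_zero hS hSx ha hc
  have t2 := triple_eq_zero hS hSx hb ha
  have t3 := triple_eq_zero hS hSx hc hb
  -- Cramer's rule again: the corresponding combination of cross products is `-det(a,b,c) S_x`,
  -- which is orthogonal to `S`.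
  have hdep : inner ℝ Sx b * inner ℝ S (cross a c) + inner ℝ Sx c * inner ℝ S (cross b a)
      + inner ℝ Sx a * inner ℝ S (cross c b) = 0 := by
    simp only [inner_vec3, cross_zero, cross_one, cross_two] at *
    linear_combination -(a 0 * (b 1 * c 2 - b 2 * c 1) + a 1 * (b 2 * c 0 - b 0 * c 2)
      + a 2 * (b 0 * c 1 - b 1 * c 0)) * hSx
  have hXv : ∀ v, inner ℝ X v = α * inner ℝ (cross S a) v
      + β * (inner ℝ ax v + inner ℝ Sx a * inner ℝ S v + p * inner ℝ Sx v) := fun v => by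
    rw [hX]; simp only [inner_add_left, real_inner_smul_left]
  have hYv : ∀ v, inner ℝ Y v = α * inner ℝ (cross S b) v
      + β * (inner ℝ bx v + inner ℝ Sx b * inner ℝ S v + q * inner ℝ Sx v) := fun v => by
    rw [hY]; simp only [inner_add_left, real_inner_smul_left]
  have hZv : ∀ v, inner ℝ Z v = α * inner ℝ (cross S c) v
      + β * (inner ℝ cx v + inner ℝ Sx c * inner ℝ S v + r * inner ℝ Sx v) := fun v => by
    rw [hZ]; simp only [inner_add_left, real_inner_smul_left]
  -- The terms with derivatives of `a`, `b`, `c`: their `β²` parts cancel in pairs by tangency, and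
  -- their `αβ` parts match the second primitive.
  have m1 : β * (q * inner ℝ X cx - r * inner ℝ X bx + (r * inner ℝ Y ax - p * inner ℝ Y cx)
      + (p * inner ℝ Z bx - q * inner ℝ Z ax))
      = α * (β * (q * inner ℝ S (cross ax c + cross a cx)
          + r * inner ℝ S (cross bx a + cross b ax) + p * inner ℝ S (cross cx b + cross c bx))) := by
    rw [hXv, hXv, hYv, hYv, hZv, hZv]
    simp only [inner_vec3, cross_zero, cross_one, cross_two, PiLp.add_apply] at hax hbx hcx ⊢
    linear_combination
      β * β * q * ((Sx 0 * a 0 + Sx 1 * a 1 + Sx 2 * a 2) * hcx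
        - (Sx 0 * c 0 + Sx 1 * c 1 + Sx 2 * c 2) * hax)
      + β * β * r * ((Sx 0 * b 0 + Sx 1 * b 1 + Sx 2 * b 2) * hax
        - (Sx 0 * a 0 + Sx 1 * a 1 + Sx 2 * a 2) * hbx)
      + β * β * p * ((Sx 0 * c 0 + Sx 1 * c 1 + Sx 2 * c 2) * hbx
        - (Sx 0 * b 0 + Sx 1 * b 1 + Sx 2 * b 2) * hcx)
  linear_combination (inner ℝ X c - inner ℝ Z a) * hq + (inner ℝ Y a - inner ℝ X b) * hr
    + (inner ℝ Z b - inner ℝ Y c) * hp + m1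
    - α * (hq * inner ℝ S (cross a c) + hr * inner ℝ S (cross b a) + hp * inner ℝ S (cross c b))
    - α * β * (q * t1 + r * t2 + p * t3) - α * β * hdep

theorem isTotal_linTerm {α β : ℝ} {a b c X Y Z : DFun Vec3 Vec3} {p q r : DFun Vec3 ℝ}
    (ha : IsDFun a) (hat : IsTangent a) (hb : IsDFun b) (hbt : IsTangent b)
    (hc : IsDFun c) (hct : IsTangent c) (hp : IsDFun p) (hq : IsDFun q) (hr : IsDFun r)
    (hX : IsDFun X) (hY : IsDFun Y) (hZ : IsDFun Z)
    (hpx : ∀ S ∈ sphereCurves, ∀ x,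
      β * totalD p x (jet S x) = β * inner ℝ (jet S x 1) (a x (jet S x)))
    (hqx : ∀ S ∈ sphereCurves, ∀ x,
      β * totalD q x (jet S x) = β * inner ℝ (jet S x 1) (b x (jet S x)))
    (hrx : ∀ S ∈ sphereCurves, ∀ x,
      β * totalD r x (jet S x) = β * inner ℝ (jet S x 1) (c x (jet S x)))
    (hXe : ∀ S ∈ sphereCurves, ∀ x, X x (jet S x) = hamField α β a p x (jet S x))
    (hYe : ∀ S ∈ sphereCurves, ∀ x, Y x (jet S x) = hamField α β b q x (jet S x))
    (hZe : ∀ S ∈ sphereCurves, ∀ x, Z x (jet S x) = hamField α β c r x (jet S x)) :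
    IsTotal sphereCurves (fun x s => β * (linTerm X b c q r x s + linTerm Y c a r p x s
      + linTerm Z a b p q x s)) := by
  have c0 := IsDFun.coord (V := Vec3) 0
  have k1 : ∀ {X b c : DFun Vec3 Vec3} {q r : DFun Vec3 ℝ}, IsDFun X → IsDFun b → IsDFun c →
      IsDFun q → IsDFun r →
      IsDFun (fun x s => q x s * inner ℝ (X x s) (c x s) - r x s * inner ℝ (X x s) (b x s)) :=
    fun hX hb hc hq hr => (hq.mul (hX.inner hc)).sub (hr.mul (hX.inner hb))
  have k2 : ∀ {a c : DFun Vec3 Vec3} {q : DFun Vec3 ℝ}, IsDFun a → IsDFun c → IsDFun q →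
      IsDFun (fun x s => q x s * inner ℝ (s 0) (cross (a x s) (c x s))) :=
    fun ha hc hq => hq.mul (c0.inner (ha.cross hc))
  have l1 : ∀ {X b c : DFun Vec3 Vec3} {q r : DFun Vec3 ℝ}, IsDFun X → IsDFun b → IsDFun c →
      IsDFun q → IsDFun r → ∀ x s,
      totalD (fun x s => q x s * inner ℝ (X x s) (c x s) - r x s * inner ℝ (X x s) (b x s)) x s
        = totalD q x s * inner ℝ (X x s) (c x s)
          + q x s * (inner ℝ (totalD X x s) (c x s) + inner ℝ (X x s) (totalD c x s))
          - (totalD r x s * inner ℝ (X x s) (b x s)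
          + r x s * (inner ℝ (totalD X x s) (b x s) + inner ℝ (X x s) (totalD b x s))) := by
    intro X b c q r hX hb hc hq hr x s
    simp only [totalD_eq_lieD]
    rw [lieD_sub (hq.mul (hX.inner hc)) (hr.mul (hX.inner hb)), lieD_mul hq (hX.inner hc),
      lieD_mul hr (hX.inner hb), lieD_inner hX hc, lieD_inner hX hb]
  have l2 : ∀ {a c : DFun Vec3 Vec3} {q : DFun Vec3 ℝ}, IsDFun a → IsDFun c → IsDFun q → ∀ x s,
      totalD (fun x s => q x s * inner ℝ (s 0) (cross (a x s) (c x s))) x s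
        = totalD q x s * inner ℝ (s 0) (cross (a x s) (c x s))
          + q x s * (inner ℝ (s 1) (cross (a x s) (c x s))
            + inner ℝ (s 0) (cross (totalD a x s) (c x s) + cross (a x s) (totalD c x s))) := by
    intro a c q ha hc hq x s
    simp only [totalD_eq_lieD]
    rw [lieD_mul hq (c0.inner (ha.cross hc)), lieD_inner c0 (ha.cross hc), lieD_cross ha hc,
      lieD_coord]
  have d1 := ((k1 hX hb hc hq hr).add (k1 hY hc ha hr hp)).add (k1 hZ ha hb hp hq)
  have d2 := ((k2 ha hc hq).add (k2 hb ha hr)).add (k2 hc hb hp)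
  refine isTotal_of_totalD contDiff_of_mem_sphereCurves
    ((d1.constSmul β).sub ((d2.constSmul β).constSmul α)) fun S hS x => ?_
  have e := jacobi_identity_aux (Xx := totalD X x (jet S x)) (Yx := totalD Y x (jet S x))
    (Zx := totalD Z x (jet S x)) (norm_jet_zero hS x) (inner_jet_zero_one hS x)
    (hat S hS x) (hbt S hS x) (hct S hS x) (inner_totalD_of_isTangent ha hat hS x)
    (inner_totalD_of_isTangent hb hbt hS x) (inner_totalD_of_isTangent hc hct hS x)
    (hpx S hS x) (hqx S hS x) (hrx S hS x) (hXe S hS x) (hYe S hS x) (hZe S hS x)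
  refine Eq.trans ?_ e
  rw [totalD_eq_lieD, lieD_sub (d1.constSmul β) ((d2.constSmul β).constSmul α),
    lieD_constSmul β d1, lieD_constSmul α (d2.constSmul β), lieD_constSmul β d2,
    lieD_add ((k1 hX hb hc hq hr).add (k1 hY hc ha hr hp)) (k1 hZ ha hb hp hq),
    lieD_add (k1 hX hb hc hq hr) (k1 hY hc ha hr hp),
    lieD_add ((k2 ha hc hq).add (k2 hb ha hr)) (k2 hc hb hp),
    lieD_add (k2 ha hc hq) (k2 hb ha hr)]
  simp only [← totalD_eq_lieD]
  rw [l1 hX hb hc hq hr, l1 hY hc ha hr hp, l1 hZ ha hb hp hq, l2 ha hc hq, l2 hb ha hr,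
    l2 hc hb hp]
  simp only [smul_eq_mul]

/-- The integral `D_x⁻¹ (S_x · δF/δS)` exists if `∂F/∂x` is a total derivative. -/
theorem isTotal_inner_varS {F : DFun Vec3 ℝ} (hF : IsDFun F) :
    IsTotal sphereCurves (fun x s => inner ℝ (s 1) (varS F x s) + partialX F x s) := by
  refine ((isTotal_totalD hF).sub
    (isTotal_evol_sub_inner_varS hF (IsDFun.coord 1) isTangent_coord_one)).congr fun S hS x => ?_
  rw [totalD_eq_partialX_add hF]
  ring

/-- Apply `∂/∂x` to `Y(F) ≡ Y · δF/δS`. The left side splits into `Y(∂F/∂x)`, total by hypothesis,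
and `(∂Y/∂x)(F) ≡ ∂Y/∂x · δF/δS`, which cancels one term on the right. -/
theorem isTotal_inner_partialX_varS {F : DFun Vec3 ℝ} (hF : IsDFun F)
    (h : IsTotal sphereCurves (partialX F)) {Y : DFun Vec3 Vec3} (hY : IsDFun Y)
    (hYt : IsTangent Y) :
    IsTotal sphereCurves (fun x s => inner ℝ (Y x s) (partialX (varS F) x s)) := by
  have t1 := (isTotal_evol_sub_inner_varS hF hY hYt).partialX
  have t2 := h.evol hF.partialX hY hYt
  have t3 := isTotal_evol_sub_inner_varS hF hY.partialX (hYt.partialX hY)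
  refine ((t2.add t3).sub t1).congr fun S hS x => ?_
  have e : partialX (fun x s => evol Y F x s - inner ℝ (Y x s) (varS F x s)) x (jet S x)
      = partialX (evol Y F) x (jet S x)
        - (inner ℝ (partialX Y x (jet S x)) (varS F x (jet S x))
          + inner ℝ (Y x (jet S x)) (partialX (varS F) x (jet S x))) := by
    simp only [partialX_eq_lieD]
    rw [lieD_sub (hF.evol hY) (hY.inner hF.varS), lieD_inner hY hF.varS]
  rw [e, partialX_evol hF hY]
  ring

/-- An operator that sends variational derivatives `a` to
`α S ∧ a + β (D_x a + (S_x · a) S + p S_x)`, where `D_x p = S_x · a` if `full` holds. -/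
def IsHamOp (A : CurveOp Vec3) (α β : ℝ) (full : Prop) : Prop :=
  ∀ F X, IsDFun F → (Acts sphereCurves A (varS F) X ↔ IsDFun X ∧ ∃ p, IsDFun p ∧
    ∀ S ∈ sphereCurves, ∀ x,
      (full → totalD p x (jet S x) = inner ℝ (jet S x 1) (varS F x (jet S x))) ∧
      X x (jet S x) = hamField α β (varS F) p x (jet S x))

/-! ### The Hamiltonian property for operators of the normal form -/

variable {A : CurveOp Vec3} {α β : ℝ} {full : Prop}

/-- The equation for `p` multiplied by `β` holds also for `S ∧` alone, where `p` is unconstrained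
but `β = 0`; one argument thus covers all cases. -/
theorem IsHamOp.exists_of_acts (hA : IsHamOp A α β full) (hβ : β = 0 ∨ full) {F : DFun Vec3 ℝ}
    {X : DFun Vec3 Vec3} (hF : IsDFun F) (h : Acts sphereCurves A (varS F) X) :
    IsDFun X ∧ IsTangent X ∧ ∃ p, IsDFun p ∧
      (full → IsPrimitive sphereCurves (fun x s => inner ℝ (s 1) (varS F x s)) p) ∧
      (∀ S ∈ sphereCurves, ∀ x, β * totalD p x (jet S x)
        = β * inner ℝ (jet S x 1) (varS F x (jet S x))) ∧
      ∀ S ∈ sphereCurves, ∀ x, X x (jet S x) = hamField α β (varS F) p x (jet S x) := by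
  obtain ⟨hX, p, hp, h⟩ := (hA F X hF).1 h
  have hXe : ∀ S ∈ sphereCurves, ∀ x, X x (jet S x) = hamField α β (varS F) p x (jet S x) :=
    fun S hS x => (h S hS x).2
  refine ⟨hX, isTangent_of_eq_hamField hF.varS (isTangent_varS F) hXe, p, hp,
    fun hf => ⟨hp, fun S hS x => ?_⟩, fun S hS x => ?_, hXe⟩
  · exact (hasDerivAt_ev hp hS.1 x).congr_deriv ((h S hS x).1 hf)
  · rcases hβ with rfl | hf
    · simp
    · rw [(h S hS x).1 hf]

theorem IsHamOp.exists_acts (hA : IsHamOp A α β full) {F : DFun Vec3 ℝ} (hF : IsDFun F)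
    (h : full → IsTotal sphereCurves (partialX F)) :
    ∃ X, Acts sphereCurves A (varS F) X := by
  by_cases hf : full
  · obtain ⟨p, hp⟩ := ((isTotal_inner_varS hF).sub (h hf)).congr
      (g' := fun x s => inner ℝ (s 1) (varS F x s)) fun S hS x => by ring
    exact ⟨_, (hA F _ hF).2 ⟨IsDFun.hamField α β hF.varS hp.1, p, hp.1, fun S hS x =>
      ⟨fun _ => hp.totalD_eq contDiff_of_mem_sphereCurves hS x, rfl⟩⟩⟩
  · exact ⟨_, (hA F _ hF).2 ⟨IsDFun.hamField α β hF.varS (IsDFun.const 0), _, IsDFun.const 0,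
      fun S hS x => ⟨fun h => absurd h hf, rfl⟩⟩⟩

/-- It suffices that `∂/∂x` of the bracket density is a total derivative. The field `∂X/∂x` is the
operator applied to `∂/∂x (δF/δS)`, so skew-symmetry turns `∂X/∂x · δG/δS` into `-Y · ∂/∂x (δF/δS)`;
this and the remaining term are handled by `isTotal_inner_partialX_varS`. -/
theorem IsHamOp.closed (hA : IsHamOp A α β full) (hβ : β = 0 ∨ full) {F G : DFun Vec3 ℝ}
    {X Y : DFun Vec3 Vec3} (hF : IsDFun F) (hG : IsDFun G)
    (hFX : Acts sphereCurves A (varS F) X) (hGY : Acts sphereCurves A (varS G) Y) :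
    ∃ Z, Acts sphereCurves A (varS (bracket X G)) Z := by
  obtain ⟨hX, hXt, p, hp, hp', hpx, hXe⟩ := hA.exists_of_acts hβ hF hFX
  obtain ⟨hY, hYt, q, hq, hq', hqx, hYe⟩ := hA.exists_of_acts hβ hG hGY
  refine hA.exists_acts (hX.inner hG.varS) fun hf => ?_
  have hFx : IsTotal sphereCurves (partialX F) :=
    ((isTotal_inner_varS hF).sub ⟨p, hp' hf⟩).congr fun S hS x => by ring
  have hGx : IsTotal sphereCurves (partialX G) :=
    ((isTotal_inner_varS hG).sub ⟨q, hq' hf⟩).congr fun S hS x => by ring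
  have hXx : ∀ S ∈ sphereCurves, ∀ x, partialX X x (jet S x)
      = hamField α β (partialX (varS F)) (partialX p) x (jet S x) := by
    intro S hS x
    have h := congrFun (ev_partialX_congr (φ := X) (ψ := hamField α β (varS F) p)
      (fun S hS => funext fun y => hXe S hS y) hS) x
    simp only [ev] at h
    rw [h, partialX_eq_lieD, lieD_hamField α β hF.varS hp, hamField,
      totalD_partialX hF.varS]
    simp only [← partialX_eq_lieD]
    simp only [← crossL_apply]
    simp
  have hpxx : ∀ S ∈ sphereCurves, ∀ x, β * totalD (partialX p) x (jet S x)
      = β * inner ℝ (jet S x 1) (partialX (varS F) x (jet S x)) := by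
    intro S hS x
    have h := congrFun (ev_partialX_congr (φ := totalD p)
      (ψ := fun x s => inner ℝ (s 1) (varS F x s))
      (fun S hS => funext fun y =>
        (hp' hf).totalD_eq contDiff_of_mem_sphereCurves hS y) hS) x
    simp only [ev] at h
    rw [totalD_partialX hp, h, partialX_eq_lieD, lieD_inner (IsDFun.coord 1) hF.varS, lieD_coord,
      inner_zero_left, zero_add, partialX_eq_lieD]
  have t1 := isTotal_skew hF.varS.partialX ((isTangent_varS F).partialX hF.varS) hG.varS
    (isTangent_varS G) hp.partialX hq hpxx hqx hXx hYe
  have t2 := isTotal_inner_partialX_varS hF hFx hY hYt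
  have t3 := isTotal_inner_partialX_varS hG hGx hX hXt
  refine ((t1.sub t2).add t3).congr fun S hS x => ?_
  have e : partialX (bracket X G) x (jet S x)
      = inner ℝ (partialX X x (jet S x)) (varS G x (jet S x))
        + inner ℝ (X x (jet S x)) (partialX (varS G) x (jet S x)) := by
    unfold bracket
    simp only [partialX_eq_lieD]
    rw [lieD_inner hX hG.varS]
  rw [e]
  ring

theorem IsHamOp.isHamiltonian (hA : IsHamOp A α β full) (hβ : β = 0 ∨ full) :
    IsHamiltonian A where
  defined F hF hFx := by
    refine hA.exists_acts hF fun _ => ?_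
    refine (isTotal_totalD (IsDFun.const (0 : ℝ))).congr fun S hS x => ?_
    rw [totalD_zero, partialX]
    simp only [fun t => hFx (x + t) x (jet S x), deriv_const]
  tangent F X hF h := fun S hS => funext fun x => (hA.exists_of_acts hβ hF h).2.1 S hS x
  closed F G X Y hF hG hFX hGY := hA.closed hβ hF hG hFX hGY
  skew F G X Y hF hG hFX hGY := by
    obtain ⟨hX, hXt, p, hp, hp', hpx, hXe⟩ := hA.exists_of_acts hβ hF hFX
    obtain ⟨hY, hYt, q, hq, hq', hqx, hYe⟩ := hA.exists_of_acts hβ hG hGY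
    exact isTotal_skew hF.varS (isTangent_varS F) hG.varS (isTangent_varS G) hp hq hpx hqx hXe hYe
  jacobi F G H X Y Z hF hG hH hFX hGY hHZ := by
    obtain ⟨hX, hXt, p, hp, hp', hpx, hXe⟩ := hA.exists_of_acts hβ hF hFX
    obtain ⟨hY, hYt, q, hq, hq', hqx, hYe⟩ := hA.exists_of_acts hβ hG hGY
    obtain ⟨hZ, hZt, r, hr, hr', hrx, hZe⟩ := hA.exists_of_acts hβ hH hHZ
    -- With `a`, `b`, `c` the gradients of `F`, `G`, `H`: each double bracket is `X(Y·c) = X(Y)·c +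
    -- Y·X(c)` up to total derivatives. The `s` terms exchange `Y·X(c)` for `X·Y(c)`, the `l` terms
    -- then reduce the cyclic sum to `linTerm`, and `t` disposes of that.
    have b1 := isTotal_evol_sub_inner_varS (hY.inner hH.varS) hX hXt
    have b2 := isTotal_evol_sub_inner_varS (hZ.inner hF.varS) hY hYt
    have b3 := isTotal_evol_sub_inner_varS (hX.inner hG.varS) hZ hZt
    have s1 := isTotal_helmholtz hH hX hXt hY hYt
    have s2 := isTotal_helmholtz hF hY hYt hZ hZt
    have s3 := isTotal_helmholtz hG hZ hZt hX hXt
    have l1 := isTotal_linearization hX hXt hG.varS (isTangent_varS G) hH.varS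
      (isTangent_varS H) hq hr hY hqx hrx hYe hZe
    have l2 := isTotal_linearization hY hYt hH.varS (isTangent_varS H) hF.varS
      (isTangent_varS F) hr hp hZ hrx hpx hZe hXe
    have l3 := isTotal_linearization hZ hZt hF.varS (isTangent_varS F) hG.varS
      (isTangent_varS G) hp hq hX hpx hqx hXe hYe
    have t := isTotal_linTerm hF.varS (isTangent_varS F) hG.varS (isTangent_varS G) hH.varS
      (isTangent_varS H) hp hq hr hX hY hZ hpx hqx hrx hXe hYe hZe
    refine ((((l1.add l2).add l3).add t).add (((s1.add s2).add s3).sub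
      ((b1.add b2).add b3))).congr fun S hS x => ?_
    have e : ∀ {X Y c : DFun Vec3 Vec3}, IsDFun Y → IsDFun c →
        evol X (fun x s => inner ℝ (Y x s) (c x s)) x (jet S x)
          = inner ℝ (evol X Y x (jet S x)) (c x (jet S x))
            + inner ℝ (Y x (jet S x)) (evol X c x (jet S x)) := by
      intro X Y c hY hc
      simp only [evol_eq_lieD]
      rw [lieD_inner hY hc]
    rw [e hY hH.varS, e hZ hF.varS, e hX hG.varS]
    unfold bracket
    ring

theorem isHamOp_spinOp₁ : IsHamOp spinOp₁ 1 0 False := by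
  intro F X hF
  have key : ∀ S x p, hamField 1 0 (varS F) p x (jet S x)
      = cross (S x) (ev (varS F) S x) := by
    intro S x p
    rw [hamField, one_smul, zero_smul, add_zero, jet_zero]; rfl
  refine and_congr Iff.rfl (exists_congr fun p => and_congr Iff.rfl ?_)
  simp only [spinOp₁, key, false_imp_iff, true_and]
  rfl

theorem ev_varS_deriv {F : DFun Vec3 ℝ} (hF : IsDFun F) {S : ℝ → Vec3} (hS : S ∈ sphereCurves)
    (x : ℝ) : deriv (ev (varS F) S) x = totalD (varS F) x (jet S x) :=
  (hasDerivAt_ev hF.varS hS.1 x).deriv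

theorem hasDerivAt_ev_iff {p : DFun Vec3 ℝ} (hp : IsDFun p) {S : ℝ → Vec3}
    (hS : S ∈ sphereCurves) (x y : ℝ) :
    HasDerivAt (ev p S) y x ↔ totalD p x (jet S x) = y :=
  ⟨fun h => (hasDerivAt_ev hp hS.1 x).unique h, fun h => h ▸ hasDerivAt_ev hp hS.1 x⟩

theorem isHamOp_spinOp₂ : IsHamOp spinOp₂ 0 1 True := by
  intro F X hF
  refine and_congr Iff.rfl (exists_congr fun p => and_congr_right fun hp =>
    forall₂_congr fun S hS => ?_)
  simp only [spinOp₂, ev_varS_deriv hF hS, hasDerivAt_ev_iff hp hS, ← forall_and, hamField,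
    zero_smul, one_smul, zero_add, jet_zero, jet_one, true_imp_iff]
  rfl

/-- Even for `β = 0` a combination keeps the domain of its nonlocal member, so the condition on `p`
is always in force. -/
theorem isHamOp_comb (α β : ℝ) : IsHamOp (comb α spinOp₁ β spinOp₂) α β True := by
  intro F X hF
  refine and_congr Iff.rfl (exists_congr fun p => and_congr_right fun hp =>
    forall₂_congr fun S hS => ?_)
  simp only [true_imp_iff]
  constructor
  · rintro ⟨b₁, b₂, h1, ⟨h2, h3⟩, h4⟩ x
    refine ⟨?_, ?_⟩
    · have := (hasDerivAt_ev_iff hp hS x _).1 (h2 x)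
      rwa [jet_one]
    · have := h4 x
      rw [h1, h3, ev_varS_deriv hF hS] at this
      rw [hamField, jet_zero, jet_one]
      exact this
  · intro h
    refine ⟨_, _, fun _ => rfl, ⟨fun x => (hasDerivAt_ev_iff hp hS x _).2 ?_, fun _ => rfl⟩,
      fun x => ?_⟩
    · have := (h x).1
      rwa [jet_one] at this
    · have := (h x).2
      rw [hamField, jet_zero, jet_one] at this
      rw [ev_varS_deriv hF hS]
      exact this

theorem compatibleHamiltonian_spinOp : CompatibleHamiltonian spinOp₁ spinOp₂ :=
  ⟨isHamOp_spinOp₁.isHamiltonian (Or.inl rfl), isHamOp_spinOp₂.isHamiltonian (Or.inr trivial),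
    fun α β => (isHamOp_comb α β).isHamiltonian (Or.inr trivial)⟩

/-- For tangent `a` the normal part of `D_x a` is `-(S_x · a) S`; projecting it away and adding
`(S_x · a) S` are the same. -/
theorem mapOp₂_iff {F : DFun Vec3 ℝ} (hF : IsDFun F) {S : ℝ → Vec3} (hS : S ∈ sphereCurves)
    (p : ℝ → ℝ) (b : ℝ → Vec3) :
    mapOp₂ S (ev (varS F) S) p b ↔ spinOp₂ S (ev (varS F) S) p b := by
  refine and_congr Iff.rfl (forall_congr' fun x => ?_)
  have h := inner_totalD_of_isTangent hF.varS (isTangent_varS F) hS x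
  rw [ev_varS_deriv hF hS, tproj]
  rw [jet_zero, jet_one] at h
  have h1 : inner ℝ (S x) (totalD (varS F) x (jet S x))
      = -inner ℝ (deriv S x) (ev (varS F) S x) := by
    simp only [ev]; linarith
  rw [h1, neg_smul, sub_neg_eq_add]

theorem isHamOp_mapOp₂ : IsHamOp mapOp₂ 0 1 True := by
  intro F X hF
  rw [← isHamOp_spinOp₂ F X hF]
  exact and_congr Iff.rfl (exists_congr fun p => and_congr_right fun hp =>
    forall₂_congr fun S hS => mapOp₂_iff hF hS _ _)

theorem isHamOp_map_comb (α β : ℝ) : IsHamOp (comb α mapOp₁ β mapOp₂) α β True := by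
  intro F X hF
  rw [← isHamOp_comb α β F X hF]
  exact and_congr Iff.rfl (exists_congr fun p => and_congr_right fun hp =>
    forall₂_congr fun S hS => exists₂_congr fun b₁ b₂ => and_congr Iff.rfl
      (and_congr (mapOp₂_iff hF hS _ _) Iff.rfl))

theorem compatibleHamiltonian_mapOp : CompatibleHamiltonian mapOp₁ mapOp₂ :=
  ⟨isHamOp_spinOp₁.isHamiltonian (Or.inl rfl), isHamOp_mapOp₂.isHamiltonian (Or.inr trivial),
    fun α β => (isHamOp_map_comb α β).isHamiltonian (Or.inr trivial)⟩

end Hamiltonian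

/-! ### The symplectic operators -/

section Symplectic

theorem re_star_mul (a b : ℂ) : (star a * b).re = inner ℝ a b := by
  rw [Complex.inner, mul_comm]; rfl

theorem re_mul_star (a b : ℂ) : (a * star b).re = inner ℝ b a := by
  rw [mul_comm, re_star_mul]

theorem inner_complex (a b : ℂ) : inner ℝ a b = a.re * b.re + a.im * b.im := by
  rw [← re_star_mul]; simp [Complex.mul_re]

/-- Multiplication by a complex number as a real linear map. -/
def mulL (z : ℂ) : ℂ →L[ℝ] ℂ := ContinuousLinearMap.mul ℝ ℂ z

theorem mulL_apply (z w : ℂ) : mulL z w = z * w := rfl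

/-- There is no constraint on `u`, so the straight variation `u + tξ` serves for every `ξ`. -/
theorem ev_evol_congr_complex {W : Type*} [NormedAddCommGroup W] [NormedSpace ℝ W]
    {φ ψ : DFun ℂ W} (hφ : IsDFun φ) (hψ : IsDFun ψ)
    (h : ∀ u ∈ uCurves, ∀ x, φ x (jet u x) = ψ x (jet u x)) {ξ : DFun ℂ ℂ} (hξ : IsDFun ξ)
    {u : ℝ → ℂ} (hu : u ∈ uCurves) (x : ℝ) :
    evol ξ φ x (jet u x) = evol ξ ψ x (jet u x) := by
  have hu' : ContDiff ℝ ∞ u := hu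
  have hs : ContDiff ℝ ∞ (fun z : ℝ × ℝ => u z.2 + z.1 • ev ξ u z.2) :=
    (hu'.comp contDiff_snd).add
      (contDiff_fst.smul ((contDiff_ev hξ hu).comp contDiff_snd))
  have h1 : ∀ x, HasDerivAt (fun t : ℝ => u x + t • ev ξ u x) (ev ξ u x) 0 := fun x => by
    simpa using ((hasDerivAt_id (0 : ℝ)).smul_const (ev ξ u x)).const_add (u x)
  have h3 := hasDerivAt_ev_variation hφ hξ hs hu (fun x => by simp) h1 x
  have h4 := hasDerivAt_ev_variation hψ hξ hs hu (fun x => by simp) h1 x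
  have h5 : ∀ t : ℝ, ev φ (fun y => u y + t • ev ξ u y) x = ev ψ (fun y => u y + t • ev ξ u y) x :=
    fun t => h _
      (show ContDiff ℝ ∞ _ from hu'.add ((contDiff_ev hξ hu').const_smul t)) x
  simp only [h5] at h3
  exact h3.unique h4

theorem contDiff_of_mem_uCurves : ∀ u ∈ uCurves, ContDiff ℝ ∞ u := fun _ h => h

/-- The vector field `-α i ξ + β (D_x ξ + p u)`. -/
def sympField (α β : ℝ) (ξ : DFun ℂ ℂ) (p : DFun ℂ ℝ) : DFun ℂ ℂ := fun x s =>
  α • mulL (-Complex.I) (ξ x s) + β • (totalD ξ x s + p x s • s 0)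

theorem IsDFun.sympField (α β : ℝ) {ξ : DFun ℂ ℂ} {p : DFun ℂ ℝ} (hξ : IsDFun ξ)
    (hp : IsDFun p) : IsDFun (sympField α β ξ p) :=
  ((hξ.comp (mulL (-Complex.I)).contDiff).constSmul α).add
    ((hξ.totalD.add (hp.smul (IsDFun.coord 0))).constSmul β)

theorem lieD_sympField {e : DFun ℂ ℝ} {E : ℕ → DFun ℂ ℂ} (α β : ℝ) {ξ : DFun ℂ ℂ}
    {p : DFun ℂ ℝ} (hξ : IsDFun ξ) (hp : IsDFun p) (x : ℝ) (s : ℕ → ℂ) :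
    lieD e E (sympField α β ξ p) x s
      = α • mulL (-Complex.I) (lieD e E ξ x s)
        + β • (lieD e E (totalD ξ) x s + (lieD e E p x s • s 0 + p x s • E 0 x s)) := by
  have h0 := hξ.comp (mulL (-Complex.I)).contDiff
  have h1 := hp.smul (IsDFun.coord (V := ℂ) 0)
  unfold sympField
  rw [lieD_add (h0.constSmul α) ((hξ.totalD.add h1).constSmul β), lieD_constSmul α h0,
    lieD_constSmul β (hξ.totalD.add h1), lieD_add hξ.totalD h1, lieD_comp hξ,
    lieD_smul hp (IsDFun.coord 0), lieD_coord]

theorem isTotal_skew_symplectic {α β : ℝ} {ξ η ξ' η' : DFun ℂ ℂ} {p q : DFun ℂ ℝ}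
    (hξ : IsDFun ξ) (hη : IsDFun η) (hp : IsDFun p) (hq : IsDFun q)
    (hpx : ∀ u ∈ uCurves, ∀ x,
      β * totalD p x (jet u x) = β * inner ℝ (ξ x (jet u x)) (jet u x 0))
    (hqx : ∀ u ∈ uCurves, ∀ x,
      β * totalD q x (jet u x) = β * inner ℝ (η x (jet u x)) (jet u x 0))
    (hξ' : ∀ u ∈ uCurves, ∀ x, ξ' x (jet u x) = sympField α β ξ p x (jet u x))
    (hη' : ∀ u ∈ uCurves, ∀ x, η' x (jet u x) = sympField α β η q x (jet u x)) :
    IsTotal uCurves (fun x s => inner ℝ (ξ x s) (η' x s) + inner ℝ (η x s) (ξ' x s)) := by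
  refine isTotal_of_totalD contDiff_of_mem_uCurves
    (((hξ.inner hη).add (hp.mul hq)).constSmul β) fun u hu x => ?_
  rw [totalD_eq_lieD, lieD_constSmul β ((hξ.inner hη).add (hp.mul hq)),
    lieD_add (hξ.inner hη) (hp.mul hq), lieD_inner hξ hη, lieD_mul hp hq]
  simp only [← totalD_eq_lieD]
  have h1 := hpx u hu x
  have h2 := hqx u hu x
  rw [hξ' u hu, hη' u hu]
  simp only [sympField, mulL_apply, inner_complex, smul_eq_mul] at *
  simp
  linear_combination q x (jet u x) * h1 + p x (jet u x) * h2

/-- Analogue of `isTotal_linearization`. The remainder comes from varying the two occurrences of `u`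
in `𝒥`, and its cyclic sum is identically zero. -/
theorem isTotal_linearization_symplectic {α β : ℝ} {ξ η ζ η' ζ' : DFun ℂ ℂ} {q r : DFun ℂ ℝ}
    (hξ : IsDFun ξ) (hη : IsDFun η) (hζ : IsDFun ζ) (hζ'd : IsDFun ζ')
    (hq : IsDFun q) (hr : IsDFun r)
    (hqx : ∀ u ∈ uCurves, ∀ x,
      β * totalD q x (jet u x) = β * inner ℝ (η x (jet u x)) (jet u x 0))
    (hrx : ∀ u ∈ uCurves, ∀ x,
      β * totalD r x (jet u x) = β * inner ℝ (ζ x (jet u x)) (jet u x 0))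
    (hη' : ∀ u ∈ uCurves, ∀ x, η' x (jet u x) = sympField α β η q x (jet u x))
    (hζ' : ∀ u ∈ uCurves, ∀ x, ζ' x (jet u x) = sympField α β ζ r x (jet u x)) :
    IsTotal uCurves (fun x s => inner ℝ (η x s) (evol ξ ζ' x s)
      + inner ℝ (evol ξ ζ x s) (η' x s)
      - β * (r x s * inner ℝ (η x s) (ξ x s) - q x s * inner ℝ (ξ x s) (ζ x s))) := by
  have hζe := hζ.evol hξ
  have hre := hr.evol hξ
  refine isTotal_of_totalD contDiff_of_mem_uCurves
    (((hη.inner hζe).add (hq.mul hre)).constSmul β) fun u hu x => ?_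
  have e1 : evol ξ ζ' x (jet u x) = evol ξ (sympField α β ζ r) x (jet u x) :=
    ev_evol_congr_complex hζ'd (IsDFun.sympField α β hζ hr) hζ' hξ hu x
  have e2 : β * totalD (evol ξ r) x (jet u x) = β * (inner ℝ (evol ξ ζ x (jet u x)) (jet u x 0)
      + inner ℝ (ζ x (jet u x)) (ξ x (jet u x))) := by
    have hζu := hζ.inner (IsDFun.coord (V := ℂ) 0)
    have h1 := ev_evol_congr_complex (hr.totalD.constSmul β) (hζu.constSmul β) hrx hξ hu x
    simp only [evol_eq_lieD] at h1
    rw [lieD_constSmul β hr.totalD, lieD_constSmul β hζu, lieD_inner hζ (IsDFun.coord 0),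
      lieD_coord] at h1
    simp only [← evol_eq_lieD] at h1
    rw [totalD_evol hr hξ]
    exact h1
  have h2 := hqx u hu x
  rw [totalD_eq_lieD, lieD_constSmul β ((hη.inner hζe).add (hq.mul hre)),
    lieD_add (hη.inner hζe) (hq.mul hre), lieD_inner hη hζe, lieD_mul hq hre]
  rw [e1, hη' u hu, evol_eq_lieD ξ (sympField α β ζ r), lieD_sympField α β hζ hr]
  simp only [← evol_eq_lieD, ← totalD_eq_lieD]
  rw [← totalD_evol hζ hξ]
  simp only [sympField, mulL_apply, inner_complex, smul_eq_mul, Function.iterate_zero, id] at *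
  simp
  linear_combination evol ξ r x (jet u x) * h2 + q x (jet u x) * e2

/-- An operator that sends `ξ` to `-α i ξ + β (D_x ξ + p u)`, where `D_x p = Re(u ξ̄)` if `full`
holds. -/
def IsSympOp (A : CurveOp ℂ) (α β : ℝ) (full : Prop) : Prop :=
  ∀ ξ η, IsDFun ξ → (Acts uCurves A ξ η ↔ IsDFun η ∧ ∃ p, IsDFun p ∧
    ∀ u ∈ uCurves, ∀ x,
      (full → totalD p x (jet u x) = inner ℝ (ξ x (jet u x)) (jet u x 0)) ∧
      η x (jet u x) = sympField α β ξ p x (jet u x))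

/-! ### The symplectic property for operators of the normal form -/

variable {A : CurveOp ℂ} {α β : ℝ} {full : Prop}

theorem IsSympOp.exists_of_acts (hA : IsSympOp A α β full) (hβ : β = 0 ∨ full) {ξ ξ' : DFun ℂ ℂ}
    (hξ : IsDFun ξ) (h : Acts uCurves A ξ ξ') :
    IsDFun ξ' ∧ ∃ p, IsDFun p ∧
      (full → ∀ u ∈ uCurves, ∀ x, totalD p x (jet u x) = inner ℝ (ξ x (jet u x)) (jet u x 0)) ∧
      (∀ u ∈ uCurves, ∀ x,
        β * totalD p x (jet u x) = β * inner ℝ (ξ x (jet u x)) (jet u x 0)) ∧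
      ∀ u ∈ uCurves, ∀ x, ξ' x (jet u x) = sympField α β ξ p x (jet u x) := by
  obtain ⟨hξ', p, hp, h⟩ := (hA ξ ξ' hξ).1 h
  refine ⟨hξ', p, hp, fun hf u hu x => (h u hu x).1 hf, fun u hu x => ?_, fun u hu x => (h u hu x).2⟩
  rcases hβ with rfl | hf
  · simp
  · rw [(h u hu x).1 hf]

theorem IsSympOp.isSymplectic (hA : IsSympOp A α β full) (hβ : β = 0 ∨ full) :
    IsSymplectic A where
  lie ξ η ξ' η' hξ hη hξξ' hηη' := by
    obtain ⟨hξ', p, hp, hpf, -, -⟩ := hA.exists_of_acts hβ hξ hξξ'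
    obtain ⟨hη', q, hq, hqf, -, -⟩ := hA.exists_of_acts hβ hη hηη'
    have hL : IsDFun (lieBracket ξ η) := (hη.evol hξ).sub (hξ.evol hη)
    -- The integral for `[ξ, η]` is `ξ(q) - η(p)`: in its derivative the terms `Re(ξ̄ η)` from
    -- varying `u` cancel.
    have hr : IsDFun (fun x s => evol ξ q x s - evol η p x s) := (hq.evol hξ).sub (hp.evol hη)
    refine ⟨_, (hA _ _ hL).2 ⟨IsDFun.sympField α β hL hr, _, hr, fun u hu x => ⟨fun hf => ?_, rfl⟩⟩⟩
    have e : ∀ {ξ η : DFun ℂ ℂ} {q : DFun ℂ ℝ}, IsDFun ξ → IsDFun η → IsDFun q →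
        (∀ u ∈ uCurves, ∀ x, totalD q x (jet u x) = inner ℝ (η x (jet u x)) (jet u x 0)) →
        totalD (evol ξ q) x (jet u x) = inner ℝ (evol ξ η x (jet u x)) (jet u x 0)
          + inner ℝ (η x (jet u x)) (ξ x (jet u x)) := by
      intro ξ η q hξ hη hq h
      have h1 := ev_evol_congr_complex hq.totalD (hη.inner (IsDFun.coord 0)) h hξ hu x
      rw [totalD_evol hq hξ, h1, evol_eq_lieD, lieD_inner hη (IsDFun.coord 0), lieD_coord,
        evol_eq_lieD]
      rfl
    simp only [totalD_sub (hq.evol hξ) (hp.evol hη)]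
    rw [e hξ hη hq (hqf hf), e hη hξ hp (hpf hf),
      real_inner_comm (ξ x (jet u x)) (η x (jet u x)), lieBracket, inner_sub_left]
    ring
  skew ξ η ξ' η' hξ hη hξξ' hηη' := by
    obtain ⟨hξ', p, hp, -, hpx, hξe⟩ := hA.exists_of_acts hβ hξ hξξ'
    obtain ⟨hη', q, hq, -, hqx, hηe⟩ := hA.exists_of_acts hβ hη hηη'
    simp only [re_star_mul]
    exact isTotal_skew_symplectic hξ hη hp hq hpx hqx hξe hηe
  closed ξ η ζ ξ' η' ζ' hξ hη hζ hξξ' hηη' hζζ' := by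
    obtain ⟨hξ', p, hp, -, hpx, hξe⟩ := hA.exists_of_acts hβ hξ hξξ'
    obtain ⟨hη', q, hq, -, hqx, hηe⟩ := hA.exists_of_acts hβ hη hηη'
    obtain ⟨hζ', r, hr, -, hrx, hζe⟩ := hA.exists_of_acts hβ hζ hζζ'
    have l1 := isTotal_linearization_symplectic hξ hη hζ hζ' hq hr hqx hrx hηe hζe
    have l2 := isTotal_linearization_symplectic hη hζ hξ hξ' hr hp hrx hpx hζe hξe
    have l3 := isTotal_linearization_symplectic hζ hξ hη hη' hp hq hpx hqx hξe hηe
    -- By the Leibniz rule the commutators cancel half of the terms, leaving the cyclic sum of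
    -- `Re(η̄ ξ(ζ')) + Re(conj(ξ(ζ)) η')`.
    refine ((l1.add l2).add l3).congr fun u hu x => ?_
    have e : ∀ {ξ η ζ' : DFun ℂ ℂ}, IsDFun η → IsDFun ζ' →
        evol ξ (fun x s => inner ℝ (η x s) (ζ' x s)) x (jet u x)
          = inner ℝ (evol ξ η x (jet u x)) (ζ' x (jet u x))
            + inner ℝ (η x (jet u x)) (evol ξ ζ' x (jet u x)) := by
      intro ξ η ζ' hη hζ'
      simp only [evol_eq_lieD]
      rw [lieD_inner hη hζ']
    simp only [re_star_mul]
    rw [e hη hζ', e hζ hξ', e hξ hη']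
    simp only [lieBracket, inner_sub_left]
    ring

theorem neg_opI_inv : -opI⁻¹ = -Complex.I := by
  rw [opI, inv_neg, Complex.inv_I, neg_neg]

theorem hasDerivAt_ev_iff_complex {p : DFun ℂ ℝ} (hp : IsDFun p) {u : ℝ → ℂ}
    (hu : u ∈ uCurves) (x y : ℝ) :
    HasDerivAt (ev p u) y x ↔ totalD p x (jet u x) = y :=
  ⟨fun h => (hasDerivAt_ev hp hu x).unique h, fun h => h ▸ hasDerivAt_ev hp hu x⟩

theorem isSympOp_uOp₁ : IsSympOp uOp₁ 1 0 False := by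
  intro ξ η hξ
  refine and_congr Iff.rfl (exists_congr fun p => and_congr_right fun hp =>
    forall₂_congr fun u hu => forall_congr' fun x => ?_)
  rw [neg_opI_inv, sympField, one_smul, zero_smul, add_zero, mulL_apply]
  simp only [false_imp_iff, true_and]
  rfl

theorem isSympOp_uOp₂ : IsSympOp uOp₂ 0 1 True := by
  intro ξ η hξ
  refine and_congr Iff.rfl (exists_congr fun p => and_congr_right fun hp =>
    forall₂_congr fun u hu => ?_)
  have h : ∀ x, deriv (ev ξ u) x = totalD ξ x (jet u x) := fun x => (hasDerivAt_ev hξ hu x).deriv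
  simp only [uOp₂, h, hasDerivAt_ev_iff_complex hp hu, ← forall_and, sympField,
    zero_smul, one_smul, zero_add, jet_zero, true_imp_iff, re_mul_star, Complex.real_smul]
  simp only [mul_comm (u _)]
  rfl

theorem isSympOp_comb (α β : ℝ) : IsSympOp (comb α uOp₁ β uOp₂) α β True := by
  intro ξ η hξ
  refine and_congr Iff.rfl (exists_congr fun p => and_congr_right fun hp =>
    forall₂_congr fun u hu => ?_)
  have h : ∀ x, deriv (ev ξ u) x = totalD ξ x (jet u x) := fun x => (hasDerivAt_ev hξ hu x).deriv
  have hf : ∀ x, sympField α β ξ p x (jet u x)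
      = α • (-opI⁻¹ * ev ξ u x) + β • (deriv (ev ξ u) x + u x * ((ev p u x : ℝ) : ℂ)) := by
    intro x
    rw [neg_opI_inv, sympField, mulL_apply, h, jet_zero, Complex.real_smul (x := p x (jet u x)),
      mul_comm (u x)]
    rfl
  simp only [true_imp_iff, hf]
  constructor
  · rintro ⟨b₁, b₂, h1, ⟨h2, h3⟩, h4⟩ x
    refine ⟨?_, ?_⟩
    · have := (hasDerivAt_ev_iff_complex hp hu x _).1 (h2 x)
      rwa [re_mul_star, ← jet_zero u] at this
    · have := h4 x
      rwa [h1, h3] at this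
  · intro h
    refine ⟨_, _, fun _ => rfl, ⟨fun x => (hasDerivAt_ev_iff_complex hp hu x _).2 ?_,
      fun _ => rfl⟩, fun x => (h x).2⟩
    rw [re_mul_star, ← jet_zero u]
    exact (h x).1

theorem compatibleSymplectic_uOp : CompatibleSymplectic uOp₁ uOp₂ :=
  ⟨isSympOp_uOp₁.isSymplectic (Or.inl rfl), isSympOp_uOp₂.isSymplectic (Or.inr trivial),
    fun α β => (isSympOp_comb α β).isSymplectic (Or.inr trivial)⟩

theorem uOp₂_iff_uRecStar (u ξ : ℝ → ℂ) (p : ℝ → ℝ) (η : ℝ → ℂ) :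
    uOp₂ u ξ p η ↔ uRecStar u (fun x => opI⁻¹ * ξ x) p (fun x => -η x) := by
  have hI : opI⁻¹ = Complex.I := by rw [opI, inv_neg, Complex.inv_I, neg_neg]
  have h1 : ∀ x, (Complex.I * u x * star (Complex.I * ξ x)).re = (u x * star (ξ x)).re := by
    intro x; simp [Complex.mul_re, Complex.mul_im]
  have h2 : ∀ x, deriv (fun x => Complex.I * ξ x) x = Complex.I * deriv ξ x := fun x => by
    simp
  rw [uOp₂, uRecStar, hI]
  refine and_congr (forall_congr' fun x => ?_) (forall_congr' fun x => ?_)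
  · rw [h1]
  · rw [h2, ← mul_assoc, Complex.I_mul_I, neg_one_mul, neg_eq_iff_eq_neg, neg_sub, sub_neg_eq_add,
      add_comm (deriv ξ x)]

end Symplectic

/-! ### The hierarchy in terms of `u` -/

section ComplexHierarchy

open Finset.HasAntidiagonal (antidiagonal mem_antidiagonal)

/-- The density `D_x⁻¹ Re(i u ϖ̄^{(n)})`. -/
def uH (n : ℕ) : DFun ℂ ℝ := fun x s => 2⁻¹ * ∑ i : Fin n,
  (uH i x s * uH (n - 1 - i) x s + inner ℝ (uGrad i x s) (uGrad (n - 1 - i) x s))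
termination_by n
decreasing_by all_goals omega

theorem uH_eq (n : ℕ) : uH n = fun x s => 2⁻¹ * ∑ i ∈ Finset.range n,
    (uH i x s * uH (n - 1 - i) x s + inner ℝ (uGrad i x s) (uGrad (n - 1 - i) x s)) := by
  funext x s
  rw [uH, Finset.sum_range]

theorem uH_succ_eq (n : ℕ) : uH (n + 1) = fun x s => 2⁻¹ * ∑ ij ∈ antidiagonal n,
    (uH ij.1 x s * uH ij.2 x s + inner ℝ (uGrad ij.1 x s) (uGrad ij.2 x s)) := by
  rw [uH_eq]
  funext x s
  rw [Finset.Nat.sum_antidiagonal_eq_sum_range_succ_mk]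
  rfl

theorem totalD_uGrad {n : ℕ}
    (h : IsInvD uCurves uVacuum (fun x s => (Complex.I * s 0 * star (uGrad n x s)).re) (uH n))
    {u : ℝ → ℂ} (hu : u ∈ uCurves) (x : ℝ) : totalD (uGrad n) x (jet u x)
      = -(Complex.I * uGrad (n + 1) x (jet u x)) - Complex.I * jet u x 0 * uH n x (jet u x) := by
  have h1 := congrFun (invD_eqAlong complex_deformation h u hu) x
  simp only [ev] at h1
  have h2 : uGrad (n + 1) x (jet u x) = Complex.I * totalD (uGrad n) x (jet u x)
      - jet u x 0 * (uH n x (jet u x) : ℂ) := by rw [← h1]; rfl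
  rw [h2]
  linear_combination totalD (uGrad n) x (jet u x) * Complex.I_mul_I

theorem inner_I_mul_comm (a b : ℂ) :
    inner ℝ a (Complex.I * b) = -inner ℝ b (Complex.I * a) := by
  simp; ring

/-- Over the full antidiagonal of `n + 1` the pairing is antisymmetric and sums to zero; the claim
splits off one end term. -/
theorem sum_inner_I_mul (w : ℕ → ℂ) (n : ℕ) :
    ∑ ij ∈ antidiagonal n, inner ℝ (w ij.1) (Complex.I * w (ij.2 + 1))
      = -inner ℝ (w (n + 1)) (Complex.I * w 0) := by
  have h : ∑ ij ∈ antidiagonal (n + 1), inner ℝ (w ij.1) (Complex.I * w ij.2)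
      = -∑ ij ∈ antidiagonal (n + 1), inner ℝ (w ij.1) (Complex.I * w ij.2) := by
    nth_rw 1 [← Finset.Nat.sum_antidiagonal_swap]
    rw [← Finset.sum_neg_distrib]
    exact Finset.sum_congr rfl fun ij _ => inner_I_mul_comm _ _
  rw [Finset.Nat.sum_antidiagonal_succ'] at h
  linarith

/-- The claims are proved together because `ϖ^{(n+1)}` is meaningful only once the integral for `n`
exists. Differentiating the quadratic recursion for `h_{n+1}`, the products with some `h_i` cancel
and `sum_inner_I_mul` leaves only the end term `Re(i u ϖ̄^{(n+1)})`. -/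
theorem uGrad_spec_aux (n : ℕ) : IsDFun (uGrad n) ∧ (∀ x, ev (uGrad n) (fun _ => 0) x = 0) ∧
    IsInvD uCurves uVacuum (fun x s => (Complex.I * s 0 * star (uGrad n x s)).re) (uH n) := by
  induction n using Nat.strong_induction_on with
  | _ n ih =>
    have hG : IsDFun (uGrad n) := by
      cases n with
      | zero => exact IsDFun.coord 0
      | succ n =>
        obtain ⟨h1, -, h2⟩ := ih n (by omega)
        have h3 := (invD_spec ⟨_, h2⟩).1.1
        have h4 := (h1.totalD.comp (mulL Complex.I).contDiff).sub
          (h3.smul (IsDFun.coord (V := ℂ) 0))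
        simp only [Complex.real_smul, mul_comm _ (_ : ℂ)] at h4
        exact h4
    have hG0 : ∀ x, ev (uGrad n) (fun _ => 0) x = 0 := by
      cases n with
      | zero => intro x; simp [ev, uGrad, jet]
      | succ n =>
        obtain ⟨h1, h2, -⟩ := ih n (by omega)
        intro x
        have h3 : ev (totalD (uGrad n)) (fun _ => 0) x = 0 := by
          rw [← (hasDerivAt_ev h1 contDiff_const x).deriv, funext h2]
          simp
        simp only [ev] at h3
        simp [ev, uGrad, h3, jet]
    have hH : IsDFun (uH n) := by
      rw [uH_eq]
      refine (IsDFun.const _).mul (IsDFun.sum _ fun i hi => ?_)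
      rw [Finset.mem_range] at hi
      obtain ⟨h1, -, h2⟩ := ih i hi
      obtain ⟨h3, -, h4⟩ := ih (n - 1 - i) (by omega)
      exact (h2.1.1.mul h4.1.1).add (h1.inner h3)
    refine ⟨hG, hG0, ⟨hH, fun u hu x => ?_⟩, ?_⟩
    · refine (hasDerivAt_ev hH hu x).congr_deriv ?_
      simp only [ev, re_mul_star]
      cases n with
      | zero =>
        -- The recursion starts with an empty sum, in accordance with `Re(i u ū) = 0`.
        have : uH 0 = fun _ _ => 0 := by rw [uH_eq]; simp
        rw [this, totalD_eq_lieD, lieD_const]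
        simp only [uGrad]
        have := inner_I_mul_comm (jet u x 0) (jet u x 0)
        linarith
      | succ n =>
        have hi : ∀ ij ∈ antidiagonal n, IsDFun (uGrad ij.1) ∧ IsDFun (uGrad ij.2) ∧
            IsDFun (uH ij.1) ∧ IsDFun (uH ij.2) := fun ij hij => by
          rw [mem_antidiagonal] at hij
          obtain ⟨h1, -, h2⟩ := ih ij.1 (by omega)
          obtain ⟨h3, -, h4⟩ := ih ij.2 (by omega)
          exact ⟨h1, h3, h2.1.1, h4.1.1⟩
        have hs : ∀ ij ∈ antidiagonal n, IsDFun (fun x s =>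
            uH ij.1 x s * uH ij.2 x s + inner ℝ (uGrad ij.1 x s) (uGrad ij.2 x s)) :=
          fun ij hij => by
            obtain ⟨h1, h2, h3, h4⟩ := hi ij hij
            exact (h3.mul h4).add (h1.inner h2)
        rw [uH_succ_eq, totalD_eq_lieD]
        refine (lieD_constSmul _ (IsDFun.sum _ hs) _ _).trans ?_
        rw [lieD_sum _ hs]
        have e1 : ∀ ij ∈ antidiagonal n, lieD (fun _ _ => 1) (fun k _ s => s (k + 1)) (fun x s =>
            uH ij.1 x s * uH ij.2 x s + inner ℝ (uGrad ij.1 x s) (uGrad ij.2 x s)) x (jet u x)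
            = -(inner ℝ (uGrad ij.1 x (jet u x)) (Complex.I * uGrad (ij.2 + 1) x (jet u x))
              + inner ℝ (uGrad ij.2 x (jet u x)) (Complex.I * uGrad (ij.1 + 1) x (jet u x))) := by
          intro ij hij
          obtain ⟨h1, h2, h3, h4⟩ := hi ij hij
          rw [mem_antidiagonal] at hij
          have k1 := (ih ij.1 (by omega)).2.2
          have k2 := (ih ij.2 (by omega)).2.2
          rw [lieD_add (h3.mul h4) (h1.inner h2), lieD_mul h3 h4, lieD_inner h1 h2]
          simp only [← totalD_eq_lieD]
          have d1 := (hasDerivAt_ev h3 hu x).unique (k1.1.2 u hu x)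
          have d2 := (hasDerivAt_ev h4 hu x).unique (k2.1.2 u hu x)
          simp only [ev, re_mul_star] at d1 d2
          rw [d1, d2, totalD_uGrad k1 hu, totalD_uGrad k2 hu]
          simp
          ring
        rw [Finset.sum_congr rfl e1, Finset.sum_neg_distrib, Finset.sum_add_distrib]
        have e2 := sum_inner_I_mul (fun k => uGrad k x (jet u x)) n
        have e3 := e2
        rw [← Finset.Nat.sum_antidiagonal_swap] at e3
        simp only [Prod.fst_swap, Prod.snd_swap] at e3
        rw [e2, e3]
        simp only [uGrad, smul_eq_mul]
        ring
    · rintro c rfl x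
      simp only [ev]
      rw [uH_eq]
      simp only
      rw [Finset.sum_eq_zero, mul_zero]
      intro i hi
      rw [Finset.mem_range] at hi
      have h1 := (ih i hi).2.1 x
      have h2 := (ih i hi).2.2.2 _ rfl x
      simp only [ev] at h1 h2
      rw [h1, h2, inner_zero_left, zero_mul, add_zero]

theorem isDFun_uGrad (n : ℕ) : IsDFun (uGrad n) := (uGrad_spec_aux n).1

theorem isInvD_uH (n : ℕ) :
    IsInvD uCurves uVacuum (fun x s => (Complex.I * s 0 * star (uGrad n x s)).re) (uH n) :=
  (uGrad_spec_aux n).2.2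

end ComplexHierarchy

/-! ### Parallel frames -/

namespace IsParallelFrame

variable {S N₁ N₂ : ℝ → Vec3} {u : ℝ → ℂ} (h : IsParallelFrame S N₁ N₂ u)
include h

theorem mem_sphereCurves : S ∈ sphereCurves := ⟨h.smooth_S, h.norm_S⟩

theorem cross_N₂ (x : ℝ) : cross (S x) (N₂ x) = -N₁ x := by
  rw [h.oriented, cross_cross_self (h.norm_S x) (h.orthogonal x)]

theorem inner_S_N₂ (x : ℝ) : inner ℝ (S x) (N₂ x) = 0 := by
  rw [h.oriented, inner_cross_self_left]

theorem inner_N₁_N₂ (x : ℝ) : inner ℝ (N₁ x) (N₂ x) = 0 := by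
  rw [h.oriented, inner_cross_self_right]

theorem inner_N₁_self (x : ℝ) : inner ℝ (N₁ x) (N₁ x) = (1 : ℝ) := by
  rw [real_inner_self_eq_norm_sq, h.norm_N₁]; simp

theorem inner_N₂_self (x : ℝ) : inner ℝ (N₂ x) (N₂ x) = (1 : ℝ) := by
  conv_lhs => rw [h.oriented, ← h.oriented]
  nth_rw 2 [h.oriented]
  rw [inner_cross_rotate, inner_cross_comm, h.cross_N₂, inner_neg_right, neg_neg,
    h.inner_N₁_self]

theorem smooth_N₂ : ContDiff ℝ ∞ N₂ := by
  have : N₂ = fun x => crossL (S x) (N₁ x) := funext h.oriented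
  rw [this]
  exact (crossL.contDiff.comp h.smooth_S).clm_apply h.smooth_N₁

theorem inner_S_ofComp (ξ : ℝ → ℂ) (x : ℝ) : inner ℝ (S x) (ofComp N₁ N₂ ξ x) = 0 := by
  simp [ofComp, inner_add_right, inner_smul_right, h.orthogonal, h.inner_S_N₂]

theorem inner_N₁_ofComp (ξ : ℝ → ℂ) (x : ℝ) :
    inner ℝ (N₁ x) (ofComp N₁ N₂ ξ x) = (ξ x).re := by
  simp only [ofComp, inner_add_right, inner_smul_right, h.inner_N₁_self, h.inner_N₁_N₂]
  ring

theorem inner_N₂_ofComp (ξ : ℝ → ℂ) (x : ℝ) :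
    inner ℝ (N₂ x) (ofComp N₁ N₂ ξ x) = (ξ x).im := by
  simp only [ofComp, inner_add_right, inner_smul_right, h.inner_N₂_self,
    real_inner_comm (N₁ x) (N₂ x), h.inner_N₁_N₂]
  ring

theorem ofComp_inj {ξ η : ℝ → ℂ} {x : ℝ} :
    ofComp N₁ N₂ ξ x = ofComp N₁ N₂ η x ↔ ξ x = η x := by
  refine ⟨fun e => ?_, fun e => by simp only [ofComp, e]⟩
  apply Complex.ext
  · rw [← h.inner_N₁_ofComp, e, h.inner_N₁_ofComp]
  · rw [← h.inner_N₂_ofComp, e, h.inner_N₂_ofComp]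

theorem inner_ofComp (ξ η : ℝ → ℂ) (x : ℝ) :
    inner ℝ (ofComp N₁ N₂ ξ x) (ofComp N₁ N₂ η x) = (star (ξ x) * η x).re := by
  rw [re_star_mul, inner_complex]
  conv_lhs => rw [ofComp]
  rw [inner_add_left, real_inner_smul_left, real_inner_smul_left, h.inner_N₁_ofComp,
    h.inner_N₂_ofComp]

theorem cross_ofComp (ξ : ℝ → ℂ) (x : ℝ) :
    cross (S x) (ofComp N₁ N₂ ξ x) = ofComp N₁ N₂ (fun y => Complex.I * ξ y) x := by
  simp only [ofComp, cross_add_right, cross_smul_right, h.cross_N₂, ← h.oriented]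
  simp [add_comm]

theorem deriv_S_eq (x : ℝ) : deriv S x = ofComp N₁ N₂ u x := h.deriv_S x

theorem inner_deriv_S_ofComp (ξ : ℝ → ℂ) (x : ℝ) :
    inner ℝ (deriv S x) (ofComp N₁ N₂ ξ x) = (u x * star (ξ x)).re := by
  rw [h.deriv_S_eq, h.inner_ofComp, re_star_mul, re_mul_star, real_inner_comm]

theorem hasDerivAt_ofComp {ξ : ℝ → ℂ} {ξ' : ℝ → ℂ} {x : ℝ} (hξ : HasDerivAt ξ (ξ' x) x) :
    HasDerivAt (ofComp N₁ N₂ ξ) (ofComp N₁ N₂ ξ' x - (u x * star (ξ x)).re • S x) x := by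
  have h1 := (h.smooth_N₁.differentiable (by simp) x).hasDerivAt
  have h2 := (h.smooth_N₂.differentiable (by simp) x).hasDerivAt
  rw [h.deriv_N₁] at h1
  rw [h.deriv_N₂] at h2
  have h3 : HasDerivAt (fun y => (ξ y).re) (ξ' x).re x :=
    Complex.reCLM.hasFDerivAt.comp_hasDerivAt x hξ
  have h4 : HasDerivAt (fun y => (ξ y).im) (ξ' x).im x :=
    Complex.imCLM.hasFDerivAt.comp_hasDerivAt x hξ
  refine ((h3.smul h1).add (h4.smul h2)).congr_deriv ?_
  simp only [ofComp, re_mul_star, inner_complex]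
  module

/-- Completeness of the frame: `N₁ ∧ a` is a multiple of `S`, and expanding `N₁ ∧ (N₁ ∧ a)` recovers
`a`. -/
theorem ofComp_inner {a : ℝ → Vec3} (ha : ∀ x, inner ℝ (S x) (a x) = 0) :
    ofComp N₁ N₂ (fun x => ⟨inner ℝ (N₁ x) (a x), inner ℝ (N₂ x) (a x)⟩) = a := by
  funext x
  have h1 : cross (N₁ x) (a x) = inner ℝ (N₂ x) (a x) • S x := by
    rw [cross_eq_smul (h.norm_S x) (h.orthogonal x) (ha x), h.oriented,
      inner_cross_rotate, inner_cross_rotate, real_inner_comm]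
  have h2 := cross_cross_eq (N₁ x) (N₁ x) (a x)
  rw [h1, cross_smul_right, cross_anticomm', ← h.oriented, h.inner_N₁_self, one_smul] at h2
  simp only [ofComp]
  rw [smul_neg] at h2
  rw [← eq_sub_iff_add_eq.1 h2]
  abel

theorem contDiff_ofComp {ξ : ℝ → ℂ} (hξ : ContDiff ℝ ∞ ξ) : ContDiff ℝ ∞ (ofComp N₁ N₂ ξ) :=
  ((Complex.reCLM.contDiff.comp hξ).smul h.smooth_N₁).add
    ((Complex.imCLM.contDiff.comp hξ).smul h.smooth_N₂)

theorem existsUnique_ofComp_iff (a : ℝ → Vec3) :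
    (ContDiff ℝ ∞ a ∧ ∀ x, inner ℝ (S x) (a x) = 0) ↔
      ∃! ξ : ℝ → ℂ, ContDiff ℝ ∞ ξ ∧ ofComp N₁ N₂ ξ = a := by
  constructor
  · rintro ⟨h1, h2⟩
    refine ⟨_, ⟨?_, h.ofComp_inner h2⟩, fun ξ hξ => funext fun x => ?_⟩
    · have : (fun x => (⟨inner ℝ (N₁ x) (a x), inner ℝ (N₂ x) (a x)⟩ : ℂ))
          = fun x => Complex.equivRealProdCLM.symm (inner ℝ (N₁ x) (a x), inner ℝ (N₂ x) (a x)) := rfl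
      rw [this]
      exact Complex.equivRealProdCLM.symm.contDiff.comp
        ((h.smooth_N₁.inner ℝ h1).prodMk (h.smooth_N₂.inner ℝ h1))
    · refine (h.ofComp_inj (η := fun x => ⟨inner ℝ (N₁ x) (a x), inner ℝ (N₂ x) (a x)⟩)).1 ?_
      rw [hξ.2, h.ofComp_inner h2]
  · rintro ⟨ξ, ⟨h1, rfl⟩, -⟩
    exact ⟨h.contDiff_ofComp h1, h.inner_S_ofComp ξ⟩

/-- The sign reflects that `-ℐ⁻¹ = -i` corresponds to `-S ∧`. As `sphereJ` unfolds to `cross`, this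
settles `J` too. -/
theorem spinOp₁_iff (ξ η : ℝ → ℂ) (p : ℝ → ℝ) :
    spinOp₁ S (ofComp N₁ N₂ ξ) p (fun x => -ofComp N₁ N₂ η x) ↔ uOp₁ u ξ p η := by
  refine forall_congr' fun x => ?_
  rw [h.cross_ofComp, neg_opI_inv, neg_eq_iff_eq_neg]
  have : -ofComp N₁ N₂ (fun y => Complex.I * ξ y) x
      = ofComp N₁ N₂ (fun y => -Complex.I * ξ y) x := by
    simp only [ofComp, neg_mul, Complex.neg_re, Complex.neg_im]; module
  rw [this, h.ofComp_inj]

/-- In a parallel frame `D_x` acts on components apart from the normal term `-Re(u ξ̄) S`, which the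
term `S S_x·` cancels. -/
theorem spinOp₂_iff {ξ : ℝ → ℂ} (η : ℝ → ℂ) (p : ℝ → ℝ) (hξ : ContDiff ℝ ∞ ξ) :
    spinOp₂ S (ofComp N₁ N₂ ξ) p (ofComp N₁ N₂ η) ↔ uOp₂ u ξ p η := by
  refine and_congr (forall_congr' fun x => by rw [h.inner_deriv_S_ofComp])
    (forall_congr' fun x => ?_)
  have h1 := (h.hasDerivAt_ofComp (ξ' := deriv ξ)
    (hξ.differentiable (by simp) x).hasDerivAt).deriv
  rw [h1, h.inner_deriv_S_ofComp, sub_add_cancel, h.deriv_S_eq]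
  have : ofComp N₁ N₂ (deriv ξ) x + p x • ofComp N₁ N₂ u x
      = ofComp N₁ N₂ (fun x => deriv ξ x + u x * (p x : ℂ)) x := by
    simp [ofComp]; module
  rw [this, h.ofComp_inj]

theorem mapOp₂_iff {ξ : ℝ → ℂ} (η : ℝ → ℂ) (p : ℝ → ℝ) (hξ : ContDiff ℝ ∞ ξ) :
    mapOp₂ S (ofComp N₁ N₂ ξ) p (ofComp N₁ N₂ η) ↔ uOp₂ u ξ p η := by
  rw [← h.spinOp₂_iff η p hξ]
  refine and_congr Iff.rfl (forall_congr' fun x => ?_)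
  have h1 := (h.hasDerivAt_ofComp (ξ' := deriv ξ)
    (hξ.differentiable (by simp) x).hasDerivAt).deriv
  have h2 : inner ℝ (S x) (S x) = (1 : ℝ) := by
    rw [real_inner_self_eq_norm_sq, h.norm_S]; simp
  rw [h1, h.inner_deriv_S_ofComp, sub_add_cancel, tproj, inner_sub_right, h.inner_S_ofComp,
    inner_smul_right, h2, mul_one, zero_sub, neg_smul, sub_neg_eq_add, sub_add_cancel]

/-- Flows and densities are matched in one induction. The densities are compared through their
common quadratic recursion rather than as primitives, so no integration constants have to be
compared between the two jet spaces. -/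
theorem ofComp_uGrad (n : ℕ) (x : ℝ) :
    totalD (spinM n) x (jet S x) = ofComp N₁ N₂ (ev (uGrad n) u) x ∧
    spinH n x (jet S x) = uH n x (jet u x) := by
  induction n using Nat.strong_induction_on generalizing x with
  | _ n ih =>
    have hS := h.mem_sphereCurves
    have hu : u ∈ uCurves := h.smooth_u
    constructor
    · cases n with
      | zero =>
        rw [spinM_zero, totalD_coord]
        have : ev (uGrad 0) u = u := by funext y; simp [ev, uGrad, jet_zero]
        rw [this, ← h.deriv_S_eq, ← jet_one]
      | succ n =>
        rw [totalD_spinM_succ hS, (ih n (by omega) x).2]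
        have h1 : ev (totalD (spinM n)) S = ofComp N₁ N₂ (ev (uGrad n) u) :=
          funext fun y => (ih n (by omega) y).1
        have h2 := hasDerivAt_ev (isDFun_spinM n).totalD h.smooth_S x
        rw [h1] at h2
        have h3 : HasDerivAt (ev (uGrad n) u) (ev (totalD (uGrad n)) u x) x :=
          hasDerivAt_ev (isDFun_uGrad n) hu x
        have h4 : totalD (totalD (spinM n)) x (jet S x) = _ := h2.unique (h.hasDerivAt_ofComp h3)
        have h5 : cross (S x) (S x) = 0 := cross_self_eq_zero _
        rw [h4, jet_zero, jet_one, cross_sub_right, cross_smul_right, h5, smul_zero, sub_zero,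
          h.cross_ofComp, h.deriv_S_eq]
        have h6 : ∀ y, ev (uGrad (n + 1)) u y
            = Complex.I * ev (totalD (uGrad n)) u y - u y * (uH n y (jet u y) : ℂ) := by
          intro y
          rw [ev, ev, totalD_uGrad (isInvD_uH n) hu, jet_zero]
          linear_combination (uGrad (n + 1) y (jet u y) + u y * uH n y (jet u y))
            * Complex.I_mul_I
        rw [funext h6]
        simp [ofComp]
        module
    · rw [spinH_eq_sum hS, uH_eq]
      simp only
      congr 1
      refine Finset.sum_congr rfl fun i hi => ?_
      rw [Finset.mem_range] at hi
      obtain ⟨h1, h2⟩ := ih i hi x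
      obtain ⟨h3, h4⟩ := ih (n - 1 - i) (by omega) x
      rw [h1, h2, h3, h4, h.inner_ofComp, re_star_mul]
      rfl

theorem ev_totalD_spinM (n : ℕ) :
    ev (totalD (spinM n)) S = ofComp N₁ N₂ (ev (uGrad n) u) :=
  funext fun x => (h.ofComp_uGrad n x).1

theorem ev_spinFlow (n : ℕ) : ev (spinFlow n) S = ofComp N₁ N₂ (ev (uGrad n) u) := by
  rw [(spinFlow_spec n).2 S h.mem_sphereCurves, h.ev_totalD_spinM]

theorem ev_varS_of_eqAlong {F : DFun Vec3 ℝ} (hF : IsDFun F) {n : ℕ}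
    (hFn : EqAlong sphereCurves F fun x s => ((n : ℝ) + 1)⁻¹ * spinH (n + 1) x s) :
    ev (varS F) S = ofComp N₁ N₂ (fun x => -(opI * ev (uGrad (n + 1)) u x)) := by
  rw [SpinHierarchy.ev_varS_of_eqAlong hF hFn h.mem_sphereCurves, h.ev_totalD_spinM]
  funext x
  rw [h.cross_ofComp]
  simp only [opI, neg_mul, neg_neg]

end IsParallelFrame

/-! ### The Hamiltonian structures of the hierarchies -/

section HamiltonianStructures

variable {F : DFun Vec3 ℝ} {n : ℕ}

/-- The integrals of the variational derivatives of the Hamiltonians. -/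
theorem isInvD_varS (hF : IsDFun F)
    (hFn : EqAlong sphereCurves F fun x s => ((n : ℝ) + 1)⁻¹ * spinH (n + 1) x s) :
    IsInvD sphereCurves sphereVacuum (fun x s => inner ℝ (s 1) (varS F x s))
      (fun x s => -spinH (n + 1) x s) := by
  have h1 := isInvD_spinH (n + 1) (f := totalD (spinM (n + 1))) fun _ _ => rfl
  refine ⟨⟨(isDFun_spinH _).neg, fun S hS x => ?_⟩, fun c hc x => ?_⟩
  · refine (h1.1.2 S hS x).neg.congr_deriv ?_
    have h2 := congrFun (ev_varS_of_eqAlong hF hFn hS) x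
    simp only [ev] at h2 ⊢
    rw [h2, jet_zero, inner_cross_comm, real_inner_comm, inner_cross_rotate]
  · have := h1.2 c hc x
    simp only [ev] at this ⊢
    rw [this, neg_zero]

theorem neg_cross_varS (hF : IsDFun F)
    (hFn : EqAlong sphereCurves F fun x s => ((n : ℝ) + 1)⁻¹ * spinH (n + 1) x s) :
    EqAlong sphereCurves (fun x s => -cross (s 0) (varS F x s)) (spinFlow (n + 1)) := by
  intro S hS
  rw [(spinFlow_spec (n + 1)).2 S hS]
  funext x
  have h2 := congrFun (ev_varS_of_eqAlong hF hFn hS) x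
  simp only [ev] at h2 ⊢
  rw [h2, ← jet_zero S, cross_cross_self (norm_jet_zero hS x) (inner_totalD_spinM hS x _), neg_neg]

/-- The gradient is `S ∧ f^{(n+1)}` and the integral is `-h_{n+1}`, so together they form the next
coefficient of `m`; one more `D_x` gives the flow. -/
theorem varS_add_eqAlong (hF : IsDFun F)
    (hFn : EqAlong sphereCurves F fun x s => ((n : ℝ) + 1)⁻¹ * spinH (n + 1) x s) :
    EqAlong sphereCurves
      (fun x s => varS F x s + spinInvD (fun y r => inner ℝ (r 1) (varS F y r)) x s • s 0)
      (spinM (n + 2)) := by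
  intro S hS
  funext x
  have h2 := congrFun (ev_varS_of_eqAlong hF hFn hS) x
  have h3 := congrFun (invD_eqAlong sphere_deformation (isInvD_varS hF hFn) S hS) x
  simp only [ev, spinInvD] at h2 h3 ⊢
  rw [h2, h3, spinM_succ_eq (norm_jet_zero hS x), jet_zero, neg_smul, sub_eq_add_neg]

theorem totalD_varS_add (hF : IsDFun F)
    (hFn : EqAlong sphereCurves F fun x s => ((n : ℝ) + 1)⁻¹ * spinH (n + 1) x s) :
    EqAlong sphereCurves
      (totalD fun x s => varS F x s
        + spinInvD (fun y r => inner ℝ (r 1) (varS F y r)) x s • s 0)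
      (spinFlow (n + 2)) := by
  intro S hS
  rw [(spinFlow_spec (n + 2)).2 S hS]
  exact ev_totalD_congr (hF.varS.add ((invD_spec ⟨_, isInvD_varS hF hFn⟩).1.1.smul
    (IsDFun.coord 0))) (isDFun_spinM _) hS.1 (varS_add_eqAlong hF hFn S hS)

/-- Differs from `totalD_varS_add` by a normal vector only; that vector is zero because the flow is
tangent. -/
theorem covD_varS_add (hF : IsDFun F)
    (hFn : EqAlong sphereCurves F fun x s => ((n : ℝ) + 1)⁻¹ * spinH (n + 1) x s) :
    EqAlong sphereCurves
      (fun x s => covD (varS F) x s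
        + spinInvD (fun y r => inner ℝ (r 1) (varS F y r)) x s • s 1)
      (spinFlow (n + 2)) := by
  intro S hS
  rw [← totalD_varS_add hF hFn S hS]
  have hp := (invD_spec ⟨_, isInvD_varS hF hFn⟩).1.1
  set p := spinInvD (fun y r => inner ℝ (r 1) (varS F y r)) with hpdef
  have hp : IsDFun p := hp
  funext x
  have h1 := congrFun (totalD_varS_add hF hFn S hS) x
  have h2 := congrFun ((spinFlow_spec (n + 2)).2 S hS) x
  have h3 := inner_totalD_spinM hS x (n + 2)
  have h4 : totalD (fun x s => varS F x s + p x s • s 0) x (jet S x)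
      = totalD (varS F) x (jet S x)
        + (totalD p x (jet S x) • jet S x 0 + p x (jet S x) • jet S x 1) := by
    simp only [totalD_eq_lieD]
    rw [lieD_add hF.varS (hp.smul (IsDFun.coord 0)), lieD_smul hp (IsDFun.coord 0), lieD_coord]
  have h5 : inner ℝ (jet S x 0) (jet S x 0) = (1 : ℝ) := by
    rw [real_inner_self_eq_norm_sq, norm_jet_zero hS]; simp
  simp only [ev] at h1 h2 ⊢
  rw [← hpdef, h4] at h1
  rw [← h2, ← h1, inner_add_right, inner_add_right, inner_smul_right, inner_smul_right, h5,
    inner_jet_zero_one hS, mul_zero, add_zero, mul_one] at h3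
  rw [h4, covD, tproj, eq_neg_of_add_eq_zero_left h3]
  module

end HamiltonianStructures

end SpinHierarchy

end

/-! ### Assembly of the theorem -/

theorem mainTheorem4 :
    -- the hierarchy of vector models and its densities are well defined
    (∀ n : ℕ, IsDFun (spinFlow n) ∧ IsDFun (spinHam n) ∧
      HasSpinInvD (fun x s => inner ℝ (cross (s 0) (s 1)) (spinFlow n x s)) ∧
      HasSpinInvD (fun x s => inner ℝ (s 1) (totalD (spinFlow n) x s)) ∧
      HasSpinInvD (fun x s => inner ℝ (s 1) (varS (spinHam n) x s))) ∧
    -- first Hamiltonian structure of the vector models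
    (∀ n : ℕ, 1 ≤ n → EqAlong sphereCurves
      (fun x s => -cross (s 0) (varS (spinHam (n - 1)) x s)) (spinFlow n)) ∧
    -- second Hamiltonian structure of the vector models
    (∀ n : ℕ, 2 ≤ n → EqAlong sphereCurves
      (totalD (fun x s => varS (spinHam (n - 2)) x s +
        spinInvD (fun y r => inner ℝ (r 1) (varS (spinHam (n - 2)) y r)) x s • s 0))
      (spinFlow n)) ∧
    CompatibleHamiltonian spinOp₁ spinOp₂ ∧
    -- the hierarchy of dynamical maps and its densities are well defined
    (∀ n : ℕ, IsDFun (mapFlow n) ∧ IsDFun (mapHam n) ∧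
      HasSpinInvD (fun x s => inner ℝ (sphereJ (s 0) (s 1)) (mapFlow n x s)) ∧
      HasSpinInvD (fun x s => inner ℝ (s 1) (covD (mapFlow n) x s)) ∧
      HasSpinInvD (fun x s => inner ℝ (s 1) (varS (mapHam n) x s))) ∧
    -- first Hamiltonian structure of the dynamical maps
    (∀ n : ℕ, 1 ≤ n → EqAlong sphereCurves
      (fun x s => -sphereJ (s 0) (varS (mapHam (n - 1)) x s)) (mapFlow n)) ∧
    -- second Hamiltonian structure of the dynamical maps
    (∀ n : ℕ, 2 ≤ n → EqAlong sphereCurves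
      (fun x s => covD (varS (mapHam (n - 2))) x s +
        spinInvD (fun y r => inner ℝ (r 1) (varS (mapHam (n - 2)) y r)) x s • s 1)
      (mapFlow n)) ∧
    CompatibleHamiltonian mapOp₁ mapOp₂ ∧
    -- the symplectic pair with respect to the flow variable `u`
    (∀ (u ξ : ℝ → ℂ) (p : ℝ → ℝ) (η : ℝ → ℂ),
      uOp₂ u ξ p η ↔ uRecStar u (fun x => opI⁻¹ * ξ x) p (fun x => -η x)) ∧
    CompatibleSymplectic uOp₁ uOp₂ ∧
    -- the hierarchy in terms of `u` is well defined
    (∀ n : ℕ, IsDFun (uGrad n) ∧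
      HasUInvD (fun x s => (Complex.I * s 0 * star (uGrad n x s)).re)) ∧
    -- in a parallel frame, the Hamiltonian pairs become the symplectic pair
    (∀ (S N₁ N₂ : ℝ → Vec3) (u : ℝ → ℂ), IsParallelFrame S N₁ N₂ u →
      (∀ a : ℝ → Vec3, (ContDiff ℝ ∞ a ∧ ∀ x, inner ℝ (S x) (a x) = 0) ↔
        ∃! ξ : ℝ → ℂ, ContDiff ℝ ∞ ξ ∧ ofComp N₁ N₂ ξ = a) ∧
      (∀ (ξ η : ℝ → ℂ) (x : ℝ),
        inner ℝ (ofComp N₁ N₂ ξ x) (ofComp N₁ N₂ η x) = (star (ξ x) * η x).re) ∧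
      (∀ (ξ η : ℝ → ℂ) (p : ℝ → ℝ), ContDiff ℝ ∞ ξ →
        (spinOp₁ S (ofComp N₁ N₂ ξ) p (fun x => -ofComp N₁ N₂ η x) ↔ uOp₁ u ξ p η) ∧
        (spinOp₂ S (ofComp N₁ N₂ ξ) p (ofComp N₁ N₂ η) ↔ uOp₂ u ξ p η) ∧
        (mapOp₁ S (ofComp N₁ N₂ ξ) p (fun x => -ofComp N₁ N₂ η x) ↔ uOp₁ u ξ p η) ∧
        (mapOp₂ S (ofComp N₁ N₂ ξ) p (ofComp N₁ N₂ η) ↔ uOp₂ u ξ p η)) ∧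
      -- flows and gradients of the hierarchies correspond as well
      (∀ n : ℕ,
        ev (spinFlow n) S = ofComp N₁ N₂ (ev (uGrad n) u) ∧
        ev (mapFlow n) S = ofComp N₁ N₂ (ev (uGrad n) u) ∧
        ev (varS (spinHam n)) S
          = ofComp N₁ N₂ (fun x => -(opI * ev (uGrad (n + 1)) u x)) ∧
        ev (varS (mapHam n)) S
          = ofComp N₁ N₂ (fun x => -(opI * ev (uGrad (n + 1)) u x)))) := by
  refine ⟨fun n => ⟨(spinFlow_spec n).1, (spinHam_spec n).1,
      ⟨_, isInvD_spinH n (spinFlow_spec n).2⟩, ⟨_, isInvD_spinHam n⟩,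
      ⟨_, isInvD_varS (spinHam_spec n).1 (spinHam_spec n).2⟩⟩,
    fun n hn => ?_, fun n hn => ?_, compatibleHamiltonian_spinOp,
    fun n => ⟨?_, (mapHam_spec n).1, ⟨spinH n, ?_⟩, ⟨_, isInvD_mapHam n⟩,
      ⟨_, isInvD_varS (mapHam_spec n).1 (mapHam_spec n).2⟩⟩,
    fun n hn => ?_, fun n hn => ?_, compatibleHamiltonian_mapOp, uOp₂_iff_uRecStar,
    compatibleSymplectic_uOp, fun n => ⟨isDFun_uGrad n, _, isInvD_uH n⟩,
    fun S N₁ N₂ u h => ⟨h.existsUnique_ofComp_iff, h.inner_ofComp,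
      fun ξ η p hξ => ⟨h.spinOp₁_iff ξ η p, h.spinOp₂_iff η p hξ, h.spinOp₁_iff ξ η p,
        h.mapOp₂_iff η p hξ⟩,
      fun n => ⟨h.ev_spinFlow n, ?_, h.ev_varS_of_eqAlong (spinHam_spec n).1 (spinHam_spec n).2,
        h.ev_varS_of_eqAlong (mapHam_spec n).1 (mapHam_spec n).2⟩⟩⟩
  · obtain ⟨m, rfl⟩ : ∃ m, n = m + 1 := ⟨n - 1, by omega⟩
    exact neg_cross_varS (spinHam_spec m).1 (spinHam_spec m).2
  · obtain ⟨m, rfl⟩ : ∃ m, n = m + 2 := ⟨n - 2, by omega⟩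
    exact totalD_varS_add (spinHam_spec m).1 (spinHam_spec m).2
  · rw [mapFlow_eq]
    exact (spinFlow_spec n).1
  · rw [mapFlow_eq]
    exact isInvD_spinH n (spinFlow_spec n).2
  · obtain ⟨m, rfl⟩ : ∃ m, n = m + 1 := ⟨n - 1, by omega⟩
    rw [mapFlow_eq]
    exact neg_cross_varS (mapHam_spec m).1 (mapHam_spec m).2
  · obtain ⟨m, rfl⟩ : ∃ m, n = m + 2 := ⟨n - 2, by omega⟩
    rw [mapFlow_eq]
    exact covD_varS_add (mapHam_spec m).1 (mapHam_spec m).2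
  · rw [mapFlow_eq]
    exact h.ev_spinFlow n
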